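/- **Theorem 2 (well-posedness).** Let $\Omega\subset\mathbb R^3$ be a bounded open set. Indices run over $1,2,3$, repeated indices are summed, $_{,j}$ is a partial derivative in the sense of distributions, $e_{ij}=\frac12(u_{i,j}+u_{j,i})$. Let $\rho,c,c_{ij},a_{ij},b_{ij},d_{ij},K_{ij},\tilde K_{ij},A_{ijkl},B_{ijkl},C_{ijkl},\tilde C_{ijkl}$ be real functions in $L^\infty(\Omega)$, with $c$ and the matrix $(c_{ij})$ uniformly positive (i.e. $c\ge r$ and $c_{ij}\xi_i\xi_j\ge r\,\xi_i\xi_i$ a.e. for all $\xi\in\mathbb R^3$, for some $r>0$). Assume: (i) a.e. in $\Omega$, $A_{ijkl}=A_{jikl}=A_{klij}$, $B_{ijkl}=B_{jikl}=B_{klij}$, $C_{ijkl}=C_{jikl}=C_{klij}$, $\tilde C_{ijkl}=\tilde C_{klij}$, and $a_{ij},b_{ij},c_{ij},d_{ij},K_{ij},\tilde K_{ij}$ are symmetric; (ii) $\rho\ge r$ a.e. for some constant $r>0$, and a.e. in $\Omega$, for all $\xi_i$ and $X_{ij}$, $\tilde K_{ij}\xi_i\xi_j+\tilde C_{ijkl}X_{lk}X_{ij}\ge0$;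 (iii) there is $c_0>0$ such that for all $u\in[W_0^{1,2}(\Omega)]^3$, $\tau\in W_0^{1,2}(\Omega)$, $R\in[W_0^{1,2}(\Omega)]^3$ $$\int_\Omega\big(A_{ijkl}e_{kl}e_{ij}+2B_{ijkl}e_{ij}R_{k,l}+K_{ij}\tau_{,i}\tau_{,j}+C_{ijkl}R_{i,j}R_{k,l}\big)dv\ge c_0\int_\Omega\big(e_{ij}e_{ij}+\tau_{,i}\tau_{,i}+R_{i,j}R_{i,j}\big)dv .$$ Let $\mathscr H$ be the space of all $\mathcal U=(u,v,\tau,\theta,R,M)$ with $u,R\in[W_0^{1,2}]^3$, $\tau\in W_0^{1,2}$, $v,M\in[L^2]^3$, $\theta\in L^2$, with $$\langle\mathcal U,\mathcal U^*\rangle=\tfrac12\int_\Omega\big(\rho v_iv_i^*+c\theta\theta^*+c_{ij}M_iM_j^*+A_{ijkl}e_{kl}e^*_{ij}+B_{ijkl}(e_{ij}R^*_{k,l}+e^*_{ij}R_{k,l})+K_{ij}\tau_{,i}\tau^*_{,j}+C_{ijkl}R_{i,j}R^*_{k,l}\big)dv,$$ $\|\mathcal U\|_{\mathscr H}=\langle\mathcal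 U,\mathcal U\rangle^{1/2}$. Let $(\ell_{ij})$ be the inverse matrix of $(c_{ij})$, and let $\mathscr A\mathcal U=(v,g,\theta,h,M,k)$ with $$\rho g_i=(A_{jikl}e_{kl}-a_{ji}\theta+B_{jikl}R_{l,k})_{,j},\qquad c\,h=-a_{ij}v_{i,j}+(-d_{ij}M_j+K_{ij}\tau_{,j}+\tilde K_{ij}\theta_{,j})_{,i}-b_{ij}M_{i,j},$$ $$c_{ij}k_j=(B_{klji}e_{kl}-b_{ji}\theta+C_{jikl}R_{k,l}+\tilde C_{jikl}M_{k,l})_{,j}-d_{ij}\theta_{,j},$$ on $\mathscr D(\mathscr A)=\{\mathcal U\in\mathscr H:\ \mathscr A\mathcal U\in\mathscr H\}$ with the graph norm. Let $f_i,s,Q_i\in C^1([0,\infty),L^2(\Omega))\cap C^0([0,\infty),W_0^{1,2}(\Omega))$, $\mathcal F=(0,f_i,0,c^{-1}\rho s,0,\ell_{ij}\rho Q_j)$ and $\mathcal U_0\in\mathscr D(\mathscr A)$. Then $\|\cdot\|_{\mathscr H}$ is equivalent to the usual norm of $[W_0^{1,2}]^3\times[L^2]^3\times W_0^{1,2}\times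 L^2\times[W_0^{1,2}]^3\times[L^2]^3$, and the Cauchy problem $$\frac{d\mathcal U}{dt}=\mathscr A\mathcal U+\mathcal F,\qquad\mathcal U(0)=\mathcal U_0,$$ has a unique solution $\mathcal U\in C^1([0,\infty),\mathscr H)\cap C^0([0,\infty),\mathscr D(\mathscr A))$. For all $t\ge0$, $$\|\mathcal U(t)\|_{\mathscr H}\le\|\mathcal U_0\|_{\mathscr H}+\int_0^t\|\mathcal F(\xi)\|_{\mathscr H}\,d\xi ,$$ and there is a constant $C>0$, depending only on $\Omega$ and the coefficients, such that for all such data and all $t\ge0$ $$\|\mathcal U(t)\|_{\mathscr H}\le\|\mathcal U_0\|_{\mathscr H}+C\int_0^t\big(\|f(\xi)\|_{L^2}+\|s(\xi)\|_{L^2}+\|Q(\xi)\|_{L^2}\big)d\xi .$$ The solution depends continuously on the initial data and the loads: if $\mathcal U,\mathcal U'$ are the solutions for the data $(\mathcal U_0,f,s,Q)$ and $(\mathcal U_0',f',s',Q')$, then, with the same $C$, for all $t\ge 0$, $$\|\mathcal U(t)-\mathcal U'(t)\|_{\mathscr H}\le\|\mathcal U_0-\mathcal U_0'\|_{\mathscr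 H}+C\int_0^t\big(\|f-f'\|_{L^2}+\|s-s'\|_{L^2}+\|Q-Q'\|_{L^2}\big)d\xi .$$ -/

import Mathlib

open MeasureTheory Set
open scoped ContDiff ENNReal

namespace MicroTherm

/-- Three-dimensional Euclidean space. -/
abbrev E3 : Type := EuclideanSpace ℝ (Fin 3)

/-- Lebesgue measure on `Ω`. -/
noncomputable abbrev vol (Ω : Set E3) : Measure E3 := volume.restrict Ω

/-- The real Hilbert space `L²(Ω)`. -/
abbrev L2 (Ω : Set E3) : Type := Lp ℝ 2 (vol Ω)

/-- `𝐋²(Ω) = [L²(Ω)]³`, with norm `(∫ v_i v_i)^{1/2}`. -/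
abbrev L2v (Ω : Set E3) : Type := PiLp 2 (fun _ : Fin 3 => L2 Ω)

/-- The partial derivative `φ_{,i}` of a smooth function. -/
noncomputable def pd (i : Fin 3) (φ : E3 → ℝ) (x : E3) : ℝ :=
  fderiv ℝ φ x (EuclideanSpace.single i 1)

/-- Test functions: `φ ∈ C_c^∞(Ω)`. -/
structure IsTest (Ω : Set E3) (φ : E3 → ℝ) : Prop where
  smooth : ContDiff ℝ ∞ φ
  compact : HasCompactSupport φ
  supp : tsupport φ ⊆ Ω

/-- Pairs `(w, g) ∈ L² × (L²)³` with the norm `(‖w‖² + ∑ ‖g_i‖²)^{1/2}`, in which `W^{1,2}(Ω)` sits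
isometrically as the set of all `(w, ∇w)`. -/
abbrev Jet (Ω : Set E3) : Type := WithLp 2 (L2 Ω × L2v Ω)

/-- `W_0^{1,2}(Ω)`: the closure of `C_c^∞(Ω)` in the `W^{1,2}`-norm. An element is stored together
with its weak gradient, as the limit of pairs `(φ, ∇φ)`. -/
noncomputable def W0sub (Ω : Set E3) : Submodule ℝ (Jet Ω) :=
  (Submodule.span ℝ {w : Jet Ω | ∃ φ : E3 → ℝ, IsTest Ω φ ∧
    (w.fst =ᵐ[vol Ω] φ) ∧ ∀ i, w.snd i =ᵐ[vol Ω] pd i φ}).topologicalClosure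

/-- The Hilbert space `W_0^{1,2}(Ω)`. -/
abbrev W0 (Ω : Set E3) : Type := W0sub Ω

/-- `𝐖_0^{1,2}(Ω) = [W_0^{1,2}(Ω)]³`. -/
abbrev W0v (Ω : Set E3) : Type := PiLp 2 (fun _ : Fin 3 => W0 Ω)

/-- The underlying `L²` function of an element of `W_0^{1,2}(Ω)`. -/
noncomputable def val {Ω : Set E3} (w : W0 Ω) : L2 Ω := (w : Jet Ω).fst

/-- The weak partial derivative `w_{,i}` of an element of `W_0^{1,2}(Ω)`. -/
noncomputable def grad {Ω : Set E3} (w : W0 Ω) (i : Fin 3) : L2 Ω := (w : Jet Ω).snd i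

/-- The underlying `𝐋²` field of an element of `𝐖_0^{1,2}(Ω)`. -/
noncomputable def valv {Ω : Set E3} (w : W0v Ω) : L2v Ω := WithLp.toLp 2 fun i => val (w i)

/-- The strain `e_{ij}(u) = (u_{i,j} + u_{j,i}) / 2`. -/
noncomputable def strain {Ω : Set E3} (u : W0v Ω) (i j : Fin 3) (x : E3) : ℝ :=
  (grad (u i) j x + grad (u j) i x) / 2

/-- The space `ℋ` of states `(u, v, τ, θ, R, M)`, as a topological vector space. -/
abbrev State (Ω : Set E3) : Type := W0v Ω × L2v Ω × W0 Ω × L2 Ω × W0v Ω × L2v Ω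

section components

variable {Ω : Set E3}

/-- Displacement. -/
def cu (U : State Ω) : W0v Ω := U.1
/-- Velocity. -/
def cv (U : State Ω) : L2v Ω := U.2.1
/-- Thermal displacement. -/
def cτ (U : State Ω) : W0 Ω := U.2.2.1
/-- Temperature. -/
def cθ (U : State Ω) : L2 Ω := U.2.2.2.1
/-- Microtemperature displacement. -/
def cR (U : State Ω) : W0v Ω := U.2.2.2.2.1
/-- Microtemperatures. -/
def cM (U : State Ω) : L2v Ω := U.2.2.2.2.2

end components

/-- The (space dependent) constitutive coefficients. `kap` is the tensor `c_{ij}`; `Kt` and `Ct` are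
the type III tensors `K̃_{ij}` and `C̃_{ijkl}`. -/
structure Material where
  ρ : E3 → ℝ
  c : E3 → ℝ
  kap : Fin 3 → Fin 3 → E3 → ℝ
  a : Fin 3 → Fin 3 → E3 → ℝ
  b : Fin 3 → Fin 3 → E3 → ℝ
  d : Fin 3 → Fin 3 → E3 → ℝ
  K : Fin 3 → Fin 3 → E3 → ℝ
  Kt : Fin 3 → Fin 3 → E3 → ℝ
  A : Fin 3 → Fin 3 → Fin 3 → Fin 3 → E3 → ℝ
  B : Fin 3 → Fin 3 → Fin 3 → Fin 3 → E3 → ℝ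
  C : Fin 3 → Fin 3 → Fin 3 → Fin 3 → E3 → ℝ
  Ct : Fin 3 → Fin 3 → Fin 3 → Fin 3 → E3 → ℝ

namespace Material

/-- Standing assumptions: bounded measurable coefficients, with `c` and `c_{ij}` uniformly positive
(so that `c⁻¹`, the inverse of `c_{ij}` and the kinetic part of the inner product make sense). -/
structure Regular (m : Material) (Ω : Set E3) : Prop where
  ρ_bdd : MemLp m.ρ ∞ (vol Ω)
  c_bdd : MemLp m.c ∞ (vol Ω)
  kap_bdd : ∀ i j, MemLp (m.kap i j) ∞ (vol Ω)
  a_bdd : ∀ i j, MemLp (m.a i j) ∞ (vol Ω)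
  b_bdd : ∀ i j, MemLp (m.b i j) ∞ (vol Ω)
  d_bdd : ∀ i j, MemLp (m.d i j) ∞ (vol Ω)
  K_bdd : ∀ i j, MemLp (m.K i j) ∞ (vol Ω)
  Kt_bdd : ∀ i j, MemLp (m.Kt i j) ∞ (vol Ω)
  A_bdd : ∀ i j k l, MemLp (m.A i j k l) ∞ (vol Ω)
  B_bdd : ∀ i j k l, MemLp (m.B i j k l) ∞ (vol Ω)
  C_bdd : ∀ i j k l, MemLp (m.C i j k l) ∞ (vol Ω)
  Ct_bdd : ∀ i j k l, MemLp (m.Ct i j k l) ∞ (vol Ω)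
  c_pos : ∃ r : ℝ, 0 < r ∧ ∀ᵐ x ∂(vol Ω), r ≤ m.c x
  kap_pos : ∃ r : ℝ, 0 < r ∧ ∀ᵐ x ∂(vol Ω), ∀ ξ : Fin 3 → ℝ,
    r * ∑ i, ξ i * ξ i ≤ ∑ i, ∑ j, m.kap i j x * ξ i * ξ j

/-- The symmetry relations of the coefficients. -/
structure Symmetric (m : Material) (Ω : Set E3) : Prop where
  A_minor : ∀ᵐ x ∂(vol Ω), ∀ i j k l, m.A i j k l x = m.A j i k l x
  A_major : ∀ᵐ x ∂(vol Ω), ∀ i j k l, m.A i j k l x = m.A k l i j x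
  B_minor : ∀ᵐ x ∂(vol Ω), ∀ i j k l, m.B i j k l x = m.B j i k l x
  B_major : ∀ᵐ x ∂(vol Ω), ∀ i j k l, m.B i j k l x = m.B k l i j x
  C_minor : ∀ᵐ x ∂(vol Ω), ∀ i j k l, m.C i j k l x = m.C j i k l x
  C_major : ∀ᵐ x ∂(vol Ω), ∀ i j k l, m.C i j k l x = m.C k l i j x
  Ct_major : ∀ᵐ x ∂(vol Ω), ∀ i j k l, m.Ct i j k l x = m.Ct k l i j x
  kap_symm : ∀ᵐ x ∂(vol Ω), ∀ i j, m.kap i j x = m.kap j i x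
  a_symm : ∀ᵐ x ∂(vol Ω), ∀ i j, m.a i j x = m.a j i x
  b_symm : ∀ᵐ x ∂(vol Ω), ∀ i j, m.b i j x = m.b j i x
  d_symm : ∀ᵐ x ∂(vol Ω), ∀ i j, m.d i j x = m.d j i x
  K_symm : ∀ᵐ x ∂(vol Ω), ∀ i j, m.K i j x = m.K j i x
  Kt_symm : ∀ᵐ x ∂(vol Ω), ∀ i j, m.Kt i j x = m.Kt j i x

/-- Positive density (bounded away from zero) and non-negative dissipation
`K̃_{ij} θ_{,i} θ_{,j} + C̃_{ijkl} M_{l,k} M_{i,j} ≥ 0` (`ξ i` stands for `θ_{,i}`, `X i j` for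
`M_{i,j}`). -/
structure Dissipative (m : Material) (Ω : Set E3) : Prop where
  ρ_pos : ∃ r : ℝ, 0 < r ∧ ∀ᵐ x ∂(vol Ω), r ≤ m.ρ x
  dissipation : ∀ᵐ x ∂(vol Ω), ∀ (ξ : Fin 3 → ℝ) (X : Fin 3 → Fin 3 → ℝ),
    0 ≤ (∑ i, ∑ j, m.Kt i j x * ξ i * ξ j)
      + ∑ i, ∑ j, ∑ k, ∑ l, m.Ct i j k l x * X l k * X i j

variable {Ω : Set E3}

/-- The density `2𝒲[(u, τ, R), (u', τ', R')]` at the point `x`. -/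
noncomputable def twoW (m : Material) (u : W0v Ω) (τ : W0 Ω) (R : W0v Ω)
    (u' : W0v Ω) (τ' : W0 Ω) (R' : W0v Ω) (x : E3) : ℝ :=
  (∑ i, ∑ j, ∑ k, ∑ l, m.A i j k l x * strain u k l x * strain u' i j x)
  + (∑ i, ∑ j, ∑ k, ∑ l, m.B i j k l x *
      (strain u i j x * grad (R' k) l x + strain u' i j x * grad (R k) l x))
  + (∑ i, ∑ j, m.K i j x * grad τ i x * grad τ' j x)
  + ∑ i, ∑ j, ∑ k, ∑ l, m.C i j k l x * grad (R i) j x * grad (R' k) l x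

/-- Coercivity of the stored energy on `𝐖_0^{1,2} × W_0^{1,2} × 𝐖_0^{1,2}`. -/
def Coercive (m : Material) (Ω : Set E3) : Prop :=
  ∃ c₀ : ℝ, 0 < c₀ ∧ ∀ (u : W0v Ω) (τ : W0 Ω) (R : W0v Ω),
    c₀ * ∫ x in Ω, ((∑ i, ∑ j, strain u i j x * strain u i j x)
        + (∑ i, grad τ i x * grad τ i x) + ∑ i, ∑ j, grad (R i) j x * grad (R i) j x)
      ≤ ∫ x in Ω, ((∑ i, ∑ j, ∑ k, ∑ l, m.A i j k l x * strain u k l x * strain u i j x)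
        + (∑ i, ∑ j, ∑ k, ∑ l, 2 * m.B i j k l x * strain u i j x * grad (R k) l x)
        + (∑ i, ∑ j, m.K i j x * grad τ i x * grad τ j x)
        + ∑ i, ∑ j, ∑ k, ∑ l, m.C i j k l x * grad (R i) j x * grad (R k) l x)

/-- The inner product of `ℋ`:
`½ ∫ (ρ v_i v'_i + c θ θ' + c_{ij} M_i M'_j + 2𝒲[(u, τ, R), (u', τ', R')])`. -/
noncomputable def energyInner (m : Material) (U V : State Ω) : ℝ :=
  (1 / 2) * ∫ x in Ω, (m.ρ x * (∑ i, cv U i x * cv V i x) + m.c x * cθ U x * cθ V x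
    + (∑ i, ∑ j, m.kap i j x * cM U i x * cM V j x)
    + m.twoW (cu U) (cτ U) (cR U) (cu V) (cτ V) (cR V) x)

/-- The norm of `ℋ` belonging to this inner product. -/
noncomputable def energyNorm (m : Material) (U : State Ω) : ℝ := Real.sqrt (m.energyInner U U)

/-- The stress `A_{jikl} e_{kl}(u) - a_{ji} θ + B_{jikl} R_{l,k}`. -/
noncomputable def stress (m : Material) (u : W0v Ω) (θ : W0 Ω) (R : W0v Ω)
    (j i : Fin 3) (x : E3) : ℝ :=
  (∑ k, ∑ l, m.A j i k l x * strain u k l x) - m.a j i x * val θ x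
    + ∑ k, ∑ l, m.B j i k l x * grad (R l) k x

/-- The entropy flux `-d_{ij} M_j + K_{ij} τ_{,j} + K̃_{ij} θ_{,j}`. -/
noncomputable def entropyFlux (m : Material) (τ θ : W0 Ω) (M : W0v Ω) (i : Fin 3) (x : E3) : ℝ :=
  ∑ j, (-(m.d i j x * val (M j) x) + m.K i j x * grad τ j x + m.Kt i j x * grad θ j x)

/-- The first entropy flux moment
`B_{klji} e_{kl}(u) - b_{ji} θ + C_{jikl} R_{k,l} + C̃_{jikl} M_{k,l}`. -/
noncomputable def momentFlux (m : Material) (u : W0v Ω) (θ : W0 Ω) (R M : W0v Ω)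
    (j i : Fin 3) (x : E3) : ℝ :=
  (∑ k, ∑ l, m.B k l j i x * strain u k l x) - m.b j i x * val θ x
    + (∑ k, ∑ l, m.C j i k l x * grad (R k) l x) + ∑ k, ∑ l, m.Ct j i k l x * grad (M k) l x

/-- `h` is the divergence `q_{j,j}` of the field `q` on `Ω`, in the sense of distributions. -/
def IsWeakDiv (Ω : Set E3) (q : Fin 3 → E3 → ℝ) (h : E3 → ℝ) : Prop :=
  ∀ φ : E3 → ℝ, IsTest Ω φ →
    ∫ x in Ω, h x * φ x = -∫ x in Ω, ∑ j, q j x * pd j φ x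

/-- `m.GenEq U G` says that `U` lies in the domain of the operator `𝒜` and that `𝒜 U = G ∈ ℋ`.

The rows `u' = v`, `τ' = θ`, `R' = M` force `v`, `θ`, `M` to be in `W_0^{1,2}`: they are the `L²`
functions behind the components `cu G`, `cτ G`, `cR G` of `G`, through which their derivatives are
written. The other rows are the equations of motion, of entropy and of first entropy moment in the
sense of distributions, multiplied by `ρ`, `c` and `c_{ij}`. -/
structure GenEq (m : Material) (U G : State Ω) : Prop where
  row_u : valv (cu G) = cv U
  row_τ : val (cτ G) = cθ U
  row_R : valv (cR G) = cM U
  row_v : ∀ i, IsWeakDiv Ω (fun j => m.stress (cu U) (cτ G) (cR U) j i)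
    (fun x => m.ρ x * cv G i x)
  row_θ : IsWeakDiv Ω (m.entropyFlux (cτ U) (cτ G) (cR G))
    (fun x => m.c x * cθ G x + (∑ i, ∑ j, m.a i j x * strain (cu G) i j x)
      + ∑ i, ∑ j, m.b i j x * grad (cR G i) j x)
  row_M : ∀ i, IsWeakDiv Ω (fun j => m.momentFlux (cu U) (cτ G) (cR U) (cR G) j i)
    (fun x => (∑ j, m.kap i j x * cM G j x) + ∑ j, m.d i j x * grad (cτ G) j x)

/-- The domain `𝒟(𝒜) = {U ∈ ℋ : 𝒜 U ∈ ℋ}`. -/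
def genDomain (m : Material) (Ω : Set E3) : Set (State Ω) := {U | ∃ G, m.GenEq U G}

/-- The inverse `ℓ_{ij}` of the matrix `c_{ij}`. -/
noncomputable def ell (m : Material) (i j : Fin 3) (x : E3) : ℝ :=
  (Matrix.of fun p q => m.kap p q x)⁻¹ i j

end Material

/-- The sources `f_i`, `s`, `Q_i` in `C¹([0,∞), L²) ∩ C⁰([0,∞), W_0^{1,2})`. -/
structure Loads (Ω : Set E3) where
  f : ℝ → W0v Ω
  s : ℝ → W0 Ω
  Q : ℝ → W0v Ω
  f_cont : ContinuousOn f (Ici 0)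
  s_cont : ContinuousOn s (Ici 0)
  Q_cont : ContinuousOn Q (Ici 0)
  f_contDiff : ContDiffOn ℝ 1 (fun t => valv (f t)) (Ici 0)
  s_contDiff : ContDiffOn ℝ 1 (fun t => val (s t)) (Ici 0)
  Q_contDiff : ContDiffOn ℝ 1 (fun t => valv (Q t)) (Ici 0)

open Classical in
/-- The product of an `L²` function with a coefficient (zero if the product is not in `L²`, which
does not happen for a bounded measurable coefficient). -/
noncomputable def mulL2 {Ω : Set E3} (p : E3 → ℝ) (g : L2 Ω) : L2 Ω :=
  if h : MemLp (fun x => p x * g x) 2 (vol Ω) then h.toLp _ else 0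

/-- The right-hand side `ℱ = (0, f_i, 0, c⁻¹ ρ s, 0, ℓ_{ij} ρ Q_j)` of the Cauchy problem. -/
noncomputable def Loads.toState {Ω : Set E3} (F : Loads Ω) (m : Material) (t : ℝ) : State Ω :=
  (0, valv (F.f t), 0, mulL2 (fun x => m.ρ x / m.c x) (val (F.s t)), 0,
    WithLp.toLp 2 fun i => ∑ j, mulL2 (fun x => m.ell i j x * m.ρ x) (val (F.Q t j)))

/-- `U` is a solution of `dU/dt = 𝒜 U + ℱ` on `[0,∞)`, `U(0) = U₀`, of class
`C¹([0,∞), ℋ) ∩ C⁰([0,∞), 𝒟(𝒜))`, where `𝒟(𝒜)` has the graph norm. The function `G` is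
`t ↦ 𝒜 U(t)`. -/
structure IsSolution {Ω : Set E3} (m : Material) (F : Loads Ω) (U₀ : State Ω)
    (U : ℝ → State Ω) : Prop where
  contDiff : ContDiffOn ℝ 1 U (Ici 0)
  evolution : ∃ G : ℝ → State Ω, ContinuousOn G (Ici 0) ∧ ∀ t, 0 ≤ t →
    m.GenEq (U t) (G t) ∧ HasDerivWithinAt U (G t + F.toState m t) (Ici 0) t
  initial : U 0 = U₀

end MicroTherm

namespace MicroTherm

open Filter Topology
open scoped RealInnerProductSpace

section Dissipative

variable {H : Type*} [NormedAddCommGroup H] [InnerProductSpace ℝ H]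

/-- Energy estimate for `U' = G + F` with `⟪G, U⟫ ≤ 0`. -/
theorem norm_le_add_integral_of_dissipative {U G F : ℝ → H}
    (hU : ∀ t, 0 ≤ t → HasDerivWithinAt U (G t + F t) (Ici 0) t)
    (hG : ∀ t, 0 ≤ t → ⟪G t, U t⟫ ≤ 0) (hF : ContinuousOn F (Ici 0)) {t : ℝ} (ht : 0 ≤ t) :
    ‖U t‖ ≤ ‖U 0‖ + ∫ s in (0 : ℝ)..t, ‖F s‖ := by
  have hφc : Continuous fun s : ℝ => ‖F (max s 0)‖ :=
    (hF.comp_continuous (by fun_prop) fun s => le_max_right s 0).norm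
  have hint : ∫ s in (0 : ℝ)..t, ‖F s‖ = ∫ s in (0 : ℝ)..t, ‖F (max s 0)‖ := by
    refine intervalIntegral.integral_congr fun s hs => ?_
    rw [uIcc_of_le ht] at hs
    simp [max_eq_left hs.1]
  rw [hint]
  refine le_of_forall_pos_le_add fun ε hε => ?_
  have key : ∀ ⦃x⦄, x ∈ Icc 0 t → √(‖U x‖ ^ 2 + ε ^ 2) ≤
      √(‖U 0‖ ^ 2 + ε ^ 2) + ∫ s in (0 : ℝ)..x, ‖F (max s 0)‖ := by
    have hpos : ∀ x, 0 < ‖U x‖ ^ 2 + ε ^ 2 := fun x => by positivity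
    have hd : ∀ x, 0 ≤ x → HasDerivWithinAt (fun x => √(‖U x‖ ^ 2 + ε ^ 2))
        ((2 * ⟪U x, G x + F x⟫) / (2 * √(‖U x‖ ^ 2 + ε ^ 2))) (Ici 0) x := fun x hx => by
      exact ((hU x hx).norm_sq.add_const (ε ^ 2)).sqrt (hpos x).ne'
    refine image_le_of_deriv_right_le_deriv_boundary
      (fun x hx => ((hd x hx.1).continuousWithinAt).mono Icc_subset_Ici_self)
      (fun x hx => (hd x hx.1).mono (Ici_subset_Ici.2 hx.1)) (by simp)
      (B' := fun x => ‖F (max x 0)‖) ?_ ?_ ?_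
    · exact (continuous_const.add
        (intervalIntegral.continuous_primitive (fun a b => hφc.intervalIntegrable a b) 0)).continuousOn
    · intro x hx
      exact ((hφc.integral_hasStrictDerivAt 0 x).hasDerivAt.const_add _).hasDerivWithinAt
    · intro x hx
      rw [max_eq_left hx.1, mul_div_mul_left _ _ two_ne_zero,
        div_le_iff₀ (Real.sqrt_pos.2 (hpos x)), inner_add_right]
      have h1 : ⟪U x, G x⟫ ≤ 0 := by rw [real_inner_comm]; exact hG x hx.1
      have h2 : ⟪U x, F x⟫ ≤ ‖U x‖ * ‖F x‖ := real_inner_le_norm _ _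
      have h3 : ‖U x‖ ≤ √(‖U x‖ ^ 2 + ε ^ 2) := Real.le_sqrt_of_sq_le (by nlinarith)
      nlinarith [mul_le_mul_of_nonneg_right h3 (norm_nonneg (F x))]
  have h1 := key (right_mem_Icc.2 ht)
  have h2 : ‖U t‖ ≤ √(‖U t‖ ^ 2 + ε ^ 2) := Real.le_sqrt_of_sq_le (by nlinarith)
  have h3 : √(‖U 0‖ ^ 2 + ε ^ 2) ≤ ‖U 0‖ + ε :=
    Real.sqrt_le_iff.2 ⟨by positivity, by nlinarith [norm_nonneg (U 0), mul_nonneg (norm_nonneg (U 0)) hε.le]⟩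
  linarith

/-- Maximal dissipative operators, given by their graph. -/
structure MDissipative (P : Submodule ℝ (H × H)) : Prop where
  dissip : ∀ p ∈ P, ⟪p.2, p.1⟫ ≤ 0
  range : ∀ r : ℝ, 0 < r → ∀ f, ∃ p ∈ P, r • p.1 - p.2 = f
  single : ∀ y, ((0 : H), y) ∈ P → y = 0

namespace MDissipative

variable {P : Submodule ℝ (H × H)} (hP : MDissipative P)
include hP

theorem norm_fst_le {r : ℝ} {p : H × H} (hp : p ∈ P) :
    r * ‖p.1‖ ≤ ‖r • p.1 - p.2‖ := by
  rcases eq_or_ne p.1 0 with h | h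
  · simp [h]
  have h1 : ⟪r • p.1 - p.2, p.1⟫ ≤ ‖r • p.1 - p.2‖ * ‖p.1‖ := real_inner_le_norm _ _
  rw [inner_sub_left, real_inner_smul_left, real_inner_self_eq_norm_sq] at h1
  have := hP.dissip p hp
  have h2 : 0 < ‖p.1‖ := norm_pos_iff.2 h
  exact le_of_mul_le_mul_right (by nlinarith) h2

theorem fst_unique {r : ℝ} (hr : 0 < r) {p q : H × H} (hp : p ∈ P) (hq : q ∈ P)
    (h : r • p.1 - p.2 = r • q.1 - q.2) : p.1 = q.1 := by
  have h1 := hP.norm_fst_le (r := r) (P.sub_mem hp hq)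
  have h2 : r • (p - q).1 - (p - q).2 = 0 := by
    rw [Prod.fst_sub, Prod.snd_sub, smul_sub, sub_sub_sub_comm, h, sub_self]
  rw [h2, norm_zero] at h1
  have h3 : ‖(p - q).1‖ ≤ 0 := by nlinarith [norm_nonneg (p - q).1]
  exact sub_eq_zero.1 (norm_le_zero_iff.1 h3)

theorem exists_resolvent {r : ℝ} (hr : 0 < r) :
    ∃ R : H →L[ℝ] H, (∀ x, (R x, r • R x - x) ∈ P) ∧ ∀ x, r * ‖R x‖ ≤ ‖x‖ := by
  choose p hp hpe using hP.range r hr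
  have hp2 : ∀ f, (p f).2 = r • (p f).1 - f := fun f =>
    eq_sub_of_add_eq (by rw [add_comm]; exact (sub_eq_iff_eq_add.1 (hpe f)).symm)
  let L : H →ₗ[ℝ] H :=
    { toFun := fun f => (p f).1
      map_add' := fun f g => by
        refine hP.fst_unique hr (hp _) (P.add_mem (hp f) (hp g)) ?_
        rw [hpe, Prod.fst_add, Prod.snd_add, smul_add, add_sub_add_comm, hpe, hpe]
      map_smul' := fun c f => by
        refine hP.fst_unique hr (hp _) (P.smul_mem c (hp f)) ?_
        rw [hpe, Prod.smul_fst, Prod.smul_snd, smul_comm, ← smul_sub, hpe] }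
  have hb : ∀ x, r * ‖L x‖ ≤ ‖x‖ := fun x => by
    have := hP.norm_fst_le (r := r) (hp x)
    rwa [hpe] at this
  refine ⟨L.mkContinuous r⁻¹ fun x => ?_, fun x => ?_, hb⟩
  · rw [inv_mul_eq_div, le_div_iff₀ hr, mul_comm]; exact hb x
  · have h : ((p x).1, r • (p x).1 - x) ∈ P := by rw [← hp2]; exact hp x
    exact h

/-- The resolvent `(r - A)⁻¹`. -/
noncomputable def res {r : ℝ} (hr : 0 < r) : H →L[ℝ] H := (hP.exists_resolvent hr).choose

theorem res_mem {r : ℝ} (hr : 0 < r) (x : H) : (hP.res hr x, r • hP.res hr x - x) ∈ P :=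
  (hP.exists_resolvent hr).choose_spec.1 x

theorem norm_res_le {r : ℝ} (hr : 0 < r) (x : H) : r * ‖hP.res hr x‖ ≤ ‖x‖ :=
  (hP.exists_resolvent hr).choose_spec.2 x

theorem res_apply {r : ℝ} (hr : 0 < r) {p : H × H} (hp : p ∈ P) :
    hP.res hr (r • p.1 - p.2) = p.1 :=
  hP.fst_unique hr (hP.res_mem hr _) hp (by simp)

theorem res_sub_res {r s : ℝ} (hr : 0 < r) (hs : 0 < s) (x : H) :
    hP.res hs x - hP.res hr x = (r - s) • hP.res hr (hP.res hs x) := by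
  have h := hP.res_apply hr (hP.res_mem hs x)
  rw [show r • hP.res hs x - (s • hP.res hs x - x) = (r - s) • hP.res hs x + x by
    rw [sub_smul]; abel, map_add, map_smul] at h
  exact sub_eq_of_eq_add h.symm

theorem res_comm {r s : ℝ} (hr : 0 < r) (hs : 0 < s) (x : H) :
    hP.res hr (hP.res hs x) = hP.res hs (hP.res hr x) := by
  rcases eq_or_ne r s with rfl | h
  · rfl
  have h1 := hP.res_sub_res hr hs x
  have h2 := hP.res_sub_res hs hr x
  have h3 : (r - s) • (hP.res hr (hP.res hs x) - hP.res hs (hP.res hr x)) = 0 := by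
    have : (r - s) • hP.res hs (hP.res hr x) = -((s - r) • hP.res hs (hP.res hr x)) := by
      rw [← neg_smul]; simp
    rw [smul_sub, this, ← h1, ← h2]; abel
  exact sub_eq_zero.1 ((smul_eq_zero.1 h3).resolve_left (sub_ne_zero.2 h))

/-- The Yosida approximation `r (r (r - A)⁻¹ - 1)`. -/
noncomputable def yosida {r : ℝ} (hr : 0 < r) : H →L[ℝ] H :=
  r • (r • hP.res hr - ContinuousLinearMap.id ℝ H)

theorem yosida_apply {r : ℝ} (hr : 0 < r) (x : H) :
    hP.yosida hr x = r • (r • hP.res hr x - x) := rfl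

theorem yosida_mem {r : ℝ} (hr : 0 < r) (x : H) :
    (r • hP.res hr x, hP.yosida hr x) ∈ P :=
  P.smul_mem r (hP.res_mem hr x)

theorem smul_res_eq {r : ℝ} (hr : 0 < r) (x : H) :
    r • hP.res hr x = x + r⁻¹ • hP.yosida hr x := by
  rw [yosida_apply, smul_smul, inv_mul_cancel₀ hr.ne', one_smul]; abel

theorem yosida_dissip {r : ℝ} (hr : 0 < r) (x : H) : ⟪hP.yosida hr x, x⟫ ≤ 0 := by
  have h := hP.dissip _ (hP.yosida_mem hr x)
  simp only [hP.smul_res_eq hr, inner_add_right, real_inner_smul_right,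
    real_inner_self_eq_norm_sq] at h
  have : 0 ≤ r⁻¹ * ‖hP.yosida hr x‖ ^ 2 := by positivity
  linarith

theorem yosida_apply_mem {r : ℝ} (hr : 0 < r) {p : H × H} (hp : p ∈ P) :
    hP.yosida hr p.1 = r • hP.res hr p.2 := by
  have h := hP.res_apply hr hp
  rw [map_sub, map_smul] at h
  rw [yosida_apply]
  nth_rewrite 2 [← h]
  simp

theorem norm_smul_res_le {r : ℝ} (hr : 0 < r) (x : H) : ‖r • hP.res hr x‖ ≤ ‖x‖ := by
  rw [norm_smul, Real.norm_of_nonneg hr.le]; exact hP.norm_res_le hr x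

theorem norm_yosida_le {r : ℝ} (hr : 0 < r) {p : H × H} (hp : p ∈ P) :
    ‖hP.yosida hr p.1‖ ≤ ‖p.2‖ := by
  rw [hP.yosida_apply_mem hr hp]; exact hP.norm_smul_res_le hr _

theorem yosida_comm {r s : ℝ} (hr : 0 < r) (hs : 0 < s) :
    Commute (hP.yosida hr) (hP.yosida hs) := by
  ext x
  simp only [_root_.mul_apply_eq_comp, yosida_apply, map_sub, map_smul, hP.res_comm hr hs,
    smul_sub]
  module

theorem isClosed : IsClosed (P : Set (H × H)) := by
  refine isClosed_of_closure_subset fun p hp => ?_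
  obtain ⟨q, hq, hlim⟩ := mem_closure_iff_seq_limit.1 hp
  have h1 := (continuous_fst.tendsto p).comp hlim
  have h2 := (continuous_snd.tendsto p).comp hlim
  have h3 : Tendsto (fun n => hP.res one_pos ((1 : ℝ) • (q n).1 - (q n).2)) atTop
      (𝓝 (hP.res one_pos ((1 : ℝ) • p.1 - p.2))) :=
    ((hP.res one_pos).continuous.tendsto _).comp ((h1.const_smul _).sub h2)
  simp only [fun n => hP.res_apply one_pos (hq n)] at h3
  have h4 := tendsto_nhds_unique h3 h1
  have h5 := hP.res_mem one_pos ((1 : ℝ) • p.1 - p.2)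
  rw [h4, sub_sub_cancel] at h5
  exact h5

/-- The domain of `A`. -/
theorem dense_domain [CompleteSpace H] : Dense {x : H | ∃ y, (x, y) ∈ P} := by
  have hcoe : {x : H | ∃ y, (x, y) ∈ P} = (P.map (LinearMap.fst ℝ H H) : Set H) := by
    ext x; simp
  rw [hcoe, Submodule.dense_iff_topologicalClosure_eq_top,
    Submodule.topologicalClosure_eq_top_iff, Submodule.eq_bot_iff]
  intro y hy
  rw [Submodule.mem_orthogonal] at hy
  have hm := hP.res_mem one_pos y
  have h1 : ⟪y, hP.res one_pos y⟫ = 0 := by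
    rw [real_inner_comm]; exact hy _ ⟨_, hm, rfl⟩
  have h2 := hP.dissip _ hm
  simp only [one_smul, inner_sub_left, real_inner_self_eq_norm_sq] at h2
  rw [h1] at h2
  have h3 : hP.res one_pos y = 0 := norm_eq_zero.1 (by nlinarith [norm_nonneg (hP.res one_pos y)])
  rw [h3] at hm
  simpa using hP.single _ hm

end MDissipative

end Dissipative

end MicroTherm

namespace MicroTherm

open Filter Topology
open scoped RealInnerProductSpace

section BoundedDissipative

variable {H : Type*} [NormedAddCommGroup H] [InnerProductSpace ℝ H]

/-- The group generated by a bounded operator. -/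
noncomputable def expOp (Y : H →L[ℝ] H) (t : ℝ) : H →L[ℝ] H := NormedSpace.exp (t • Y)

theorem expOp_zero (Y : H →L[ℝ] H) (x : H) : expOp Y 0 x = x := by
  simp [expOp]

theorem expOp_comm {Y Z : H →L[ℝ] H} (h : Commute Z Y) (t : ℝ) (x : H) :
    Z (expOp Y t x) = expOp Y t (Z x) := by
  have : Commute Z (expOp Y t) := Commute.exp_right (h.smul_right t)
  exact congrArg (fun L : H →L[ℝ] H => L x) this.eq

/-- Variation of constants. -/
noncomputable def duhamel (Y : H →L[ℝ] H) (y : H) (g : ℝ → H) (t : ℝ) : H :=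
  expOp Y t y + ∫ s in (0 : ℝ)..t, expOp Y (t - s) (g s)

theorem duhamel_zero (Y : H →L[ℝ] H) (y : H) (g : ℝ → H) : duhamel Y y g 0 = y := by
  simp [duhamel, expOp_zero]

variable [CompleteSpace H]

theorem hasDerivAt_expOp (Y : H →L[ℝ] H) (t : ℝ) : HasDerivAt (expOp Y) (Y * expOp Y t) t :=
  hasDerivAt_exp_smul_const' Y t

theorem continuous_expOp (Y : H →L[ℝ] H) : Continuous (expOp Y) :=
  continuous_iff_continuousAt.2 fun t => (hasDerivAt_expOp Y t).continuousAt

theorem hasDerivAt_expOp_apply (Y : H →L[ℝ] H) (x : H) (t : ℝ) :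
    HasDerivAt (fun t => expOp Y t x) (Y (expOp Y t x)) t :=
  (hasDerivAt_expOp Y t).clm_apply (hasDerivAt_const t x) |>.congr_deriv (by simp)

theorem expOp_add (Y : H →L[ℝ] H) (s t : ℝ) (x : H) :
    expOp Y (s + t) x = expOp Y s (expOp Y t x) := by
  let _ : NormedAlgebra ℚ (H →L[ℝ] H) := NormedAlgebra.restrictScalars ℚ ℝ _
  rw [expOp, add_smul, NormedSpace.exp_add_of_commute]
  · rfl
  · exact ((Commute.refl Y).smul_left s).smul_right t

theorem norm_expOp_le {Y : H →L[ℝ] H} (hY : ∀ x, ⟪Y x, x⟫ ≤ 0) {t : ℝ} (ht : 0 ≤ t) (x : H) :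
    ‖expOp Y t x‖ ≤ ‖x‖ := by
  have h := norm_le_add_integral_of_dissipative (U := fun t => expOp Y t x)
    (G := fun t => Y (expOp Y t x)) (F := fun _ => 0)
    (fun s _ => by simpa using (hasDerivAt_expOp_apply Y x s).hasDerivWithinAt)
    (fun s _ => hY _) continuousOn_const ht
  simpa [expOp_zero] using h

theorem hasDerivAt_duhamel (Y : H →L[ℝ] H) (y : H) {g : ℝ → H} (hg : Continuous g) (t : ℝ) :
    HasDerivAt (duhamel Y y g) (Y (duhamel Y y g t) + g t) t := by
  have hc : Continuous fun s => expOp Y (-s) (g s) :=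
    ((continuous_expOp Y).comp continuous_neg).clm_apply hg
  have heq : duhamel Y y g = fun t => expOp Y t (y + ∫ s in (0 : ℝ)..t, expOp Y (-s) (g s)) := by
    funext t
    rw [duhamel, map_add, ← ContinuousLinearMap.intervalIntegral_comp_comm _
      (hc.intervalIntegrable 0 t)]
    simp only [← expOp_add, sub_eq_add_neg]
  have h1 := (hc.integral_hasStrictDerivAt 0 t).hasDerivAt.const_add y
  have h2 := (hasDerivAt_expOp Y t).clm_apply h1
  rw [heq]
  refine h2.congr_deriv ?_
  rw [← expOp_add, add_neg_cancel, expOp_zero]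
  rfl

theorem continuous_duhamel (Y : H →L[ℝ] H) (y : H) {g : ℝ → H} (hg : Continuous g) :
    Continuous (duhamel Y y g) :=
  continuous_iff_continuousAt.2 fun t => (hasDerivAt_duhamel Y y hg t).continuousAt

theorem norm_duhamel_le {Y : H →L[ℝ] H} (hY : ∀ x, ⟪Y x, x⟫ ≤ 0) (y : H) {g : ℝ → H}
    (hg : Continuous g) {t : ℝ} (ht : 0 ≤ t) :
    ‖duhamel Y y g t‖ ≤ ‖y‖ + ∫ s in (0 : ℝ)..t, ‖g s‖ := by
  have h := norm_le_add_integral_of_dissipative (U := duhamel Y y g)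
    (G := fun t => Y (duhamel Y y g t)) (F := g)
    (fun s _ => (hasDerivAt_duhamel Y y hg s).hasDerivWithinAt)
    (fun s _ => hY _) hg.continuousOn ht
  rwa [duhamel_zero] at h

/-- The derivative of a variation-of-constants solution is one, too. -/
theorem duhamel_deriv {Y : H →L[ℝ] H} (hY : ∀ x, ⟪Y x, x⟫ ≤ 0) (y : H) {f g : ℝ → H}
    (hg : Continuous g) (hf : ∀ t, HasDerivAt f (g t) t) {t : ℝ} (ht : 0 ≤ t) :
    Y (duhamel Y y f t) + f t = duhamel Y (Y y + f 0) g t := by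
  have hfc : Continuous f := continuous_iff_continuousAt.2 fun t => (hf t).continuousAt
  have h := norm_le_add_integral_of_dissipative
    (U := fun t => Y (duhamel Y y f t) + f t - duhamel Y (Y y + f 0) g t)
    (G := fun t => Y (Y (duhamel Y y f t) + f t - duhamel Y (Y y + f 0) g t)) (F := fun _ => 0)
    (fun s _ => by
      have h1 := ((Y.hasFDerivAt.comp_hasDerivAt s (hasDerivAt_duhamel Y y hfc s)).add (hf s)).sub
        (hasDerivAt_duhamel Y (Y y + f 0) hg s)
      refine (h1.congr_deriv ?_).hasDerivWithinAt
      simp only [map_sub, add_zero]; abel)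
    (fun s _ => hY _) continuousOn_const ht
  simp only [duhamel_zero, sub_self, norm_zero, intervalIntegral.integral_zero, add_zero] at h
  exact sub_eq_zero.1 (norm_le_zero_iff.1 h)

end BoundedDissipative

section Limits

variable {H : Type*} [NormedAddCommGroup H]

theorem cauchySeq_of_dense {f : ℕ → H → H} {D : Set H} (hD : Dense D)
    (hf : ∀ n x y, ‖f n x - f n y‖ ≤ ‖x - y‖) (h : ∀ x ∈ D, CauchySeq fun n => f n x) (x : H) :
    CauchySeq fun n => f n x := by
  refine Metric.cauchySeq_iff'.2 fun ε hε => ?_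
  obtain ⟨y, hyx, hy⟩ := hD.exists_dist_lt x (ε := ε / 3) (by positivity)
  obtain ⟨N, hN⟩ := Metric.cauchySeq_iff'.1 (h _ hyx) (ε / 3) (by positivity)
  refine ⟨N, fun n hn => ?_⟩
  have h1 := hf n x y
  have h2 := hf N y x
  have h3 := hN n hn
  rw [← dist_eq_norm, ← dist_eq_norm] at h1 h2
  rw [dist_comm y x] at h2
  calc dist (f n x) (f N x) ≤ dist (f n x) (f n y) + dist (f n y) (f N y) + dist (f N y) (f N x) :=
        dist_triangle4 _ _ _ _
    _ < ε := by linarith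

theorem tendsto_inv_smul_zero [NormedSpace ℝ H] {u : ℕ → H} {C : ℝ} (hu : ∀ n, ‖u n‖ ≤ C) :
    Tendsto (fun n : ℕ => ((n : ℝ) + 1)⁻¹ • u n) atTop (𝓝 0) := by
  refine squeeze_zero_norm (a := fun n : ℕ => ((n : ℝ) + 1)⁻¹ * C) (fun n => ?_) ?_
  · rw [norm_smul, Real.norm_of_nonneg (by positivity)]
    exact mul_le_mul_of_nonneg_left (hu n) (by positivity)
  · have := (tendsto_one_div_add_atTop_nhds_zero_nat (𝕜 := ℝ)).mul_const C
    simpa using this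

end Limits

namespace MDissipative

variable {H : Type*} [NormedAddCommGroup H] [InnerProductSpace ℝ H]
  {P : Submodule ℝ (H × H)} (hP : MDissipative P)
include hP

/-- The Yosida approximations with parameters `n + 1`. -/
noncomputable def yos (n : ℕ) : H →L[ℝ] H := hP.yosida (r := (n : ℝ) + 1) n.cast_add_one_pos

theorem yos_dissip (n : ℕ) (x : H) : ⟪hP.yos n x, x⟫ ≤ 0 := hP.yosida_dissip _ x

theorem yos_mem (n : ℕ) (x : H) : (x + ((n : ℝ) + 1)⁻¹ • hP.yos n x, hP.yos n x) ∈ P := by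
  have := hP.yosida_mem (r := (n : ℝ) + 1) n.cast_add_one_pos x
  rwa [hP.smul_res_eq] at this

variable [CompleteSpace H]

theorem tendsto_smul_res (x : H) :
    Tendsto (fun n : ℕ => ((n : ℝ) + 1) • hP.res (r := (n : ℝ) + 1) n.cast_add_one_pos x) atTop
      (𝓝 x) := by
  have hD : ∀ p ∈ P, Tendsto (fun n : ℕ => ((n : ℝ) + 1) •
      hP.res (r := (n : ℝ) + 1) n.cast_add_one_pos p.1) atTop (𝓝 p.1) := fun p hp => by
    have h := (tendsto_inv_smul_zero (u := fun n => hP.yos n p.1)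
      fun n => hP.norm_yosida_le n.cast_add_one_pos hp).const_add p.1
    rw [add_zero] at h
    refine h.congr fun n => ?_
    rw [hP.smul_res_eq]; rfl
  refine Metric.tendsto_atTop.2 fun ε hε => ?_
  obtain ⟨y, ⟨z, hyz⟩, hy⟩ := hP.dense_domain.exists_dist_lt x (ε := ε / 3) (by positivity)
  obtain ⟨N, hN⟩ := Metric.tendsto_atTop.1 (hD _ hyz) (ε / 3) (by positivity)
  refine ⟨N, fun n hn => ?_⟩
  have h1 := hP.norm_smul_res_le (r := (n : ℝ) + 1) n.cast_add_one_pos (x - y)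
  rw [map_sub, smul_sub, ← dist_eq_norm, ← dist_eq_norm] at h1
  have h3 := hN n hn
  rw [dist_comm] at hy
  calc _ ≤ _ := dist_triangle4 _ _ _ _
    _ < ε / 3 + ε / 3 + ε / 3 := by
      refine add_lt_add (add_lt_add (lt_of_le_of_lt h1 (by rwa [dist_comm])) h3) hy
    _ = ε := by ring

theorem tendsto_yos {p : H × H} (hp : p ∈ P) :
    Tendsto (fun n => hP.yos n p.1) atTop (𝓝 p.2) :=
  (hP.tendsto_smul_res p.2).congr fun n =>
    (hP.yosida_apply_mem (r := (n : ℝ) + 1) n.cast_add_one_pos hp).symm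

theorem cauchySeq_expOp {t : ℝ} (ht : 0 ≤ t) (x : H) :
    CauchySeq fun n => expOp (hP.yos n) t x := by
  refine cauchySeq_of_dense hP.dense_domain (f := fun n x => expOp (hP.yos n) t x)
    (fun n x y => ?_) ?_ x
  · rw [← map_sub]; exact norm_expOp_le (hP.yos_dissip n) ht _
  rintro x ⟨y, hxy⟩
  have hest : ∀ n k, ‖expOp (hP.yos n) t x - expOp (hP.yos k) t x‖ ≤
      t * ‖hP.yos n x - hP.yos k x‖ := fun n k => by
    have hcom : Commute (hP.yos n) (hP.yos k) := hP.yosida_comm (r := (n : ℝ) + 1) (s := (k : ℝ) + 1) n.cast_add_one_pos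
      k.cast_add_one_pos
    have h := norm_le_add_integral_of_dissipative
      (U := fun t => expOp (hP.yos n) t x - expOp (hP.yos k) t x)
      (G := fun t => hP.yos k (expOp (hP.yos n) t x - expOp (hP.yos k) t x))
      (F := fun t => expOp (hP.yos n) t (hP.yos n x - hP.yos k x))
      (fun s _ => by
        have h1 := (hasDerivAt_expOp_apply (hP.yos n) x s).sub
          (hasDerivAt_expOp_apply (hP.yos k) x s)
        refine (h1.congr_deriv ?_).hasDerivWithinAt
        rw [map_sub, map_sub, ← expOp_comm (Commute.refl (hP.yos n)), ← expOp_comm hcom.symm]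
        abel)
      (fun s _ => hP.yos_dissip k _)
      ((continuous_expOp _).clm_apply continuous_const).continuousOn ht
    simp only [expOp_zero, sub_self, norm_zero, zero_add] at h
    refine h.trans ?_
    have h2 := intervalIntegral.integral_mono_on (μ := volume) ht
      (((continuous_expOp (hP.yos n)).clm_apply
        (continuous_const (y := hP.yos n x - hP.yos k x))).norm.intervalIntegrable 0 t)
      (intervalIntegrable_const (c := ‖hP.yos n x - hP.yos k x‖))
      (fun s hs => norm_expOp_le (hP.yos_dissip n) hs.1 _)
    refine h2.trans (by simp)
  have hc := (hP.tendsto_yos hxy).cauchySeq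
  refine Metric.cauchySeq_iff.2 fun ε hε => ?_
  obtain ⟨N, hN⟩ := Metric.cauchySeq_iff.1 hc (ε / (t + 1)) (by positivity)
  refine ⟨N, fun n hn k hk => ?_⟩
  have h1 := hN n hn k hk
  rw [dist_eq_norm] at h1 ⊢
  calc _ ≤ t * ‖hP.yos n x - hP.yos k x‖ := hest n k
    _ ≤ (t + 1) * ‖hP.yos n x - hP.yos k x‖ := by nlinarith [norm_nonneg (hP.yos n x - hP.yos k x)]
    _ < (t + 1) * (ε / (t + 1)) := by gcongr
    _ = ε := by field_simp

/-- The contraction semigroup generated by `A`. -/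
noncomputable def semigroup (t : ℝ) (x : H) : H :=
  (cauchySeq_tendsto_of_complete (hP.cauchySeq_expOp (le_max_right t 0) x)).choose

theorem tendsto_semigroup' (t : ℝ) (x : H) :
    Tendsto (fun n => expOp (hP.yos n) (max t 0) x) atTop (𝓝 (hP.semigroup t x)) :=
  (cauchySeq_tendsto_of_complete (hP.cauchySeq_expOp (le_max_right t 0) x)).choose_spec

theorem tendsto_semigroup {t : ℝ} (ht : 0 ≤ t) (x : H) :
    Tendsto (fun n => expOp (hP.yos n) t x) atTop (𝓝 (hP.semigroup t x)) := by
  have := hP.tendsto_semigroup' t x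
  rwa [max_eq_left ht] at this

theorem norm_semigroup_sub_le (t : ℝ) (x y : H) :
    ‖hP.semigroup t x - hP.semigroup t y‖ ≤ ‖x - y‖ := by
  refine le_of_tendsto ((hP.tendsto_semigroup' t x).sub (hP.tendsto_semigroup' t y)).norm
    (Eventually.of_forall fun n => ?_)
  rw [← map_sub]; exact norm_expOp_le (hP.yos_dissip n) (le_max_right _ _) _

theorem norm_semigroup_sub_le_of_mem (s t : ℝ) {p : H × H} (hp : p ∈ P) :
    ‖hP.semigroup t p.1 - hP.semigroup s p.1‖ ≤ ‖p.2‖ * |t - s| := by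
  have hle : ‖hP.semigroup t p.1 - hP.semigroup s p.1‖ ≤ ‖p.2‖ * |max t 0 - max s 0| := by
    refine le_of_tendsto ((hP.tendsto_semigroup' t p.1).sub (hP.tendsto_semigroup' s p.1)).norm
      (Eventually.of_forall fun n => ?_)
    have := (convex_Ici (0 : ℝ)).norm_image_sub_le_of_norm_hasDerivWithin_le (C := ‖p.2‖)
      (fun r _ => (hasDerivAt_expOp_apply (hP.yos n) p.1 r).hasDerivWithinAt)
      (fun r hr => by
        rw [expOp_comm (Commute.refl _)]
        exact (norm_expOp_le (hP.yos_dissip n) hr _).trans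
          (hP.norm_yosida_le n.cast_add_one_pos hp))
      (mem_Ici.2 (le_max_right s 0)) (mem_Ici.2 (le_max_right t 0))
    simpa using this
  exact hle.trans (mul_le_mul_of_nonneg_left (abs_max_sub_max_le_abs _ _ _) (norm_nonneg _))

theorem continuous_semigroup : Continuous fun q : ℝ × H => hP.semigroup q.1 q.2 := by
  refine continuous_iff_continuousAt.2 fun ⟨t, x⟩ => Metric.continuousAt_iff.2 fun ε hε => ?_
  obtain ⟨y, ⟨z, hyz⟩, hy⟩ := hP.dense_domain.exists_dist_lt x (ε := ε / 4) (by positivity)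
  rw [dist_eq_norm] at hy
  refine ⟨min (ε / 4) (ε / 4 / (‖z‖ + 1)), by positivity, ?_⟩
  rintro ⟨s, w⟩ h
  rw [Prod.dist_eq, max_lt_iff, lt_min_iff, lt_min_iff] at h
  obtain ⟨⟨-, h1⟩, h2, -⟩ := h
  simp only [dist_eq_norm, Real.norm_eq_abs] at h1 h2 ⊢
  rw [lt_div_iff₀ (by positivity)] at h1
  have e1 := hP.norm_semigroup_sub_le s w x
  have e2 := hP.norm_semigroup_sub_le s x y
  have e3 := hP.norm_semigroup_sub_le_of_mem t s hyz
  have e4 := hP.norm_semigroup_sub_le t y x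
  rw [norm_sub_rev y x] at e4
  have e5 : ‖z‖ * |s - t| ≤ ε / 4 := by nlinarith [abs_nonneg (s - t)]
  have : hP.semigroup s w - hP.semigroup t x = (hP.semigroup s w - hP.semigroup s x) +
      (hP.semigroup s x - hP.semigroup s y) + (hP.semigroup s y - hP.semigroup t y) +
      (hP.semigroup t y - hP.semigroup t x) := by abel
  rw [this]
  refine (norm_add₄_le).trans_lt ?_
  linarith

theorem continuous_semigroup_apply {X : Type*} [TopologicalSpace X] {a : X → ℝ} {b : X → H}
    (ha : Continuous a) (hb : Continuous b) : Continuous fun x => hP.semigroup (a x) (b x) := by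
  have h : Continuous fun x => (a x, b x) := ha.prodMk hb
  have h' := hP.continuous_semigroup.comp h
  exact h'

/-- The mild solution. -/
noncomputable def mild (y : H) (g : ℝ → H) (t : ℝ) : H :=
  hP.semigroup t y + ∫ s in (0 : ℝ)..t, hP.semigroup (t - s) (g s)

theorem continuous_mild (y : H) {g : ℝ → H} (hg : Continuous g) : Continuous (hP.mild y g) := by
  have h1 : Continuous fun t : ℝ => hP.semigroup t y :=
    hP.continuous_semigroup_apply continuous_id continuous_const
  have h2 : Continuous (Function.uncurry fun t s => hP.semigroup (t - s) (g s)) :=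
    hP.continuous_semigroup_apply (continuous_fst.sub continuous_snd) (hg.comp continuous_snd)
  exact h1.add
    (intervalIntegral.continuous_parametric_intervalIntegral_of_continuous h2 continuous_id)

theorem tendsto_duhamel {u : ℕ → H} {y : H} (hu : Tendsto u atTop (𝓝 y)) {g : ℝ → H}
    (hg : Continuous g) {t : ℝ} (ht : 0 ≤ t) :
    Tendsto (fun n => duhamel (hP.yos n) (u n) g t) atTop (𝓝 (hP.mild y g t)) := by
  refine Tendsto.add ?_ ?_
  · have h0 : Tendsto (fun n => expOp (hP.yos n) t (u n - y)) atTop (𝓝 0) := by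
      refine squeeze_zero_norm (fun n => norm_expOp_le (hP.yos_dissip n) ht _) ?_
      simpa using (hu.sub_const y).norm
    simpa using h0.add (hP.tendsto_semigroup ht y)
  · refine intervalIntegral.tendsto_integral_filter_of_dominated_convergence (fun s => ‖g s‖)
      (Eventually.of_forall fun n => ?_) (Eventually.of_forall fun n => ?_)
      (hg.norm.intervalIntegrable 0 t) (Eventually.of_forall fun s hs => ?_)
    · exact (((continuous_expOp _).comp (continuous_const.sub continuous_id)).clm_apply
        hg).aestronglyMeasurable
    · refine Eventually.of_forall fun s hs => ?_
      rw [uIoc_of_le ht] at hs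
      exact norm_expOp_le (hP.yos_dissip n) (sub_nonneg.2 hs.2) _
    · rw [uIoc_of_le ht] at hs
      exact hP.tendsto_semigroup (sub_nonneg.2 hs.2) _

/-- Classical solutions of the inhomogeneous Cauchy problem. -/
theorem exists_solution {p : H × H} (hp : p ∈ P) {f g : ℝ → H} (hg : Continuous g)
    (hf : ∀ t, HasDerivAt f (g t) t) :
    ∃ U V : ℝ → H, Continuous V ∧ U 0 = p.1 ∧ ∀ t, 0 ≤ t →
      HasDerivWithinAt U (V t) (Ici 0) t ∧ (U t, V t - f t) ∈ P := by
  have hfc : Continuous f := continuous_iff_continuousAt.2 fun t => (hf t).continuousAt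
  set V := hP.mild (p.2 + f 0) g with hV
  have hVc : Continuous V := hP.continuous_mild _ hg
  let Un : ℕ → ℝ → H := fun n => duhamel (hP.yos n) p.1 f
  let Vn : ℕ → ℝ → H := fun n => duhamel (hP.yos n) (hP.yos n p.1 + f 0) g
  have hVn : ∀ n t, 0 ≤ t → hP.yos n (Un n t) + f t = Vn n t := fun n t ht =>
    duhamel_deriv (hP.yos_dissip n) p.1 hg hf ht
  have hVlim : ∀ t, 0 ≤ t → Tendsto (fun n => Vn n t) atTop (𝓝 (V t)) := fun t ht =>
    hP.tendsto_duhamel ((hP.tendsto_yos hp).add_const _) hg ht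
  have hUlim : ∀ t, 0 ≤ t → Tendsto (fun n => Un n t) atTop (𝓝 (hP.mild p.1 f t)) := fun t ht =>
    hP.tendsto_duhamel tendsto_const_nhds hfc ht
  have hVnc : ∀ n, Continuous (Vn n) := fun n => continuous_duhamel _ _ hg
  have hbd : ∀ n t, 0 ≤ t → ‖Vn n t‖ ≤ ‖p.2‖ + ‖f 0‖ + ∫ s in (0 : ℝ)..t, ‖g s‖ :=
    fun n t ht => (norm_duhamel_le (hP.yos_dissip n) _ hg ht).trans (by
      gcongr
      exact (norm_add_le _ _).trans
        (add_le_add_left (hP.norm_yosida_le n.cast_add_one_pos hp) _))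
  have hUn : ∀ n t, 0 ≤ t → Un n t = p.1 + ∫ s in (0 : ℝ)..t, Vn n s := fun n t ht => by
    have h := intervalIntegral.integral_eq_sub_of_hasDerivAt (a := 0) (b := t) (f := Un n)
      (fun s _ => hasDerivAt_duhamel (hP.yos n) p.1 hfc s)
      (((hP.yos n).continuous.comp (continuous_duhamel _ _ hfc)).add hfc |>.intervalIntegrable 0 t)
    rw [show Un n 0 = p.1 from duhamel_zero _ _ _] at h
    rw [← intervalIntegral.integral_congr (fun s hs => ?_) (f := fun s =>
      hP.yos n (duhamel (hP.yos n) p.1 f s) + f s), h]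
    · abel
    · rw [uIcc_of_le ht] at hs
      exact hVn n s hs.1
  have hU : ∀ t, 0 ≤ t → hP.mild p.1 f t = p.1 + ∫ s in (0 : ℝ)..t, V s := fun t ht => by
    refine tendsto_nhds_unique (hUlim t ht) ?_
    simp only [fun n => hUn n t ht]
    refine tendsto_const_nhds.add ?_
    refine intervalIntegral.tendsto_integral_filter_of_dominated_convergence
      (fun _ => ‖p.2‖ + ‖f 0‖ + ∫ s in (0 : ℝ)..t, ‖g s‖)
      (Eventually.of_forall fun n => (hVnc n).aestronglyMeasurable)
      (Eventually.of_forall fun n => Eventually.of_forall fun s hs => ?_)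
      intervalIntegrable_const (Eventually.of_forall fun s hs => ?_)
    · rw [uIoc_of_le ht] at hs
      refine (hbd n s hs.1.le).trans ?_
      gcongr
      refine intervalIntegral.integral_mono_interval le_rfl hs.1.le hs.2
        (Eventually.of_forall fun _ => norm_nonneg _) (hg.norm.intervalIntegrable 0 t)
    · rw [uIoc_of_le ht] at hs
      exact hVlim s hs.1.le
  refine ⟨fun t => p.1 + ∫ s in (0 : ℝ)..t, V s, V, hVc, by simp, fun t ht => ⟨?_, ?_⟩⟩
  · exact ((hVc.integral_hasStrictDerivAt 0 t).hasDerivAt.const_add _).hasDerivWithinAt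
  · have hY : Tendsto (fun n => hP.yos n (Un n t)) atTop (𝓝 (V t - f t)) :=
      ((hVlim t ht).sub_const (f t)).congr fun n => by rw [← hVn n t ht, add_sub_cancel_right]
    have hs : Tendsto (fun n : ℕ => ((n : ℝ) + 1)⁻¹ • hP.yos n (Un n t)) atTop (𝓝 0) := by
      have := (tendsto_one_div_add_atTop_nhds_zero_nat (𝕜 := ℝ)).smul hY
      simpa using this
    have hJ := (hUlim t ht).add hs
    rw [add_zero, hU t ht] at hJ
    exact hP.isClosed.mem_of_tendsto (hJ.prodMk_nhds hY)
      (Eventually.of_forall fun n => hP.yos_mem n _)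

end MDissipative

end MicroTherm

namespace MicroTherm

open Filter Topology
open scoped RealInnerProductSpace

section Renorming

/-- A copy of `E`, to carry another norm. -/
def Renorm (E : Type*) : Type _ := E

instance {E : Type*} [AddCommGroup E] : AddCommGroup (Renorm E) := inferInstanceAs (AddCommGroup E)

instance {E : Type*} [AddCommGroup E] [Module ℝ E] : Module ℝ (Renorm E) :=
  inferInstanceAs (Module ℝ E)

universe u

variable {E : Type u} [NormedAddCommGroup E] [NormedSpace ℝ E]

/-- A Banach space with a bounded, symmetric, coercive form is a Hilbert space for that form. -/
theorem exists_hilbert [CompleteSpace E] (B : E →L[ℝ] E →L[ℝ] ℝ) (hB : ∀ x y, B x y = B y x) {c : ℝ}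
    (hc : 0 < c) (hcoer : ∀ x, c * ‖x‖ ^ 2 ≤ B x x) :
    ∃ (H : Type u) (_ : NormedAddCommGroup H) (_ : InnerProductSpace ℝ H) (_ : CompleteSpace H)
      (e : E ≃L[ℝ] H), ∀ x y, ⟪e x, e y⟫ = B x y := by
  obtain ⟨K, hK0, hK⟩ : ∃ K : ℝ, 0 ≤ K ∧ ∀ x, B x x ≤ K * ‖x‖ * ‖x‖ :=
    ⟨‖B‖, B.opNorm_nonneg, fun x => (le_abs_self _).trans (B.le_opNorm₂ x x)⟩
  let toE : Renorm E →ₗ[ℝ] E := (LinearMap.id : E →ₗ[ℝ] E)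
  let core : InnerProductSpace.Core ℝ (Renorm E) :=
    { inner := fun x y => B (toE x) (toE y)
      conj_inner_symm := fun x y => hB _ _
      re_inner_nonneg := fun x => by
        have := hcoer (toE x)
        exact le_trans (by positivity) this
      add_left := fun x y z => by simp
      smul_left := fun x y r => by simp
      definite := fun x hx => by
        have h := hcoer (toE x)
        have hx' : B (toE x) (toE x) = 0 := hx
        rw [hx'] at h
        have : ‖toE x‖ = 0 := by
          by_contra hne
          have : 0 < c * ‖toE x‖ ^ 2 := by positivity
          linarith
        exact norm_eq_zero.1 this }
  let i1 : NormedAddCommGroup (Renorm E) := core.toNormedAddCommGroup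
  let i2 : InnerProductSpace ℝ (Renorm E) := InnerProductSpace.ofCore core.toCore
  have hin : ∀ x y : Renorm E, ⟪x, y⟫ = B (toE x) (toE y) := fun x y => rfl
  have hsq : ∀ x : Renorm E, ‖x‖ ^ 2 = B (toE x) (toE x) := fun x => by
    rw [← real_inner_self_eq_norm_sq, hin]
  let l : E ≃ₗ[ℝ] Renorm E := LinearEquiv.refl ℝ E
  have hup : ∀ x : E, ‖l x‖ ≤ √K * ‖x‖ := fun x => by
    refine le_of_sq_le_sq ?_ (by positivity)
    rw [hsq, mul_pow, Real.sq_sqrt hK0]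
    calc B x x ≤ K * ‖x‖ * ‖x‖ := hK x
      _ = _ := by ring
  have hlow : ∀ x : Renorm E, ‖l.symm x‖ ≤ (√c)⁻¹ * ‖x‖ := fun x => by
    rw [inv_mul_eq_div, le_div_iff₀ (Real.sqrt_pos.2 hc)]
    refine le_of_sq_le_sq ?_ (by positivity)
    rw [hsq, mul_pow, Real.sq_sqrt hc.le, mul_comm]
    exact hcoer _
  let e : E ≃L[ℝ] Renorm E := l.toContinuousLinearEquivOfBounds _ _ hup hlow
  refine ⟨Renorm E, i1, i2, ?_, e, fun x y => rfl⟩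
  exact (completeSpace_congr (e := e.toEquiv) e.isUniformEmbedding).1 inferInstance

variable [CompleteSpace E] {B : E →L[ℝ] E →L[ℝ] ℝ} (hB : ∀ x y, B x y = B y x) {c : ℝ}
  (hc : 0 < c) (hcoer : ∀ x, c * ‖x‖ ^ 2 ≤ B x x)
include hB hc hcoer

theorem sqrt_form_le_add_integral {U G F : ℝ → E}
    (hU : ∀ t, 0 ≤ t → HasDerivWithinAt U (G t + F t) (Ici 0) t)
    (hG : ∀ t, 0 ≤ t → B (G t) (U t) ≤ 0) (hF : ContinuousOn F (Ici 0)) {t : ℝ} (ht : 0 ≤ t) :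
    √(B (U t) (U t)) ≤ √(B (U 0) (U 0)) + ∫ s in (0 : ℝ)..t, √(B (F s) (F s)) := by
  obtain ⟨H, _, _, _, e, he⟩ := exists_hilbert B hB hc hcoer
  have hn : ∀ x, √(B x x) = ‖e x‖ := fun x => by
    rw [← he, real_inner_self_eq_norm_sq, Real.sqrt_sq (norm_nonneg _)]
  simp only [hn]
  refine norm_le_add_integral_of_dissipative (U := fun t => e (U t)) (G := fun t => e (G t))
    (F := fun t => e (F t)) (fun s hs => ?_) (fun s hs => ?_) (e.continuous.comp_continuousOn hF) ht
  · rw [← map_add]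
    exact e.hasFDerivAt.comp_hasDerivWithinAt s (hU s hs)
  · rw [he]; exact hG s hs

theorem exists_solution_of_form {P : Submodule ℝ (E × E)} (hdiss : ∀ p ∈ P, B p.2 p.1 ≤ 0)
    (hrange : ∀ r : ℝ, 0 < r → ∀ f, ∃ p ∈ P, r • p.1 - p.2 = f)
    (hsingle : ∀ y, ((0 : E), y) ∈ P → y = 0) {p : E × E} (hp : p ∈ P) {f g : ℝ → E}
    (hg : Continuous g) (hf : ∀ t, HasDerivAt f (g t) t) :
    ∃ U V : ℝ → E, Continuous V ∧ U 0 = p.1 ∧ ∀ t, 0 ≤ t →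
      HasDerivWithinAt U (V t) (Ici 0) t ∧ (U t, V t - f t) ∈ P := by
  obtain ⟨H, _, _, _, e, he⟩ := exists_hilbert B hB hc hcoer
  let ee : (E × E) ≃L[ℝ] H × H := e.prodCongr e
  let Q : Submodule ℝ (H × H) := P.comap (ee.symm : (H × H) →ₗ[ℝ] E × E)
  have hQ : ∀ a b, (a, b) ∈ Q ↔ (e.symm a, e.symm b) ∈ P := fun a b => Iff.rfl
  have hmd : MDissipative Q :=
    { dissip := fun q hq => by
        have := hdiss _ hq
        rw [← he] at this
        simpa [ee] using this
      range := fun r hr f => by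
        obtain ⟨p, hp, hpf⟩ := hrange r hr (e.symm f)
        refine ⟨(e p.1, e p.2), (hQ _ _).2 (by simpa using hp), ?_⟩
        have := congrArg e hpf
        simpa using this
      single := fun y hy => by
        rw [hQ, map_zero] at hy
        simpa using hsingle _ hy }
  have hp' : (e p.1, e p.2) ∈ Q := (hQ _ _).2 (by simpa using hp)
  obtain ⟨U, V, hV, hU0, h⟩ := hmd.exists_solution hp' (f := fun t => e (f t))
    (g := fun t => e (g t)) (e.continuous.comp hg) (fun t => e.hasFDerivAt.comp_hasDerivAt t (hf t))
  refine ⟨fun t => e.symm (U t), fun t => e.symm (V t), e.symm.continuous.comp hV, by simp [hU0],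
    fun t ht => ⟨e.symm.hasFDerivAt.comp_hasDerivWithinAt t (h t ht).1, ?_⟩⟩
  have := (hQ _ _).1 (h t ht).2
  simpa using this

end Renorming

section SecondOrder

variable {E X Y : Type*} [NormedAddCommGroup E] [NormedSpace ℝ E]
  [NormedAddCommGroup X] [InnerProductSpace ℝ X]
  [NormedAddCommGroup Y] [NormedSpace ℝ Y]

/-- The graph `{(U, G)}` of the first order operator in `E ≃ X × Y` belonging to the second order
equation `kin (y', ι z) + W (x, z) + N (x', z) = 0`, `ι x' = y`. -/
def systemGraph (e : E ≃ₗ[ℝ] X × Y) (ι : X →L[ℝ] Y) (kin : Y →L[ℝ] Y →L[ℝ] ℝ)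
    (W N : X →L[ℝ] X →L[ℝ] ℝ) : Submodule ℝ (E × E) where
  carrier := {p | ι (e p.2).1 = (e p.1).2 ∧
    ∀ z, kin (e p.2).2 (ι z) + W (e p.1).1 z + N (e p.2).1 z = 0}
  add_mem' := by
    rintro p q ⟨hp1, hp2⟩ ⟨hq1, hq2⟩
    refine ⟨by simp [hp1, hq1], fun z => ?_⟩
    have := congrArg₂ (· + ·) (hp2 z) (hq2 z)
    simp only [Prod.fst_add, Prod.snd_add, map_add, _root_.add_apply] at this ⊢
    linarith
  zero_mem' := by simp
  smul_mem' := by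
    rintro c p ⟨hp1, hp2⟩
    refine ⟨by simp [hp1], fun z => ?_⟩
    simp only [Prod.smul_fst, Prod.smul_snd, map_smul, _root_.smul_apply, smul_eq_mul]
    rw [← mul_add, ← mul_add, hp2 z, mul_zero]

variable {e : E ≃ₗ[ℝ] X × Y} {ι : X →L[ℝ] Y} {kin : Y →L[ℝ] Y →L[ℝ] ℝ} {W N : X →L[ℝ] X →L[ℝ] ℝ}

theorem mem_systemGraph {U G : E} : (U, G) ∈ systemGraph e ι kin W N ↔
    ι (e G).1 = (e U).2 ∧ ∀ z, kin (e G).2 (ι z) + W (e U).1 z + N (e G).1 z = 0 := Iff.rfl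

theorem systemGraph_dissip (hW : ∀ x y, W x y = W y x) (hN : ∀ x, 0 ≤ N x x) {p : E × E}
    (hp : p ∈ systemGraph e ι kin W N) :
    kin (e p.2).2 (e p.1).2 + W (e p.2).1 (e p.1).1 ≤ 0 := by
  obtain ⟨h1, h2⟩ := hp
  have h3 := h2 (e p.2).1
  rw [h1, hW] at h3
  linarith [hN (e p.2).1]

theorem systemGraph_single (hι : Function.Injective ι) (hd : DenseRange ι) {c : ℝ} (hc : 0 < c)
    (hkin : ∀ y, c * ‖y‖ ^ 2 ≤ kin y y) {y : E} (hy : ((0 : E), y) ∈ systemGraph e ι kin W N) :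
    y = 0 := by
  obtain ⟨h1, h2⟩ := hy
  simp only [map_zero, Prod.fst_zero, Prod.snd_zero] at h1 h2
  have hx : (e y).1 = 0 := hι (by rw [h1, map_zero])
  have hk : ∀ w, kin (e y).2 w = 0 := by
    refine fun w => hd.induction_on (p := fun w => kin (e y).2 w = 0) w
      (isClosed_eq (kin (e y).2).continuous continuous_const) fun z => ?_
    have := h2 z
    rw [hx] at this
    simpa using this
  have h3 := hkin (e y).2
  rw [hk] at h3
  have h4 : (e y).2 = 0 := by
    by_contra hne
    have := norm_pos_iff.2 hne
    have : 0 < c * ‖(e y).2‖ ^ 2 := by positivity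
    linarith
  exact e.map_eq_zero_iff.1 (Prod.ext hx h4)

theorem systemGraph_range [CompleteSpace X] {c : ℝ} (hc : 0 < c)
    (hW : ∀ x, c * ‖x‖ ^ 2 ≤ W x x) (hN : ∀ x, 0 ≤ N x x) (hkin : ∀ y, 0 ≤ kin y y)
    {r : ℝ} (hr : 0 < r) (f : E) :
    ∃ p ∈ systemGraph e ι kin W N, r • p.1 - p.2 = f := by
  let a : X →L[ℝ] X →L[ℝ] ℝ := r • kin.bilinearComp ι ι + r⁻¹ • W + N
  have ha : IsCoercive a := ⟨r⁻¹ * c, by positivity, fun x => by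
    simp only [a, _root_.add_apply, _root_.smul_apply,
      ContinuousLinearMap.bilinearComp_apply, smul_eq_mul]
    have h1 := mul_le_mul_of_nonneg_left (hW x) (inv_pos.2 hr).le
    have h2 := mul_nonneg hr.le (hkin (ι x))
    linarith [hN x]⟩
  let b : X →L[ℝ] ℝ := (kin (e f).2).comp ι - r⁻¹ • W (e f).1
  let x : X := ha.continuousLinearEquivOfBilin.symm ((InnerProductSpace.toDual ℝ X).symm b)
  have hx : ∀ z, a x z = b z := fun z => by
    rw [← ha.continuousLinearEquivOfBilin_apply]
    simp [x]
  let G : E := e.symm (x, r • ι x - (e f).2)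
  let U : E := e.symm (r⁻¹ • (x + (e f).1), ι x)
  refine ⟨(U, G), ⟨by simp [U, G], fun z => ?_⟩, ?_⟩
  · have := hx z
    simp only [a, b, _root_.add_apply, _root_.smul_apply,
      ContinuousLinearMap.bilinearComp_apply, smul_eq_mul, _root_.sub_apply,
      ContinuousLinearMap.comp_apply] at this
    simp only [U, G, LinearEquiv.apply_symm_apply, map_sub, map_smul, map_add,
      _root_.add_apply, _root_.smul_apply, _root_.sub_apply,
      smul_eq_mul]
    linarith
  · apply e.injective
    simp only [U, G, map_sub, map_smul, LinearEquiv.apply_symm_apply]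
    refine Prod.ext ?_ ?_
    · simp [smul_smul, hr.ne']
    · simp

end SecondOrder

end MicroTherm

namespace MicroTherm

open Filter Topology
open scoped RealInnerProductSpace

section Multiplication

variable {Ω : Set E3}

theorem integrable_mul (f g : L2 Ω) : Integrable (fun x => f x * g x) (vol Ω) :=
  (L2.integrable_inner (𝕜 := ℝ) f g).congr
    (Eventually.of_forall fun x => by simp [mul_comm])

theorem inner_eq_integral (f g : L2 Ω) : ⟪f, g⟫ = ∫ x in Ω, f x * g x := by
  rw [L2.inner_def]
  exact integral_congr_ae (Eventually.of_forall fun x => by simp [mul_comm])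

theorem inner_eq_integral_of_ae {f g : L2 Ω} {a b : E3 → ℝ} (hf : f =ᵐ[vol Ω] a)
    (hg : g =ᵐ[vol Ω] b) : ⟪f, g⟫ = ∫ x in Ω, a x * b x := by
  rw [inner_eq_integral]
  exact integral_congr_ae (hf.mul hg)

open Classical in
/-- Multiplication by a bounded measurable function, as an operator on `L²`. -/
noncomputable def mulOp (Ω : Set E3) (p : E3 → ℝ) : L2 Ω →L[ℝ] L2 Ω :=
  if h : MemLp p ∞ (vol Ω) then
    (ContinuousLinearMap.mul ℝ ℝ).holderL (vol Ω) ∞ 2 2 (h.toLp p) else 0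

variable {p q : E3 → ℝ}

theorem coeFn_mulOp (hp : MemLp p ∞ (vol Ω)) (f : L2 Ω) :
    mulOp Ω p f =ᵐ[vol Ω] fun x => p x * f x := by
  rw [mulOp, dif_pos hp]
  filter_upwards [(ContinuousLinearMap.mul ℝ ℝ).coeFn_holder (r := 2) (hp.toLp p) f,
    hp.coeFn_toLp] with x h1 h2
  rw [ContinuousLinearMap.holderL_apply_apply, h1, h2]
  rfl

theorem mulOp_congr (hpq : p =ᵐ[vol Ω] q) : mulOp Ω p = mulOp Ω q := by
  by_cases hp : MemLp p ∞ (vol Ω)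
  · have hq : MemLp q ∞ (vol Ω) := (memLp_congr_ae hpq).1 hp
    rw [mulOp, mulOp, dif_pos hp, dif_pos hq, (MemLp.toLp_eq_toLp_iff hp hq).2 hpq]
  · have hq : ¬ MemLp q ∞ (vol Ω) := fun h => hp ((memLp_congr_ae hpq).2 h)
    rw [mulOp, mulOp, dif_neg hp, dif_neg hq]

theorem mulL2_eq_mulOp (hp : MemLp p ∞ (vol Ω)) (f : L2 Ω) : mulL2 p f = mulOp Ω p f := by
  have h : MemLp (fun x => p x * f x) 2 (vol Ω) :=
    (memLp_congr_ae (coeFn_mulOp hp f)).1 (Lp.memLp _)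
  rw [mulL2, dif_pos h]
  exact Lp.ext (h.coeFn_toLp.trans (coeFn_mulOp hp f).symm)

theorem integrable_mul_mul (hp : MemLp p ∞ (vol Ω)) (f g : L2 Ω) :
    Integrable (fun x => p x * f x * g x) (vol Ω) := by
  refine (integrable_mul (mulOp Ω p f) g).congr ?_
  filter_upwards [coeFn_mulOp hp f] with x hx
  rw [hx]

theorem inner_mulOp (hp : MemLp p ∞ (vol Ω)) (f g : L2 Ω) :
    ⟪mulOp Ω p f, g⟫ = ∫ x in Ω, p x * f x * g x := by
  rw [inner_eq_integral]
  refine integral_congr_ae ?_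
  filter_upwards [coeFn_mulOp hp f] with x hx
  rw [hx]

theorem inner_mulOp_comm (f g : L2 Ω) : ⟪mulOp Ω p f, g⟫ = ⟪mulOp Ω p g, f⟫ := by
  by_cases hp : MemLp p ∞ (vol Ω)
  · rw [inner_mulOp hp, inner_mulOp hp]
    exact integral_congr_ae (Eventually.of_forall fun x => by ring)
  · simp [mulOp, dif_neg hp]

end Multiplication

section TestFunctions

variable {Ω : Set E3} {φ ψ : E3 → ℝ}

theorem contDiff_pd (hφ : ContDiff ℝ ∞ φ) (i : Fin 3) : ContDiff ℝ ∞ (pd i φ) :=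
  (hφ.fderiv_right (m := ∞) (by simp)).clm_apply contDiff_const

theorem tsupport_pd_subset (i : Fin 3) : tsupport (pd i φ) ⊆ tsupport φ :=
  (closure_mono fun x hx => by
    refine Function.mem_support.2 fun h => hx ?_
    simp [pd, h]).trans (tsupport_fderiv_subset ℝ)

namespace IsTest

theorem deriv (hφ : IsTest Ω φ) (i : Fin 3) : IsTest Ω (pd i φ) where
  smooth := contDiff_pd hφ.smooth i
  compact := hφ.compact.of_isClosed_subset (isClosed_tsupport _) (tsupport_pd_subset i)
  supp := (tsupport_pd_subset i).trans hφ.supp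

theorem memLp (hφ : IsTest Ω φ) : MemLp φ 2 (vol Ω) :=
  (hφ.smooth.continuous.memLp_of_hasCompactSupport hφ.compact).restrict Ω

theorem eq_zero (hφ : IsTest Ω φ) {x : E3} (hx : x ∉ Ω) : φ x = 0 :=
  image_eq_zero_of_notMem_tsupport fun h => hx (hφ.supp h)

theorem setIntegral_mul (hφ : IsTest Ω φ) (f : E3 → ℝ) :
    ∫ x in Ω, f x * φ x = ∫ x, f x * φ x :=
  setIntegral_eq_integral_of_forall_compl_eq_zero fun x hx => by rw [hφ.eq_zero hx, mul_zero]

theorem integrable_mul (hφ : IsTest Ω φ) (hψ : IsTest Ω ψ) : Integrable fun x => φ x * ψ x :=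
  (hφ.smooth.continuous.mul hψ.smooth.continuous).integrable_of_hasCompactSupport
    hφ.compact.mul_right

theorem integral_mul_pd (hφ : IsTest Ω φ) (hψ : IsTest Ω ψ) (i : Fin 3) :
    ∫ x in Ω, φ x * pd i ψ x = -∫ x in Ω, pd i φ x * ψ x := by
  rw [(hψ.deriv i).setIntegral_mul, hψ.setIntegral_mul]
  exact integral_mul_fderiv_eq_neg_fderiv_mul_of_integrable ((hφ.deriv i).integrable_mul hψ)
    (hφ.integrable_mul (hψ.deriv i)) (hφ.integrable_mul hψ)
    (fun x _ => (hφ.smooth.differentiable (by simp)).differentiableAt)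
    (fun x _ => (hψ.smooth.differentiable (by simp)).differentiableAt)

theorem pd_comm (hφ : IsTest Ω φ) (i j : Fin 3) :
    pd i (pd j φ) = pd j (pd i φ) := by
  funext x
  have hd : DifferentiableAt ℝ (fderiv ℝ φ) x :=
    ((hφ.smooth.fderiv_right (m := ∞) (by simp)).differentiable (by simp)).differentiableAt
  have h : ∀ k l, pd k (pd l φ) x =
      fderiv ℝ (fderiv ℝ φ) x (EuclideanSpace.single k 1) (EuclideanSpace.single l 1) :=
    fun k l => by
      have := (hd.hasFDerivAt.clm_apply
        (hasFDerivAt_const (EuclideanSpace.single l (1 : ℝ) : E3) x)).fderiv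
      change fderiv ℝ (fun y => fderiv ℝ φ y (EuclideanSpace.single l 1)) x _ = _
      rw [this]
      simp
  rw [h, h]
  have h2 : ContDiff ℝ 2 φ := contDiff_infty.1 hφ.smooth 2
  exact (h2.contDiffAt.isSymmSndFDerivAt (by simp)).eq _ _

theorem integral_pd_mul_pd (hφ : IsTest Ω φ) (hψ : IsTest Ω ψ) (i j : Fin 3) :
    ∫ x in Ω, pd i φ x * pd j ψ x =
      ∫ x in Ω, pd j φ x * pd i ψ x := by
  have h1 := hφ.integral_mul_pd (hψ.deriv j) i
  have h2 := hφ.integral_mul_pd (hψ.deriv i) j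
  rw [hψ.pd_comm] at h1
  linarith

theorem zero : IsTest Ω (0 : E3 → ℝ) where
  smooth := contDiff_const
  compact := HasCompactSupport.zero
  supp := by simp [tsupport]

theorem add (hφ : IsTest Ω φ) (hψ : IsTest Ω ψ) : IsTest Ω (φ + ψ) where
  smooth := hφ.smooth.add hψ.smooth
  compact := hφ.compact.add hψ.compact
  supp := (tsupport_add φ ψ).trans (union_subset hφ.supp hψ.supp)

theorem const_smul (hφ : IsTest Ω φ) (c : ℝ) : IsTest Ω (c • φ) where
  smooth := hφ.smooth.const_smul c
  compact := hφ.compact.mono (Function.support_const_smul_subset c φ)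
  supp := (closure_mono (Function.support_const_smul_subset c φ)).trans hφ.supp

end IsTest

end TestFunctions

section Sobolev

variable {Ω : Set E3}

instance : CompleteSpace (W0 Ω) :=
  inferInstanceAs (CompleteSpace (Submodule.topologicalClosure _ : Submodule ℝ (Jet Ω)))

/-- `w` is represented by the test function `φ`. -/
structure Represents (φ : E3 → ℝ) (w : Jet Ω) : Prop where
  isTest : IsTest Ω φ
  fst : w.fst =ᵐ[vol Ω] φ
  snd : ∀ i, w.snd i =ᵐ[vol Ω] pd i φ

theorem exists_represents_of_mem_span {w : Jet Ω} (hw : w ∈ Submodule.span ℝ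
    {w : Jet Ω | ∃ φ : E3 → ℝ, IsTest Ω φ ∧ (w.fst =ᵐ[vol Ω] φ) ∧
      ∀ i, w.snd i =ᵐ[vol Ω] pd i φ}) : ∃ φ, Represents φ w := by
  induction hw using Submodule.span_induction with
  | mem w hw => obtain ⟨φ, h1, h2, h3⟩ := hw; exact ⟨φ, h1, h2, h3⟩
  | zero =>
    refine ⟨0, IsTest.zero, Lp.coeFn_zero _ _ _, fun i => (Lp.coeFn_zero _ _ _).trans ?_⟩
    exact Eventually.of_forall fun x => by simp [pd]
  | add v w _ _ hv hw =>
    obtain ⟨φ, hφ⟩ := hv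
    obtain ⟨ψ, hψ⟩ := hw
    refine ⟨φ + ψ, hφ.isTest.add hψ.isTest, (Lp.coeFn_add _ _).trans (hφ.fst.add hψ.fst),
      fun i => (Lp.coeFn_add _ _).trans (((hφ.snd i).add (hψ.snd i)).trans ?_)⟩
    refine Eventually.of_forall fun x => ?_
    have h1 : DifferentiableAt ℝ φ x := (hφ.isTest.smooth.differentiable (by simp)).differentiableAt
    have h2 : DifferentiableAt ℝ ψ x := (hψ.isTest.smooth.differentiable (by simp)).differentiableAt
    simp [pd, fderiv_add h1 h2]
  | smul c w _ hw =>
    obtain ⟨φ, hφ⟩ := hw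
    refine ⟨c • φ, hφ.isTest.const_smul c, (Lp.coeFn_smul _ _).trans (hφ.fst.const_smul c),
      fun i => (Lp.coeFn_smul _ _).trans (((hφ.snd i).const_smul c).trans ?_)⟩
    refine Eventually.of_forall fun x => ?_
    have h1 : DifferentiableAt ℝ φ x := (hφ.isTest.smooth.differentiable (by simp)).differentiableAt
    simp [pd, fderiv_const_smul h1]

theorem IsTest.exists_represents {φ : E3 → ℝ} (hφ : IsTest Ω φ) :
    ∃ w : W0 Ω, Represents φ (w : Jet Ω) := by
  let w : Jet Ω := WithLp.toLp 2 (hφ.memLp.toLp φ,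
    WithLp.toLp 2 fun i => (hφ.deriv i).memLp.toLp (pd i φ))
  have h1 : w.fst =ᵐ[vol Ω] φ := hφ.memLp.coeFn_toLp
  have h2 : ∀ i, w.snd i =ᵐ[vol Ω] pd i φ := fun i => (hφ.deriv i).memLp.coeFn_toLp
  exact ⟨⟨w, Submodule.le_topologicalClosure _ (Submodule.subset_span ⟨φ, hφ, h1, h2⟩)⟩, hφ, h1, h2⟩

theorem W0_induction {p : W0 Ω → Prop} (hc : IsClosed {w | p w})
    (h : ∀ (w : W0 Ω) (φ : E3 → ℝ), Represents φ (w : Jet Ω) → p w) (w : W0 Ω) : p w := by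
  obtain ⟨u, hu, hlim⟩ := mem_closure_iff_seq_limit.1
    (show (w : Jet Ω) ∈ closure _ from w.2)
  let u' : ℕ → W0 Ω := fun n => ⟨u n, Submodule.le_topologicalClosure _ (hu n)⟩
  have hlim' : Tendsto u' atTop (𝓝 w) := tendsto_subtype_rng.2 hlim
  refine hc.mem_of_tendsto hlim' (Eventually.of_forall fun n => ?_)
  obtain ⟨φ, hφ⟩ := exists_represents_of_mem_span (hu n)
  exact h _ φ hφ

/-- `val` as a bounded operator. -/
noncomputable def valL (Ω : Set E3) : W0 Ω →L[ℝ] L2 Ω :=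
  (WithLp.fstL 2 ℝ (L2 Ω) (L2v Ω)).comp (W0sub Ω).subtypeL

/-- `grad` as a bounded operator. -/
noncomputable def gradL (Ω : Set E3) (i : Fin 3) : W0 Ω →L[ℝ] L2 Ω :=
  (PiLp.proj 2 (fun _ : Fin 3 => L2 Ω) i : L2v Ω →L[ℝ] L2 Ω).comp
    ((WithLp.sndL 2 ℝ (L2 Ω) (L2v Ω)).comp (W0sub Ω).subtypeL)

theorem valL_apply (w : W0 Ω) : valL Ω w = val w := rfl

theorem inner_val_grad (w z : W0 Ω) (i : Fin 3) : ⟪val w, grad z i⟫ = -⟪grad w i, val z⟫ := by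
  refine W0_induction (p := fun w => ⟪val w, grad z i⟫ = -⟪grad w i, val z⟫) ?_ ?_ w
  · exact isClosed_eq ((valL Ω).continuous.inner continuous_const)
      ((gradL Ω i).continuous.inner continuous_const).neg
  intro w φ hφ
  refine W0_induction (p := fun z => ⟪val w, grad z i⟫ = -⟪grad w i, val z⟫) ?_ ?_ z
  · exact isClosed_eq (continuous_const.inner (gradL Ω i).continuous)
      (continuous_const.inner (valL Ω).continuous).neg
  intro z ψ hψ
  have h := hφ.isTest.integral_mul_pd hψ.isTest i
  rw [val, grad, val, grad, inner_eq_integral_of_ae hφ.fst (hψ.snd i),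
    inner_eq_integral_of_ae (hφ.snd i) hψ.fst]
  exact h

theorem inner_grad_grad (w z : W0 Ω) (i j : Fin 3) :
    ⟪grad w i, grad z j⟫ = ⟪grad w j, grad z i⟫ := by
  refine W0_induction (p := fun w => ⟪grad w i, grad z j⟫ = ⟪grad w j, grad z i⟫) ?_ ?_ w
  · exact isClosed_eq ((gradL Ω i).continuous.inner continuous_const)
      ((gradL Ω j).continuous.inner continuous_const)
  intro w φ hφ
  refine W0_induction (p := fun z => ⟪grad w i, grad z j⟫ = ⟪grad w j, grad z i⟫) ?_ ?_ z
  · exact isClosed_eq (continuous_const.inner (gradL Ω j).continuous)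
      (continuous_const.inner (gradL Ω i).continuous)
  intro z ψ hψ
  have h := hφ.isTest.integral_pd_mul_pd hψ.isTest i j
  rw [grad, grad, grad, grad, inner_eq_integral_of_ae (hφ.snd i) (hψ.snd j),
    inner_eq_integral_of_ae (hφ.snd j) (hψ.snd i)]
  exact h

/-- Weak divergences can be tested with `W_0^{1,2}`. -/
theorem isWeakDiv_iff {q : Fin 3 → E3 → ℝ} {h : E3 → ℝ} {qL : Fin 3 → L2 Ω} {hL : L2 Ω}
    (hq : ∀ j, qL j =ᵐ[vol Ω] q j) (hh : hL =ᵐ[vol Ω] h) :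
    Material.IsWeakDiv Ω q h ↔ ∀ w : W0 Ω, ⟪hL, val w⟫ + ∑ j, ⟪qL j, grad w j⟫ = 0 := by
  have key : ∀ (w : W0 Ω) φ, Represents φ (w : Jet Ω) →
      ⟪hL, val w⟫ = ∫ x in Ω, h x * φ x ∧
      ∑ j, ⟪qL j, grad w j⟫ = ∫ x in Ω, ∑ j, q j x * pd j φ x := fun w φ hφ => by
    constructor
    · exact inner_eq_integral_of_ae hh hφ.fst
    · simp only [inner_eq_integral]
      rw [← integral_finsetSum _ fun j _ => integrable_mul _ _]
      refine integral_congr_ae ?_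
      filter_upwards [ae_all_iff.2 hq, ae_all_iff.2 hφ.snd] with x h1 h2
      exact Finset.sum_congr rfl fun j _ => by rw [h1, grad, h2]
  constructor
  · intro hdiv
    refine W0_induction ?_ fun w φ hφ => ?_
    · refine isClosed_eq ((continuous_const.inner (valL Ω).continuous).add ?_) continuous_const
      exact continuous_finsetSum _ fun j _ => continuous_const.inner (gradL Ω j).continuous
    · rw [(key w φ hφ).1, (key w φ hφ).2, hdiv φ hφ.isTest, neg_add_cancel]
  · intro hw φ hφ
    obtain ⟨w, hwφ⟩ := hφ.exists_represents
    have := hw w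
    rw [(key w φ hwφ).1, (key w φ hwφ).2] at this
    exact eq_neg_of_add_eq_zero_left this

theorem eq_zero_of_inner_val (hΩ : IsOpen Ω) (hΩb : Bornology.IsBounded Ω) {f : L2 Ω}
    (hf : ∀ w : W0 Ω, ⟪f, val w⟫ = 0) : f = 0 := by
  have hfin : IsFiniteMeasure (vol Ω) := ⟨by simpa using hΩb.measure_lt_top⟩
  have hint : IntegrableOn f Ω := (Lp.memLp f).integrable (by norm_num)
  have h := hΩ.ae_eq_zero_of_integral_contDiff_smul_eq_zero (μ := volume) (f := f)
    hint.locallyIntegrableOn fun g h1 h2 h3 => by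
      have hg : IsTest Ω g := ⟨h1, h2, h3⟩
      obtain ⟨w, hw⟩ := hg.exists_represents
      have h4 := hf w
      rw [val, inner_eq_integral_of_ae (EventuallyEq.refl _ f) hw.fst] at h4
      have h5 := hg.setIntegral_mul f
      simp only [smul_eq_mul, mul_comm (g _)]
      rw [← h5]; exact h4
  refine Lp.ext (EventuallyEq.trans ?_ (Lp.coeFn_zero _ _ _).symm)
  exact (ae_restrict_iff' hΩ.measurableSet).2 h

theorem denseRange_val (hΩ : IsOpen Ω) (hΩb : Bornology.IsBounded Ω) : DenseRange (valL Ω) := by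
  have h : (valL Ω).range.topologicalClosure = ⊤ := by
    rw [Submodule.topologicalClosure_eq_top_iff, Submodule.eq_bot_iff]
    intro f hf
    refine eq_zero_of_inner_val hΩ hΩb fun w => ?_
    rw [real_inner_comm]
    exact (Submodule.mem_orthogonal _ _).1 hf _ ⟨w, rfl⟩
  exact (Submodule.dense_iff_topologicalClosure_eq_top.2 h)

theorem val_injective (hΩ : IsOpen Ω) (hΩb : Bornology.IsBounded Ω) :
    Function.Injective (valL Ω) := by
  refine (injective_iff_map_eq_zero _).2 fun w hw => ?_
  have hg : ∀ i, grad w i = 0 := fun i => eq_zero_of_inner_val hΩ hΩb fun z => by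
    have := inner_val_grad w z i
    rw [← valL_apply, hw, inner_zero_left] at this
    linarith
  refine Subtype.ext ?_
  refine (WithLp.ofLp_injective 2) (Prod.ext hw ?_)
  exact (WithLp.ofLp_injective 2) (funext hg)

/-- Poincaré's inequality. -/
theorem exists_poincare (hΩb : Bornology.IsBounded Ω) :
    ∃ C : ℝ, 0 ≤ C ∧ ∀ w : W0 Ω, ‖val w‖ ≤ C * ∑ i, ‖grad w i‖ := by
  refine ⟨eLpNormLESNormFDerivOfLeConst ℝ (volume : Measure E3) Ω 2 2, NNReal.coe_nonneg _,
    W0_induction ?_ fun w φ hφ => ?_⟩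
  · exact isClosed_le (valL Ω).continuous.norm (continuous_const.mul
      (continuous_finsetSum _ fun i _ => (gradL Ω i).continuous.norm))
  have hsupp : φ.support ⊆ Ω := (subset_tsupport φ).trans hφ.isTest.supp
  have h1 := eLpNorm_le_eLpNorm_fderiv (volume : Measure E3) (s := Ω) (p := 2)
    (hφ.isTest.smooth.of_le (by simp)) hsupp (by norm_num)
    (by rw [finrank_euclideanSpace_fin]; norm_num) hΩb
  have hpdL : ∀ i, MemLp (pd i φ) 2 volume := fun i =>
    (hφ.isTest.deriv i).smooth.continuous.memLp_of_hasCompactSupport (hφ.isTest.deriv i).compact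
  have h2 : eLpNorm (fderiv ℝ φ) 2 volume ≤ ∑ i, eLpNorm (pd i φ) 2 volume := by
    refine (eLpNorm_mono_real (g := ∑ i, fun x => |pd i φ x|) fun x => ?_).trans
      ((eLpNorm_sum_le (fun i _ => (hpdL i).1.norm) (by norm_num)).trans
        (Finset.sum_le_sum fun i _ => (eLpNorm_norm (pd i φ)).le))
    rw [Finset.sum_apply]
    refine ContinuousLinearMap.opNorm_le_bound _ (by positivity) fun v => ?_
    have hv : v = ∑ i, v i • EuclideanSpace.single i (1 : ℝ) := by
      ext j; simp [Finset.sum_apply, Pi.single_apply]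
    nth_rewrite 1 [hv]
    rw [map_sum, Finset.sum_mul]
    refine (norm_sum_le _ _).trans (Finset.sum_le_sum fun i _ => ?_)
    rw [map_smul, norm_smul, mul_comm]
    exact mul_le_mul_of_nonneg_left (PiLp.norm_apply_le v i) (abs_nonneg _)
  have h3 : ∀ i, eLpNorm (pd i φ) 2 volume = ENNReal.ofReal ‖grad w i‖ := fun i => by
    rw [grad, Lp.norm_def, ENNReal.ofReal_toReal (Lp.eLpNorm_ne_top _),
      eLpNorm_congr_ae (hφ.snd i)]
    exact (eLpNorm_restrict_eq_of_support_subset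
      ((subset_tsupport _).trans (hφ.isTest.deriv i).supp)).symm
  have h4 : eLpNorm φ 2 volume = ENNReal.ofReal ‖val w‖ := by
    rw [val, Lp.norm_def, ENNReal.ofReal_toReal (Lp.eLpNorm_ne_top _), eLpNorm_congr_ae hφ.fst]
    exact (eLpNorm_restrict_eq_of_support_subset hsupp).symm
  simp only [h3] at h2
  rw [← ENNReal.ofReal_sum_of_nonneg fun i _ => norm_nonneg _] at h2
  have h5 := h1.trans (mul_le_mul_right h2 _)
  have e2 : ((2 : NNReal) : ℝ≥0∞) = 2 := rfl
  rw [e2, h4, ← ENNReal.ofReal_coe_nnreal, ← ENNReal.ofReal_mul (NNReal.coe_nonneg _)] at h5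
  exact (ENNReal.ofReal_le_ofReal_iff (by positivity)).1 h5

/-- The strain as an element of `L²`. -/
noncomputable def strainL (Ω : Set E3) (i j : Fin 3) : W0v Ω →L[ℝ] L2 Ω :=
  (1 / 2 : ℝ) • ((gradL Ω j).comp (PiLp.proj 2 (fun _ : Fin 3 => W0 Ω) i : W0v Ω →L[ℝ] W0 Ω) +
    (gradL Ω i).comp (PiLp.proj 2 (fun _ : Fin 3 => W0 Ω) j : W0v Ω →L[ℝ] W0 Ω))

theorem strainL_apply (u : W0v Ω) (i j : Fin 3) :
    strainL Ω i j u = (1 / 2 : ℝ) • (grad (u i) j + grad (u j) i) := rfl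

theorem coeFn_strainL (u : W0v Ω) (i j : Fin 3) : strainL Ω i j u =ᵐ[vol Ω] strain u i j := by
  rw [strainL_apply]
  filter_upwards [Lp.coeFn_smul (1 / 2 : ℝ) (grad (u i) j + grad (u j) i),
    Lp.coeFn_add (grad (u i) j) (grad (u j) i)] with x h1 h2
  rw [h1, Pi.smul_apply, h2, strain, Pi.add_apply, smul_eq_mul]
  ring

/-- Korn's first inequality. -/
theorem korn (u : W0v Ω) :
    ∑ i, ∑ j, ‖grad (u i) j‖ ^ 2 ≤ 2 * ∑ i, ∑ j, ‖strainL Ω i j u‖ ^ 2 := by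
  have h1 : ∀ i j, ‖strainL Ω i j u‖ ^ 2 = (1 / 4) * (‖grad (u i) j‖ ^ 2 + ‖grad (u j) i‖ ^ 2 +
      2 * ⟪grad (u i) i, grad (u j) j⟫) := fun i j => by
    rw [strainL_apply, norm_smul, mul_pow, norm_add_sq_real, inner_grad_grad (u i) (u j) j i]
    norm_num
    ring
  have h2 : 0 ≤ ∑ i, ∑ j, ⟪grad (u i) i, grad (u j) j⟫ := by
    have : ∑ i, ∑ j, ⟪grad (u i) i, grad (u j) j⟫ =
        ⟪∑ i, grad (u i) i, ∑ j, grad (u j) j⟫ := by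
      rw [sum_inner]
      simp only [inner_sum]
    rw [this]
    exact real_inner_self_nonneg
  have h3 : ∑ i, ∑ j, ‖grad (u j) i‖ ^ 2 = ∑ i, ∑ j, ‖grad (u i) j‖ ^ 2 := Finset.sum_comm
  simp only [h1, ← Finset.mul_sum, Finset.sum_add_distrib, h3]
  linarith

end Sobolev

end MicroTherm

namespace MicroTherm

open Filter Topology
open scoped RealInnerProductSpace

section HasInt

/-- `F` is integrable on `Ω`, with integral `r`. -/
def HasInt (Ω : Set E3) (F : E3 → ℝ) (r : ℝ) : Prop :=
  Integrable F (vol Ω) ∧ ∫ x in Ω, F x = r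

namespace HasInt

variable {Ω : Set E3} {F G p a b : E3 → ℝ} {r s : ℝ}

theorem add (hF : HasInt Ω F r) (hG : HasInt Ω G s) : HasInt Ω (fun x => F x + G x) (r + s) :=
  ⟨hF.1.add hG.1, by rw [integral_add hF.1 hG.1, hF.2, hG.2]⟩

theorem const_mul (hF : HasInt Ω F r) (c : ℝ) : HasInt Ω (fun x => c * F x) (c * r) :=
  ⟨hF.1.const_mul c, by rw [integral_const_mul, hF.2]⟩

theorem sum {ι : Type*} [Fintype ι] {F : ι → E3 → ℝ} {r : ι → ℝ} (h : ∀ i, HasInt Ω (F i) (r i)) :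
    HasInt Ω (fun x => ∑ i, F i x) (∑ i, r i) :=
  ⟨integrable_finsetSum _ fun i _ => (h i).1, by
    rw [integral_finsetSum _ fun i _ => (h i).1]; exact Finset.sum_congr rfl fun i _ => (h i).2⟩

theorem congr (hF : HasInt Ω F r) (h : F =ᵐ[vol Ω] G) : HasInt Ω G r :=
  ⟨hF.1.congr h, by rw [← integral_congr_ae h, hF.2]⟩

theorem mono (hF : HasInt Ω F r) (hG : HasInt Ω G s) (h : F ≤ᵐ[vol Ω] G) : r ≤ s := by
  rw [← hF.2, ← hG.2]; exact integral_mono_ae hF.1 hG.1 h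

theorem nonneg (hF : HasInt Ω F r) (h : ∀ᵐ x ∂(vol Ω), 0 ≤ F x) : 0 ≤ r := by
  rw [← hF.2]; exact integral_nonneg_of_ae h

theorem mul_mul {f g : L2 Ω} (hp : MemLp p ∞ (vol Ω)) (hf : f =ᵐ[vol Ω] a) (hg : g =ᵐ[vol Ω] b) :
    HasInt Ω (fun x => p x * a x * b x) ⟪mulOp Ω p f, g⟫ := by
  refine HasInt.congr ⟨integrable_mul_mul hp f g, (inner_mulOp hp f g).symm⟩ ?_
  filter_upwards [hf, hg] with x h1 h2
  rw [h1, h2]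

theorem sq {f : L2 Ω} (hf : f =ᵐ[vol Ω] a) : HasInt Ω (fun x => a x * a x) (‖f‖ ^ 2) := by
  rw [← real_inner_self_eq_norm_sq]
  exact HasInt.congr ⟨integrable_mul f f, (inner_eq_integral f f).symm⟩ (hf.mul hf)

end HasInt

end HasInt

section Spaces

variable (Ω : Set E3)

noncomputable scoped instance : NormedAddCommGroup (L2 Ω) := inferInstance

noncomputable scoped instance : NormedSpace ℝ (L2 Ω) := inferInstance

noncomputable scoped instance : NormedAddCommGroup (W0 Ω) := inferInstance

noncomputable scoped instance : NormedSpace ℝ (W0 Ω) := inferInstance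

noncomputable scoped instance : NormedAddCommGroup (L2v Ω) := inferInstance

noncomputable scoped instance : NormedSpace ℝ (L2v Ω) := inferInstance

noncomputable scoped instance : NormedAddCommGroup (W0v Ω) := inferInstance

noncomputable scoped instance : NormedSpace ℝ (W0v Ω) := inferInstance

/-- The triples `(u, τ, R)`. -/
def Conf : Type := WithLp 2 (W0v Ω × WithLp 2 (W0 Ω × W0v Ω))

noncomputable instance : NormedAddCommGroup (Conf Ω) :=
  inferInstanceAs (NormedAddCommGroup (WithLp 2 (W0v Ω × WithLp 2 (W0 Ω × W0v Ω))))

noncomputable instance : InnerProductSpace ℝ (Conf Ω) :=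
  inferInstanceAs (InnerProductSpace ℝ (WithLp 2 (W0v Ω × WithLp 2 (W0 Ω × W0v Ω))))

instance : CompleteSpace (Conf Ω) :=
  inferInstanceAs (CompleteSpace (WithLp 2 (W0v Ω × WithLp 2 (W0 Ω × W0v Ω))))

/-- The triples `(v, θ, M)`. -/
def Vel : Type := L2v Ω × L2 Ω × L2v Ω

noncomputable instance : NormedAddCommGroup (Vel Ω) :=
  inferInstanceAs (NormedAddCommGroup (L2v Ω × L2 Ω × L2v Ω))

noncomputable instance : NormedSpace ℝ (Vel Ω) :=
  inferInstanceAs (NormedSpace ℝ (L2v Ω × L2 Ω × L2v Ω))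

/-- The triples `(u, τ, R)` as a topological product. -/
noncomputable def confEquiv : Conf Ω ≃L[ℝ] W0v Ω × WithLp 2 (W0 Ω × W0v Ω) :=
  WithLp.prodContinuousLinearEquiv 2 ℝ (W0v Ω) (WithLp 2 (W0 Ω × W0v Ω))

/-- The triples `(v, θ, M)` as a product. -/
noncomputable def velEquiv : Vel Ω ≃L[ℝ] L2v Ω × L2 Ω × L2v Ω :=
  ContinuousLinearEquiv.refl ℝ (L2v Ω × L2 Ω × L2v Ω)

/-- Component of a vector field. -/
noncomputable abbrev compL (i : Fin 3) : W0v Ω →L[ℝ] W0 Ω := PiLp.proj 2 (fun _ : Fin 3 => W0 Ω) i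

/-- The first component of a triple. -/
noncomputable def confU : Conf Ω →L[ℝ] W0v Ω :=
  (ContinuousLinearMap.fst ℝ _ _).comp (confEquiv Ω).toContinuousLinearMap

/-- The second component of a triple. -/
noncomputable def confT : Conf Ω →L[ℝ] W0 Ω :=
  (WithLp.fstL 2 ℝ _ _).comp
    ((ContinuousLinearMap.snd ℝ _ _).comp (confEquiv Ω).toContinuousLinearMap)

/-- The third component of a triple. -/
noncomputable def confR : Conf Ω →L[ℝ] W0v Ω :=
  (WithLp.sndL 2 ℝ _ _).comp
    ((ContinuousLinearMap.snd ℝ _ _).comp (confEquiv Ω).toContinuousLinearMap)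

/-- Strain of the displacement. -/
noncomputable def dU (i j : Fin 3) : Conf Ω →L[ℝ] L2 Ω := (strainL Ω i j).comp (confU Ω)

/-- Gradient of the scalar component. -/
noncomputable def dT (i : Fin 3) : Conf Ω →L[ℝ] L2 Ω := (gradL Ω i).comp (confT Ω)

/-- Value of the scalar component. -/
noncomputable def vT : Conf Ω →L[ℝ] L2 Ω := (valL Ω).comp (confT Ω)

/-- Gradient of the third component. -/
noncomputable def dR (i j : Fin 3) : Conf Ω →L[ℝ] L2 Ω :=
  (gradL Ω j).comp ((compL Ω i).comp (confR Ω))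

/-- Value of the third component. -/
noncomputable def vR (i : Fin 3) : Conf Ω →L[ℝ] L2 Ω :=
  (valL Ω).comp ((compL Ω i).comp (confR Ω))

/-- `valv` as a bounded operator. -/
noncomputable def valvL : W0v Ω →L[ℝ] L2v Ω :=
  (PiLp.continuousLinearEquiv 2 ℝ (fun _ : Fin 3 => L2 Ω)).symm.toContinuousLinearMap.comp
    (ContinuousLinearMap.pi fun i => (valL Ω).comp (compL Ω i))

/-- The embedding of `𝐖_0^{1,2} × W_0^{1,2} × 𝐖_0^{1,2}` into `𝐋² × L² × 𝐋²`. -/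
noncomputable def embL : Conf Ω →L[ℝ] Vel Ω :=
  (velEquiv Ω).symm.toContinuousLinearMap.comp
    (((valvL Ω).comp (confU Ω)).prod ((vT Ω).prod ((valvL Ω).comp (confR Ω))))

/-- Components of the first entry. -/
noncomputable def velV (i : Fin 3) : Vel Ω →L[ℝ] L2 Ω :=
  (PiLp.proj 2 (fun _ : Fin 3 => L2 Ω) i : L2v Ω →L[ℝ] L2 Ω).comp
    ((ContinuousLinearMap.fst ℝ _ _).comp (velEquiv Ω).toContinuousLinearMap)

/-- The second entry. -/
noncomputable def velT : Vel Ω →L[ℝ] L2 Ω :=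
  (ContinuousLinearMap.fst ℝ _ _).comp
    ((ContinuousLinearMap.snd ℝ _ _).comp (velEquiv Ω).toContinuousLinearMap)

/-- Components of the third entry. -/
noncomputable def velM (i : Fin 3) : Vel Ω →L[ℝ] L2 Ω :=
  (PiLp.proj 2 (fun _ : Fin 3 => L2 Ω) i : L2v Ω →L[ℝ] L2 Ω).comp
    ((ContinuousLinearMap.snd ℝ _ _).comp
      ((ContinuousLinearMap.snd ℝ _ _).comp (velEquiv Ω).toContinuousLinearMap))

variable {Ω}

theorem sq_norm_conf (z : Conf Ω) :
    ‖z‖ ^ 2 = ‖confU Ω z‖ ^ 2 + (‖confT Ω z‖ ^ 2 + ‖confR Ω z‖ ^ 2) := by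
  have h : ‖z‖ ^ 2 = ‖confU Ω z‖ ^ 2 + ‖(confEquiv Ω z).2‖ ^ 2 :=
    WithLp.prod_norm_sq_eq_of_L2 (α := W0v Ω) (β := WithLp 2 (W0 Ω × W0v Ω)) z
  rw [h, WithLp.prod_norm_sq_eq_of_L2]
  rfl

theorem sq_norm_vel_le (y : Vel Ω) :
    ‖y‖ ^ 2 ≤ (∑ i, ‖velV Ω i y‖ ^ 2) + ‖velT Ω y‖ ^ 2 + ∑ i, ‖velM Ω i y‖ ^ 2 := by
  have h : ∀ a b c : ℝ, 0 ≤ a → 0 ≤ b → 0 ≤ c →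
      max a (max b c) ^ 2 ≤ a ^ 2 + b ^ 2 + c ^ 2 := fun a b c ha hb hc => by
    rcases max_choice a (max b c) with h | h <;> rw [h]
    · nlinarith
    · rcases max_choice b c with h | h <;> rw [h] <;> nlinarith
  have h1 : ∑ i, ‖velV Ω i y‖ ^ 2 = ‖(velEquiv Ω y).1‖ ^ 2 := (PiLp.norm_sq_eq_of_L2 _ _).symm
  have h2 : ∑ i, ‖velM Ω i y‖ ^ 2 = ‖(velEquiv Ω y).2.2‖ ^ 2 := (PiLp.norm_sq_eq_of_L2 _ _).symm
  rw [h1, h2]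
  exact h _ _ _ (norm_nonneg (velEquiv Ω y).1) (norm_nonneg (velEquiv Ω y).2.1)
    (norm_nonneg (velEquiv Ω y).2.2)

theorem sq_norm_W0 (w : W0 Ω) : ‖w‖ ^ 2 = ‖val w‖ ^ 2 + ∑ i, ‖grad w i‖ ^ 2 := by
  have h : ‖w‖ = ‖(w : Jet Ω)‖ := rfl
  rw [h, WithLp.prod_norm_sq_eq_of_L2, PiLp.norm_sq_eq_of_L2]
  rfl

theorem exists_sq_norm_W0_le (hΩb : Bornology.IsBounded Ω) :
    ∃ K : ℝ, 1 ≤ K ∧ ∀ w : W0 Ω, ‖w‖ ^ 2 ≤ K * ∑ i, ‖grad w i‖ ^ 2 := by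
  obtain ⟨C, hC, h⟩ := exists_poincare hΩb
  refine ⟨1 + 3 * C ^ 2, by nlinarith [sq_nonneg C], fun w => ?_⟩
  have h1 : (∑ i, ‖grad w i‖) ^ 2 ≤ 3 * ∑ i, ‖grad w i‖ ^ 2 := by
    have := sq_sum_le_card_mul_sum_sq (s := Finset.univ) (f := fun i : Fin 3 => ‖grad w i‖)
    simpa using this
  have h2 : ‖val w‖ ^ 2 ≤ C ^ 2 * (∑ i, ‖grad w i‖) ^ 2 := by
    rw [← mul_pow]; exact pow_le_pow_left₀ (norm_nonneg _) (h w) 2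
  rw [sq_norm_W0]
  nlinarith [sq_nonneg C]

/-- The bilinear form `∫ p f(x) g(y)`. -/
noncomputable def mulForm {V : Type*} [NormedAddCommGroup V] [NormedSpace ℝ V] (p : E3 → ℝ)
    (f g : V →L[ℝ] L2 Ω) : V →L[ℝ] V →L[ℝ] ℝ :=
  (innerSL ℝ (E := L2 Ω)).bilinearComp ((mulOp Ω p).comp f) g

theorem mulForm_apply {V : Type*} [NormedAddCommGroup V] [NormedSpace ℝ V] (p : E3 → ℝ)
    (f g : V →L[ℝ] L2 Ω) (x y : V) : mulForm p f g x y = ⟪mulOp Ω p (f x), g y⟫ := rfl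

end Spaces

namespace Material

variable (m : Material) (Ω : Set E3)

/-- The kinetic form. -/
noncomputable def kin : Vel Ω →L[ℝ] Vel Ω →L[ℝ] ℝ :=
  (∑ i, mulForm m.ρ (velV Ω i) (velV Ω i)) + mulForm m.c (velT Ω) (velT Ω)
    + ∑ i, ∑ j, mulForm (m.kap i j) (velM Ω i) (velM Ω j)

/-- The stored energy form. -/
noncomputable def stored : Conf Ω →L[ℝ] Conf Ω →L[ℝ] ℝ :=
  (∑ i, ∑ j, ∑ k, ∑ l, mulForm (m.A i j k l) (dU Ω k l) (dU Ω i j))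
    + (∑ i, ∑ j, ∑ k, ∑ l, (mulForm (m.B i j k l) (dU Ω i j) (dR Ω k l)
        + mulForm (m.B i j k l) (dR Ω k l) (dU Ω i j)))
    + (∑ i, ∑ j, mulForm (m.K i j) (dT Ω i) (dT Ω j))
    + ∑ i, ∑ j, ∑ k, ∑ l, mulForm (m.C i j k l) (dR Ω i j) (dR Ω k l)

/-- The form of dissipation and thermoelastic coupling. -/
noncomputable def coupling : Conf Ω →L[ℝ] Conf Ω →L[ℝ] ℝ :=
  (∑ i, ∑ j, (mulForm (m.a i j) (dU Ω i j) (vT Ω) - mulForm (m.a i j) (vT Ω) (dU Ω i j)))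
    + (∑ i, ∑ j, (mulForm (m.b i j) (dR Ω i j) (vT Ω) - mulForm (m.b j i) (vT Ω) (dR Ω i j)))
    + (∑ i, ∑ j, (mulForm (m.d i j) (dT Ω j) (vR Ω i) - mulForm (m.d i j) (vR Ω j) (dT Ω i)))
    + (∑ i, ∑ j, mulForm (m.Kt i j) (dT Ω j) (dT Ω i))
    + ∑ i, ∑ j, ∑ k, ∑ l, mulForm (m.Ct j i k l) (dR Ω k l) (dR Ω i j)

variable {m Ω}

theorem kin_apply (x y : Vel Ω) : m.kin Ω x y = (∑ i, ⟪mulOp Ω m.ρ (velV Ω i x), velV Ω i y⟫)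
    + ⟪mulOp Ω m.c (velT Ω x), velT Ω y⟫
    + ∑ i, ∑ j, ⟪mulOp Ω (m.kap i j) (velM Ω i x), velM Ω j y⟫ := by
  simp only [kin, _root_.add_apply, _root_.sum_apply, mulForm_apply]

theorem stored_apply (x y : Conf Ω) : m.stored Ω x y =
    (∑ i, ∑ j, ∑ k, ∑ l, ⟪mulOp Ω (m.A i j k l) (dU Ω k l x), dU Ω i j y⟫)
    + (∑ i, ∑ j, ∑ k, ∑ l, (⟪mulOp Ω (m.B i j k l) (dU Ω i j x), dR Ω k l y⟫
        + ⟪mulOp Ω (m.B i j k l) (dR Ω k l x), dU Ω i j y⟫))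
    + (∑ i, ∑ j, ⟪mulOp Ω (m.K i j) (dT Ω i x), dT Ω j y⟫)
    + ∑ i, ∑ j, ∑ k, ∑ l, ⟪mulOp Ω (m.C i j k l) (dR Ω i j x), dR Ω k l y⟫ := by
  simp only [stored, _root_.add_apply, _root_.sum_apply, mulForm_apply]

theorem coupling_apply (x y : Conf Ω) : m.coupling Ω x y =
    (∑ i, ∑ j, (⟪mulOp Ω (m.a i j) (dU Ω i j x), vT Ω y⟫ - ⟪mulOp Ω (m.a i j) (vT Ω x), dU Ω i j y⟫))
    + (∑ i, ∑ j, (⟪mulOp Ω (m.b i j) (dR Ω i j x), vT Ω y⟫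
        - ⟪mulOp Ω (m.b j i) (vT Ω x), dR Ω i j y⟫))
    + (∑ i, ∑ j, (⟪mulOp Ω (m.d i j) (dT Ω j x), vR Ω i y⟫ - ⟪mulOp Ω (m.d i j) (vR Ω j x), dT Ω i y⟫))
    + (∑ i, ∑ j, ⟪mulOp Ω (m.Kt i j) (dT Ω j x), dT Ω i y⟫)
    + ∑ i, ∑ j, ∑ k, ∑ l, ⟪mulOp Ω (m.Ct j i k l) (dR Ω k l x), dR Ω i j y⟫ := by
  simp only [coupling, _root_.add_apply, _root_.sub_apply, _root_.sum_apply, mulForm_apply]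

/-- The part of the integrand of the energy inner product belonging to the kinetic form. -/
theorem hasInt_kin (hreg : m.Regular Ω) (x y : Vel Ω) :
    HasInt Ω (fun s => m.ρ s * (∑ i, velV Ω i x s * velV Ω i y s) + m.c s * velT Ω x s * velT Ω y s
      + ∑ i, ∑ j, m.kap i j s * velM Ω i x s * velM Ω j y s) (m.kin Ω x y) := by
  rw [kin_apply]
  refine HasInt.add (HasInt.add ?_ (HasInt.mul_mul hreg.c_bdd .rfl .rfl))
    (HasInt.sum fun i => HasInt.sum fun j => HasInt.mul_mul (hreg.kap_bdd i j) .rfl .rfl)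
  refine HasInt.congr (HasInt.sum fun i => HasInt.mul_mul hreg.ρ_bdd .rfl .rfl)
    (Eventually.of_forall fun s => ?_)
  simp only [Finset.mul_sum, mul_assoc]

theorem hasInt_stored (hreg : m.Regular Ω) (x y : Conf Ω) :
    HasInt Ω (m.twoW (confU Ω x) (confT Ω x) (confR Ω x) (confU Ω y) (confT Ω y) (confR Ω y))
      (m.stored Ω x y) := by
  rw [stored_apply]
  have he : ∀ i j (x : Conf Ω), dU Ω i j x =ᵐ[vol Ω] strain (confU Ω x) i j :=
    fun i j x => coeFn_strainL _ i j
  refine ((HasInt.add ?_ ?_).add ?_).add ?_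
  · exact HasInt.sum fun i => HasInt.sum fun j => HasInt.sum fun k => HasInt.sum fun l =>
      HasInt.mul_mul (hreg.A_bdd i j k l) (he k l x) (he i j y)
  · refine HasInt.sum fun i => HasInt.sum fun j => HasInt.sum fun k => HasInt.sum fun l =>
      ((HasInt.mul_mul (hreg.B_bdd i j k l) (he i j x) (b := grad (confR Ω y k) l) .rfl).add
      (HasInt.mul_mul (hreg.B_bdd i j k l) (a := grad (confR Ω x k) l) .rfl (he i j y))).congr
        (Eventually.of_forall fun s => ?_)
    ring
  · exact HasInt.sum fun i => HasInt.sum fun j => HasInt.mul_mul (hreg.K_bdd i j) .rfl .rfl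
  · exact HasInt.sum fun i => HasInt.sum fun j => HasInt.sum fun k => HasInt.sum fun l =>
      HasInt.mul_mul (hreg.C_bdd i j k l) .rfl .rfl

theorem kin_symm (hsym : m.Symmetric Ω) (x y : Vel Ω) : m.kin Ω x y = m.kin Ω y x := by
  have hk : ∀ i j, mulOp Ω (m.kap i j) = mulOp Ω (m.kap j i) := fun i j =>
    mulOp_congr (by filter_upwards [hsym.kap_symm] with s hs using hs i j)
  rw [kin_apply, kin_apply]
  congr 1
  · congr 1
    · exact Finset.sum_congr rfl fun i _ => inner_mulOp_comm _ _
    · exact inner_mulOp_comm _ _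
  · rw [Finset.sum_comm]
    refine Finset.sum_congr rfl fun i _ => Finset.sum_congr rfl fun j _ => ?_
    rw [inner_mulOp_comm, hk]

theorem sum_swap_pairs (F : Fin 3 → Fin 3 → Fin 3 → Fin 3 → ℝ) :
    ∑ i, ∑ j, ∑ k, ∑ l, F i j k l = ∑ i, ∑ j, ∑ k, ∑ l, F k l i j := by
  calc ∑ i, ∑ j, ∑ k, ∑ l, F i j k l
      = ∑ q : Fin 3 × Fin 3, ∑ r : Fin 3 × Fin 3, F q.1 q.2 r.1 r.2 := by
        simp only [Fintype.sum_prod_type]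
    _ = ∑ r : Fin 3 × Fin 3, ∑ q : Fin 3 × Fin 3, F q.1 q.2 r.1 r.2 := Finset.sum_comm
    _ = _ := by simp only [Fintype.sum_prod_type]

theorem stored_symm (hsym : m.Symmetric Ω) (x y : Conf Ω) :
    m.stored Ω x y = m.stored Ω y x := by
  have hA : ∀ i j k l, mulOp Ω (m.A i j k l) = mulOp Ω (m.A k l i j) := fun i j k l =>
    mulOp_congr (by filter_upwards [hsym.A_major] with s hs using hs i j k l)
  have hC : ∀ i j k l, mulOp Ω (m.C i j k l) = mulOp Ω (m.C k l i j) := fun i j k l =>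
    mulOp_congr (by filter_upwards [hsym.C_major] with s hs using hs i j k l)
  have hK : ∀ i j, mulOp Ω (m.K i j) = mulOp Ω (m.K j i) := fun i j =>
    mulOp_congr (by filter_upwards [hsym.K_symm] with s hs using hs i j)
  rw [stored_apply, stored_apply]
  refine congrArg₂ (· + ·) (congrArg₂ (· + ·) (congrArg₂ (· + ·) ?_ ?_) ?_) ?_
  · rw [sum_swap_pairs]
    refine Finset.sum_congr rfl fun i _ => Finset.sum_congr rfl fun j _ =>
      Finset.sum_congr rfl fun k _ => Finset.sum_congr rfl fun l _ => ?_
    rw [inner_mulOp_comm, hA]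
  · refine Finset.sum_congr rfl fun i _ => Finset.sum_congr rfl fun j _ =>
      Finset.sum_congr rfl fun k _ => Finset.sum_congr rfl fun l _ => ?_
    rw [inner_mulOp_comm, add_comm, inner_mulOp_comm]
  · rw [Finset.sum_comm]
    refine Finset.sum_congr rfl fun i _ => Finset.sum_congr rfl fun j _ => ?_
    rw [inner_mulOp_comm, hK]
  · rw [sum_swap_pairs]
    refine Finset.sum_congr rfl fun i _ => Finset.sum_congr rfl fun j _ =>
      Finset.sum_congr rfl fun k _ => Finset.sum_congr rfl fun l _ => ?_
    rw [inner_mulOp_comm, hC]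

theorem exists_kin_coercive (hreg : m.Regular Ω) (hdiss : m.Dissipative Ω) :
    ∃ r : ℝ, 0 < r ∧ ∀ y, r * ‖y‖ ^ 2 ≤ m.kin Ω y y := by
  obtain ⟨r₁, hr₁, h₁⟩ := hdiss.ρ_pos
  obtain ⟨r₂, hr₂, h₂⟩ := hreg.c_pos
  obtain ⟨r₃, hr₃, h₃⟩ := hreg.kap_pos
  set r := min r₁ (min r₂ r₃) with hr
  have hrpos : 0 < r := lt_min hr₁ (lt_min hr₂ hr₃)
  have e1 : r ≤ r₁ := min_le_left _ _
  have e2 : r ≤ r₂ := (min_le_right _ _).trans (min_le_left _ _)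
  have e3 : r ≤ r₃ := (min_le_right _ _).trans (min_le_right _ _)
  refine ⟨r, hrpos, fun y => ?_⟩
  have hI : HasInt Ω (fun s => r * ((∑ i, velV Ω i y s * velV Ω i y s) + velT Ω y s * velT Ω y s
      + ∑ i, velM Ω i y s * velM Ω i y s)) (r * ((∑ i, ‖velV Ω i y‖ ^ 2) + ‖velT Ω y‖ ^ 2 + ∑ i, ‖velM Ω i y‖ ^ 2)) :=
    (((HasInt.sum fun i => HasInt.sq .rfl).add (HasInt.sq .rfl)).add
      (HasInt.sum fun i => HasInt.sq .rfl)).const_mul r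
  have hle := hI.mono (hasInt_kin hreg y y) (by
    filter_upwards [h₁, h₂, h₃] with s g1 g2 g3
    have p1 : 0 ≤ ∑ i, velV Ω i y s * velV Ω i y s := Finset.sum_nonneg fun i _ => mul_self_nonneg _
    have p3 : 0 ≤ ∑ i, velM Ω i y s * velM Ω i y s := Finset.sum_nonneg fun i _ => mul_self_nonneg _
    have p2 := mul_self_nonneg (velT Ω y s)
    have q1 := mul_le_mul_of_nonneg_right (e1.trans g1) p1
    have q2 := mul_le_mul_of_nonneg_right (e2.trans g2) p2
    have q3 := mul_le_mul_of_nonneg_right e3 p3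
    have q4 := g3 fun i => velM Ω i y s
    simp only [mul_add]
    linarith [mul_assoc (m.c s) (velT Ω y s) (velT Ω y s)])
  refine le_trans (mul_le_mul_of_nonneg_left ?_ hrpos.le) hle
  exact sq_norm_vel_le y

theorem exists_stored_coercive (hΩb : Bornology.IsBounded Ω) (hreg : m.Regular Ω)
    (hcoer : m.Coercive Ω) : ∃ r : ℝ, 0 < r ∧ ∀ z, r * ‖z‖ ^ 2 ≤ m.stored Ω z z := by
  obtain ⟨c₀, hc₀, h⟩ := hcoer
  obtain ⟨K, hK1, hK⟩ := exists_sq_norm_W0_le hΩb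
  refine ⟨c₀ / (2 * K), by positivity, fun z => ?_⟩
  have h1 : HasInt Ω (fun s => (∑ i, ∑ j, strain (confU Ω z) i j s * strain (confU Ω z) i j s)
      + (∑ i, grad (confT Ω z) i s * grad (confT Ω z) i s)
      + ∑ i, ∑ j, grad (confR Ω z i) j s * grad (confR Ω z i) j s)
      ((∑ i, ∑ j, ‖strainL Ω i j (confU Ω z)‖ ^ 2) + (∑ i, ‖grad (confT Ω z) i‖ ^ 2)
        + ∑ i, ∑ j, ‖grad (confR Ω z i) j‖ ^ 2) :=
    ((HasInt.sum fun i => HasInt.sum fun j => HasInt.sq (coeFn_strainL _ i j)).add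
      (HasInt.sum fun i => HasInt.sq .rfl)).add
      (HasInt.sum fun i => HasInt.sum fun j => HasInt.sq .rfl)
  have h2 := (hasInt_stored hreg z z).congr (Eventually.of_forall fun s => by
    show _ = (∑ i, ∑ j, ∑ k, ∑ l, m.A i j k l s * strain (confU Ω z) k l s *
        strain (confU Ω z) i j s)
      + (∑ i, ∑ j, ∑ k, ∑ l, 2 * m.B i j k l s * strain (confU Ω z) i j s *
        grad (confR Ω z k) l s)
      + (∑ i, ∑ j, m.K i j s * grad (confT Ω z) i s * grad (confT Ω z) j s)
      + ∑ i, ∑ j, ∑ k, ∑ l, m.C i j k l s * grad (confR Ω z i) j s * grad (confR Ω z k) l s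
    rw [twoW]
    congr 3
    refine Finset.sum_congr rfl fun i _ => Finset.sum_congr rfl fun j _ =>
      Finset.sum_congr rfl fun k _ => Finset.sum_congr rfl fun l _ => ?_
    ring)
  have h3 := h (confU Ω z) (confT Ω z) (confR Ω z)
  rw [h1.2, h2.2] at h3
  refine le_trans ?_ h3
  have hv : ∀ u : W0v Ω, ‖u‖ ^ 2 ≤ K * ∑ i, ∑ j, ‖grad (u i) j‖ ^ 2 := fun u => by
    rw [PiLp.norm_sq_eq_of_L2, Finset.mul_sum]
    exact Finset.sum_le_sum fun i _ => hK (u i)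
  have k1 := hv (confU Ω z)
  have k2 := hv (confR Ω z)
  have k3 := hK (confT Ω z)
  have k4 := korn (confU Ω z)
  have p2 : 0 ≤ ∑ i, ∑ j, ‖grad (confR Ω z i) j‖ ^ 2 := by positivity
  have p3 : 0 ≤ ∑ i, ‖grad (confT Ω z) i‖ ^ 2 := by positivity
  rw [div_mul_eq_mul_div, div_le_iff₀ (by positivity), sq_norm_conf, mul_assoc]
  refine mul_le_mul_of_nonneg_left ?_ hc₀.le
  have k5 := mul_le_mul_of_nonneg_left k4 (zero_le_one.trans hK1)
  have p4 := mul_nonneg (zero_le_one.trans hK1) p2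
  have p5 := mul_nonneg (zero_le_one.trans hK1) p3
  linarith

theorem coupling_nonneg (hreg : m.Regular Ω) (hsym : m.Symmetric Ω) (hdiss : m.Dissipative Ω)
    (z : Conf Ω) : 0 ≤ m.coupling Ω z z := by
  have hb : ∀ i j, mulOp Ω (m.b i j) = mulOp Ω (m.b j i) := fun i j =>
    mulOp_congr (by filter_upwards [hsym.b_symm] with s hs using hs i j)
  have hd : ∀ i j, mulOp Ω (m.d i j) = mulOp Ω (m.d j i) := fun i j =>
    mulOp_congr (by filter_upwards [hsym.d_symm] with s hs using hs i j)
  have h1 : ∑ i, ∑ j, (⟪mulOp Ω (m.a i j) (dU Ω i j z), vT Ω z⟫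
      - ⟪mulOp Ω (m.a i j) (vT Ω z), dU Ω i j z⟫) = 0 :=
    Finset.sum_eq_zero fun i _ => Finset.sum_eq_zero fun j _ => by
      rw [inner_mulOp_comm, sub_self]
  have h2 : ∑ i, ∑ j, (⟪mulOp Ω (m.b i j) (dR Ω i j z), vT Ω z⟫
      - ⟪mulOp Ω (m.b j i) (vT Ω z), dR Ω i j z⟫) = 0 :=
    Finset.sum_eq_zero fun i _ => Finset.sum_eq_zero fun j _ => by
      rw [inner_mulOp_comm, hb, sub_self]
  have h3 : ∑ i, ∑ j, (⟪mulOp Ω (m.d i j) (dT Ω j z), vR Ω i z⟫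
      - ⟪mulOp Ω (m.d i j) (vR Ω j z), dT Ω i z⟫) = 0 := by
    simp only [Finset.sum_sub_distrib]
    rw [sub_eq_zero, Finset.sum_comm]
    refine Finset.sum_congr rfl fun i _ => Finset.sum_congr rfl fun j _ => ?_
    rw [inner_mulOp_comm, hd]
  rw [coupling_apply, h1, h2, h3, zero_add, zero_add, zero_add]
  have hI := (HasInt.sum fun i => HasInt.sum fun j =>
      HasInt.mul_mul (hreg.Kt_bdd i j) (f := dT Ω j z) (g := dT Ω i z) .rfl .rfl).add
    (HasInt.sum fun i => HasInt.sum fun j => HasInt.sum fun k => HasInt.sum fun l =>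
      HasInt.mul_mul (hreg.Ct_bdd j i k l) (f := dR Ω k l z) (g := dR Ω i j z) .rfl .rfl)
  refine hI.nonneg ?_
  filter_upwards [hdiss.dissipation, hsym.Ct_major] with s h hs
  refine (h (fun i => dT Ω i z s) fun i j => dR Ω i j z s).trans_eq ?_
  congr 1
  · refine Finset.sum_congr rfl fun i _ => Finset.sum_congr rfl fun j _ => ?_
    ring
  · rw [sum_swap_pairs, Finset.sum_comm]
    refine Finset.sum_congr rfl fun i _ => Finset.sum_congr rfl fun j _ =>
      Finset.sum_congr rfl fun k _ => Finset.sum_congr rfl fun l _ => ?_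
    rw [hs k l j i]
    ring

end Material

end MicroTherm

namespace MicroTherm

open Filter Topology
open scoped RealInnerProductSpace

section Representatives

variable {Ω : Set E3} {f g : L2 Ω} {a b p : E3 → ℝ}

theorem ae_add (hf : f =ᵐ[vol Ω] a) (hg : g =ᵐ[vol Ω] b) :
    (f + g : L2 Ω) =ᵐ[vol Ω] fun x => a x + b x := (Lp.coeFn_add f g).trans (hf.add hg)

theorem ae_sub (hf : f =ᵐ[vol Ω] a) (hg : g =ᵐ[vol Ω] b) :
    (f - g : L2 Ω) =ᵐ[vol Ω] fun x => a x - b x := (Lp.coeFn_sub f g).trans (hf.sub hg)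

theorem ae_neg (hf : f =ᵐ[vol Ω] a) : (-f : L2 Ω) =ᵐ[vol Ω] fun x => -a x :=
  (Lp.coeFn_neg f).trans hf.neg

theorem ae_sum {n : ℕ} {f : Fin n → L2 Ω} {a : Fin n → E3 → ℝ} (h : ∀ i, f i =ᵐ[vol Ω] a i) :
    (∑ i, f i : L2 Ω) =ᵐ[vol Ω] fun x => ∑ i, a i x := by
  induction n with
  | zero =>
    simp only [Finset.univ_eq_empty, Finset.sum_empty]
    exact Lp.coeFn_zero ℝ 2 (vol Ω)
  | succ n ih =>
    simp only [Fin.sum_univ_succ]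
    exact ae_add (h 0) (ih fun i => h i.succ)

theorem ae_mul (hp : MemLp p ∞ (vol Ω)) (hf : f =ᵐ[vol Ω] a) :
    mulOp Ω p f =ᵐ[vol Ω] fun x => p x * a x := by
  filter_upwards [coeFn_mulOp hp f, hf] with x h1 h2
  rw [h1, h2]

end Representatives

theorem sum_grad_eq_sum_strain {Ω : Set E3} {T : Fin 3 → Fin 3 → L2 Ω} (hT : ∀ i j, T i j = T j i)
    (w : W0v Ω) :
    ∑ i, ∑ j, ⟪T j i, grad (w i) j⟫ = ∑ i, ∑ j, ⟪T i j, strainL Ω i j w⟫ := by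
  have h1 : ∑ i, ∑ j, ⟪T i j, grad (w j) i⟫ = ∑ i, ∑ j, ⟪T j i, grad (w i) j⟫ := Finset.sum_comm
  have h2 : ∑ i, ∑ j, ⟪T i j, grad (w i) j⟫ = ∑ i, ∑ j, ⟪T j i, grad (w i) j⟫ :=
    Finset.sum_congr rfl fun i _ => Finset.sum_congr rfl fun j _ => by rw [hT]
  simp only [strainL_apply, real_inner_smul_right, inner_add_right, ← Finset.mul_sum,
    Finset.sum_add_distrib, h1, h2]
  ring

namespace Material

variable (m : Material) {Ω : Set E3}

/-- The stress as an element of `L²`. -/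
noncomputable def stressL (x x' : Conf Ω) (j i : Fin 3) : L2 Ω :=
  (∑ k, ∑ l, mulOp Ω (m.A j i k l) (dU Ω k l x)) - mulOp Ω (m.a j i) (vT Ω x')
    + ∑ k, ∑ l, mulOp Ω (m.B j i k l) (dR Ω l k x)

/-- The entropy flux as an element of `L²`. -/
noncomputable def fluxL (x x' : Conf Ω) (i : Fin 3) : L2 Ω :=
  ∑ j, (-(mulOp Ω (m.d i j) (vR Ω j x')) + mulOp Ω (m.K i j) (dT Ω j x)
    + mulOp Ω (m.Kt i j) (dT Ω j x'))

/-- The first entropy flux moment as an element of `L²`. -/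
noncomputable def momentL (x x' : Conf Ω) (j i : Fin 3) : L2 Ω :=
  (∑ k, ∑ l, mulOp Ω (m.B k l j i) (dU Ω k l x)) - mulOp Ω (m.b j i) (vT Ω x')
    + (∑ k, ∑ l, mulOp Ω (m.C j i k l) (dR Ω k l x))
    + ∑ k, ∑ l, mulOp Ω (m.Ct j i k l) (dR Ω k l x')

/-- The left-hand side of the entropy equation. -/
noncomputable def entropyRate (x' : Conf Ω) (y' : Vel Ω) : L2 Ω :=
  mulOp Ω m.c (velT Ω y') + (∑ i, ∑ j, mulOp Ω (m.a i j) (dU Ω i j x'))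
    + ∑ i, ∑ j, mulOp Ω (m.b i j) (dR Ω i j x')

/-- The left-hand side of the equation of first entropy moment. -/
noncomputable def momentRate (x' : Conf Ω) (y' : Vel Ω) (i : Fin 3) : L2 Ω :=
  (∑ j, mulOp Ω (m.kap i j) (velM Ω j y')) + ∑ j, mulOp Ω (m.d i j) (dT Ω j x')

variable {m}

theorem sum_inner_stressL (hsym : m.Symmetric Ω) (x x' z : Conf Ω) :
    ∑ i, ∑ j, ⟪m.stressL x x' j i, grad (confU Ω z i) j⟫ =
      (∑ i, ∑ j, ∑ k, ∑ l, ⟪mulOp Ω (m.A i j k l) (dU Ω k l x), dU Ω i j z⟫)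
      - (∑ i, ∑ j, ⟪mulOp Ω (m.a i j) (vT Ω x'), dU Ω i j z⟫)
      + ∑ i, ∑ j, ∑ k, ∑ l, ⟪mulOp Ω (m.B i j k l) (dR Ω k l x), dU Ω i j z⟫ := by
  have hA : ∀ i j k l, mulOp Ω (m.A i j k l) = mulOp Ω (m.A j i k l) := fun i j k l =>
    mulOp_congr (by filter_upwards [hsym.A_minor] with s hs using hs i j k l)
  have hB : ∀ i j k l, mulOp Ω (m.B i j k l) = mulOp Ω (m.B j i k l) := fun i j k l =>
    mulOp_congr (by filter_upwards [hsym.B_minor] with s hs using hs i j k l)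
  have hB' : ∀ i j k l, mulOp Ω (m.B i j k l) = mulOp Ω (m.B i j l k) := fun i j k l =>
    mulOp_congr (by
      filter_upwards [hsym.B_minor, hsym.B_major] with s h1 h2
      rw [h2, h1, h2])
  have ha : ∀ i j, mulOp Ω (m.a i j) = mulOp Ω (m.a j i) := fun i j =>
    mulOp_congr (by filter_upwards [hsym.a_symm] with s hs using hs i j)
  have hT : ∀ i j, m.stressL x x' i j = m.stressL x x' j i := fun i j => by
    simp only [stressL, hA i j, hB i j, ha i j]
  rw [sum_grad_eq_sum_strain hT]
  simp only [stressL, inner_add_left, inner_sub_left, sum_inner, Finset.sum_add_distrib,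
    Finset.sum_sub_distrib]
  refine congrArg₂ (· + ·) rfl ?_
  refine Finset.sum_congr rfl fun i _ => Finset.sum_congr rfl fun j _ => ?_
  rw [Finset.sum_comm]
  refine Finset.sum_congr rfl fun k _ => Finset.sum_congr rfl fun l _ => ?_
  rw [hB']
  rfl

theorem sum_inner_fluxL (hsym : m.Symmetric Ω) (x x' z : Conf Ω) :
    ∑ i, ⟪m.fluxL x x' i, dT Ω i z⟫ =
      -(∑ i, ∑ j, ⟪mulOp Ω (m.d i j) (vR Ω j x'), dT Ω i z⟫)
      + (∑ i, ∑ j, ⟪mulOp Ω (m.K i j) (dT Ω i x), dT Ω j z⟫)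
      + ∑ i, ∑ j, ⟪mulOp Ω (m.Kt i j) (dT Ω j x'), dT Ω i z⟫ := by
  have hK : ∀ i j, mulOp Ω (m.K i j) = mulOp Ω (m.K j i) := fun i j =>
    mulOp_congr (by filter_upwards [hsym.K_symm] with s hs using hs i j)
  have h1 : ∑ i, ∑ j, ⟪mulOp Ω (m.K i j) (dT Ω j x), dT Ω i z⟫ =
      ∑ i, ∑ j, ⟪mulOp Ω (m.K i j) (dT Ω i x), dT Ω j z⟫ := by
    rw [Finset.sum_comm]
    refine Finset.sum_congr rfl fun i _ => Finset.sum_congr rfl fun j _ => ?_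
    rw [hK]
  simp only [fluxL, sum_inner, inner_add_left, inner_neg_left, Finset.sum_add_distrib,
    Finset.sum_neg_distrib, h1]

theorem sum_inner_momentL (hsym : m.Symmetric Ω) (x x' z : Conf Ω) :
    ∑ i, ∑ j, ⟪m.momentL x x' j i, dR Ω i j z⟫ =
      (∑ i, ∑ j, ∑ k, ∑ l, ⟪mulOp Ω (m.B i j k l) (dU Ω i j x), dR Ω k l z⟫)
      - (∑ i, ∑ j, ⟪mulOp Ω (m.b j i) (vT Ω x'), dR Ω i j z⟫)
      + (∑ i, ∑ j, ∑ k, ∑ l, ⟪mulOp Ω (m.C i j k l) (dR Ω i j x), dR Ω k l z⟫)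
      + ∑ i, ∑ j, ∑ k, ∑ l, ⟪mulOp Ω (m.Ct j i k l) (dR Ω k l x'), dR Ω i j z⟫ := by
  have hB : ∀ i j k l, mulOp Ω (m.B i j k l) = mulOp Ω (m.B i j l k) := fun i j k l =>
    mulOp_congr (by
      filter_upwards [hsym.B_minor, hsym.B_major] with s h1 h2
      rw [h2, h1, h2])
  have hC : ∀ i j k l, mulOp Ω (m.C i j k l) = mulOp Ω (m.C l k i j) := fun i j k l =>
    mulOp_congr (by
      filter_upwards [hsym.C_minor, hsym.C_major] with s h1 h2
      rw [h2, h1])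
  have h1 : ∑ i, ∑ j, ∑ k, ∑ l, ⟪mulOp Ω (m.B i j k l) (dU Ω i j x), dR Ω k l z⟫ =
      ∑ i, ∑ j, ∑ k, ∑ l, ⟪mulOp Ω (m.B k l j i) (dU Ω k l x), dR Ω i j z⟫ := by
    rw [sum_swap_pairs]
    refine Finset.sum_congr rfl fun i _ => Finset.sum_congr rfl fun j _ =>
      Finset.sum_congr rfl fun k _ => Finset.sum_congr rfl fun l _ => ?_
    rw [hB]
  have h2 : ∑ i, ∑ j, ∑ k, ∑ l, ⟪mulOp Ω (m.C i j k l) (dR Ω i j x), dR Ω k l z⟫ =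
      ∑ i, ∑ j, ∑ k, ∑ l, ⟪mulOp Ω (m.C j i k l) (dR Ω k l x), dR Ω i j z⟫ := by
    rw [sum_swap_pairs]
    refine Finset.sum_congr rfl fun i _ => Finset.sum_congr rfl fun j _ =>
      Finset.sum_congr rfl fun k _ => Finset.sum_congr rfl fun l _ => ?_
    rw [hC]
  simp only [momentL, sum_inner, inner_add_left, inner_sub_left, Finset.sum_add_distrib,
    Finset.sum_sub_distrib, h1, h2]

/-- The weak form of the system, as the sum of the weak forms of its rows. -/
theorem weak_form_eq (hsym : m.Symmetric Ω) (x x' z : Conf Ω) (y' : Vel Ω) :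
    m.kin Ω y' (embL Ω z) + m.stored Ω x z + m.coupling Ω x' z =
      (∑ i, (⟪mulOp Ω m.ρ (velV Ω i y'), val (confU Ω z i)⟫
        + ∑ j, ⟪m.stressL x x' j i, grad (confU Ω z i) j⟫))
      + (⟪m.entropyRate x' y', val (confT Ω z)⟫ + ∑ i, ⟪m.fluxL x x' i, grad (confT Ω z) i⟫)
      + ∑ i, (⟪m.momentRate x' y' i, val (confR Ω z i)⟫
        + ∑ j, ⟪m.momentL x x' j i, grad (confR Ω z i) j⟫) := by
  have hk : ∀ i j, mulOp Ω (m.kap i j) = mulOp Ω (m.kap j i) := fun i j =>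
    mulOp_congr (by filter_upwards [hsym.kap_symm] with s hs using hs i j)
  have h1 := sum_inner_stressL hsym x x' z
  have h2 : ∑ i, ⟪m.fluxL x x' i, grad (confT Ω z) i⟫ = _ := sum_inner_fluxL hsym x x' z
  have h3 : ∑ i, ∑ j, ⟪m.momentL x x' j i, grad (confR Ω z i) j⟫ = _ :=
    sum_inner_momentL hsym x x' z
  have h4 : ∑ i, ∑ j, ⟪mulOp Ω (m.kap i j) (velM Ω i y'), vR Ω j z⟫ =
      ∑ i, ∑ j, ⟪mulOp Ω (m.kap i j) (velM Ω j y'), vR Ω i z⟫ := by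
    rw [Finset.sum_comm]
    refine Finset.sum_congr rfl fun i _ => Finset.sum_congr rfl fun j _ => ?_
    rw [hk]
  have e1 : ∀ i, velV Ω i (embL Ω z) = val (confU Ω z i) := fun i => rfl
  have e2 : velT Ω (embL Ω z) = val (confT Ω z) := rfl
  have e3 : ∀ i, velM Ω i (embL Ω z) = vR Ω i z := fun i => rfl
  have e4 : ∀ i, val (confR Ω z i) = vR Ω i z := fun i => rfl
  have e5 : vT Ω z = val (confT Ω z) := rfl
  rw [kin_apply, stored_apply, coupling_apply]
  simp only [e1, e2, e3, e4, e5, Finset.sum_add_distrib, Finset.sum_sub_distrib, h1, h2, h3, h4,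
    entropyRate, momentRate, inner_add_left, sum_inner]
  ring

end Material

section State

variable (Ω : Set E3)

set_option synthInstance.maxHeartbeats 200000 in
noncomputable scoped instance : NormedAddCommGroup (State Ω) := inferInstance

set_option synthInstance.maxHeartbeats 200000 in
noncomputable scoped instance : NormedSpace ℝ (State Ω) := inferInstance

set_option synthInstance.maxHeartbeats 200000 in
noncomputable scoped instance : Module ℝ (State Ω) := inferInstance

noncomputable scoped instance : TopologicalSpace (State Ω) := inferInstance

noncomputable scoped instance : AddCommGroup (State Ω) := inferInstance


/-- The configuration `(u, τ, R)` of a state. -/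
noncomputable def stateConf : State Ω →L[ℝ] Conf Ω :=
  (confEquiv Ω).symm.toContinuousLinearMap.comp
    ((ContinuousLinearMap.fst ℝ (W0v Ω) (L2v Ω × W0 Ω × L2 Ω × W0v Ω × L2v Ω)).prod
      ((WithLp.prodContinuousLinearEquiv 2 ℝ (W0 Ω) (W0v Ω)).symm.toContinuousLinearMap.comp
        (((ContinuousLinearMap.fst ℝ (W0 Ω) (L2 Ω × W0v Ω × L2v Ω)).prod
          ((ContinuousLinearMap.fst ℝ (W0v Ω) (L2v Ω)).comp
          ((ContinuousLinearMap.snd ℝ (L2 Ω) (W0v Ω × L2v Ω)).comp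
            (ContinuousLinearMap.snd ℝ (W0 Ω) (L2 Ω × W0v Ω × L2v Ω))))).comp
          ((ContinuousLinearMap.snd ℝ (L2v Ω) (W0 Ω × L2 Ω × W0v Ω × L2v Ω)).comp
            (ContinuousLinearMap.snd ℝ (W0v Ω) (L2v Ω × W0 Ω × L2 Ω × W0v Ω × L2v Ω))))))

/-- The velocities `(v, θ, M)` of a state. -/
noncomputable def stateVel : State Ω →L[ℝ] Vel Ω :=
  (velEquiv Ω).symm.toContinuousLinearMap.comp
    (((ContinuousLinearMap.fst ℝ (L2v Ω) (W0 Ω × L2 Ω × W0v Ω × L2v Ω)).prod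
      (((ContinuousLinearMap.fst ℝ (L2 Ω) (W0v Ω × L2v Ω)).prod
        ((ContinuousLinearMap.snd ℝ (W0v Ω) (L2v Ω)).comp
          (ContinuousLinearMap.snd ℝ (L2 Ω) (W0v Ω × L2v Ω)))).comp
        ((ContinuousLinearMap.snd ℝ (W0 Ω) (L2 Ω × W0v Ω × L2v Ω)).comp
          (ContinuousLinearMap.snd ℝ (L2v Ω) (W0 Ω × L2 Ω × W0v Ω × L2v Ω))))).comp
      (ContinuousLinearMap.snd ℝ (W0v Ω) (L2v Ω × W0 Ω × L2 Ω × W0v Ω × L2v Ω)))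

/-- States as pairs of a configuration and velocities. -/
noncomputable def stateEquiv : State Ω ≃ₗ[ℝ] Conf Ω × Vel Ω where
  toFun U := (stateConf Ω U, stateVel Ω U)
  map_add' U V := by rw [map_add, map_add]; rfl
  map_smul' c U := by rw [map_smul, map_smul]; rfl
  invFun q := (confU Ω q.1, (velEquiv Ω q.2).1, confT Ω q.1, (velEquiv Ω q.2).2.1, confR Ω q.1,
    (velEquiv Ω q.2).2.2)
  left_inv _ := rfl
  right_inv _ := rfl

variable {Ω}

theorem stateEquiv_apply (U : State Ω) : stateEquiv Ω U = (stateConf Ω U, stateVel Ω U) := rfl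

theorem confU_stateConf (U : State Ω) : confU Ω (stateConf Ω U) = cu U := rfl

theorem confT_stateConf (U : State Ω) : confT Ω (stateConf Ω U) = cτ U := rfl

theorem confR_stateConf (U : State Ω) : confR Ω (stateConf Ω U) = cR U := rfl

theorem sq_norm_state_le (U : State Ω) :
    ‖U‖ ^ 2 ≤ ‖stateConf Ω U‖ ^ 2 + ‖stateVel Ω U‖ ^ 2 := by
  have hx := sq_norm_conf (stateConf Ω U)
  rw [confU_stateConf, confT_stateConf, confR_stateConf] at hx
  have hy : ‖stateVel Ω U‖ = max ‖cv U‖ (max ‖cθ U‖ ‖cM U‖) := rfl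
  have hU : ‖U‖ = max ‖cu U‖ (max ‖cv U‖ (max ‖cτ U‖ (max ‖cθ U‖ (max ‖cR U‖ ‖cM U‖)))) := rfl
  set R := √(‖stateConf Ω U‖ ^ 2 + ‖stateVel Ω U‖ ^ 2) with hR
  have hR2 : R ^ 2 = ‖stateConf Ω U‖ ^ 2 + ‖stateVel Ω U‖ ^ 2 := Real.sq_sqrt (by positivity)
  have hRy : ‖stateVel Ω U‖ ≤ R := Real.le_sqrt_of_sq_le (by nlinarith [sq_nonneg ‖stateConf Ω U‖])
  have h0 := sq_nonneg ‖stateVel Ω U‖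
  have g1 := sq_nonneg ‖cu U‖
  have g2 := sq_nonneg ‖cτ U‖
  have g3 := sq_nonneg ‖cR U‖
  have a1 : ‖cu U‖ ≤ R := Real.le_sqrt_of_sq_le (by linarith)
  have a2 : ‖cτ U‖ ≤ R := Real.le_sqrt_of_sq_le (by linarith)
  have a3 : ‖cR U‖ ≤ R := Real.le_sqrt_of_sq_le (by linarith)
  rw [hy, max_le_iff, max_le_iff] at hRy
  rw [← hR2]
  refine pow_le_pow_left₀ (norm_nonneg _) ?_ 2
  rw [hU]
  exact max_le a1 (max_le hRy.1 (max_le a2 (max_le hRy.2.1 (max_le a3 hRy.2.2))))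

end State

namespace Material

variable (m : Material) (Ω : Set E3)

/-- The inner product of `ℋ` as a bounded bilinear form. -/
noncomputable def energyForm : State Ω →L[ℝ] State Ω →L[ℝ] ℝ :=
  (1 / 2 : ℝ) • ((m.kin Ω).bilinearComp (stateVel Ω) (stateVel Ω)
    + (m.stored Ω).bilinearComp (stateConf Ω) (stateConf Ω))

variable {m Ω}

theorem energyForm_apply (U V : State Ω) : m.energyForm Ω U V =
    (1 / 2) * (m.kin Ω (stateVel Ω U) (stateVel Ω V)
      + m.stored Ω (stateConf Ω U) (stateConf Ω V)) := by
  simp only [energyForm, _root_.smul_apply, _root_.add_apply,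
    ContinuousLinearMap.bilinearComp_apply, smul_eq_mul]

theorem energyInner_eq (hreg : m.Regular Ω) (U V : State Ω) :
    m.energyInner U V = m.energyForm Ω U V := by
  rw [energyForm_apply, energyInner]
  have h := ((hasInt_kin hreg (stateVel Ω U) (stateVel Ω V)).add
    (hasInt_stored hreg (stateConf Ω U) (stateConf Ω V))).2
  rw [← h]
  rfl

theorem energyNorm_eq (hreg : m.Regular Ω) (U : State Ω) :
    m.energyNorm U = √(m.energyForm Ω U U) := by
  rw [energyNorm, energyInner_eq hreg]

theorem energyForm_symm (hsym : m.Symmetric Ω) (U V : State Ω) :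
    m.energyForm Ω U V = m.energyForm Ω V U := by
  rw [energyForm_apply, energyForm_apply, kin_symm hsym, stored_symm hsym]

theorem exists_energyForm_coercive (hΩb : Bornology.IsBounded Ω) (hreg : m.Regular Ω)
    (hdiss : m.Dissipative Ω) (hcoer : m.Coercive Ω) :
    ∃ r : ℝ, 0 < r ∧ ∀ U, r * ‖U‖ ^ 2 ≤ m.energyForm Ω U U := by
  obtain ⟨r₁, hr₁, h₁⟩ := exists_kin_coercive hreg hdiss
  obtain ⟨r₂, hr₂, h₂⟩ := exists_stored_coercive hΩb hreg hcoer
  have hr : 0 < min r₁ r₂ := lt_min hr₁ hr₂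
  refine ⟨1 / 2 * min r₁ r₂, by positivity, fun U => ?_⟩
  rw [energyForm_apply, mul_assoc]
  refine mul_le_mul_of_nonneg_left ?_ (by norm_num)
  have e1 := mul_le_mul_of_nonneg_right (min_le_left r₁ r₂) (sq_nonneg ‖stateVel Ω U‖)
  have e2 := mul_le_mul_of_nonneg_right (min_le_right r₁ r₂) (sq_nonneg ‖stateConf Ω U‖)
  have e3 := mul_le_mul_of_nonneg_left (sq_norm_state_le U) hr.le
  linarith [h₁ (stateVel Ω U), h₂ (stateConf Ω U)]

/-- The graph of `𝒜`. -/
noncomputable def graph (m : Material) (Ω : Set E3) : Submodule ℝ (State Ω × State Ω) :=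
  systemGraph (stateEquiv Ω) (embL Ω) (m.kin Ω) (m.stored Ω) (m.coupling Ω)

theorem mem_graph_iff (U G : State Ω) : (U, G) ∈ m.graph Ω ↔
    embL Ω (stateConf Ω G) = stateVel Ω U ∧ ∀ z, m.kin Ω (stateVel Ω G) (embL Ω z)
      + m.stored Ω (stateConf Ω U) z + m.coupling Ω (stateConf Ω G) z = 0 := by
  rw [graph, mem_systemGraph, stateEquiv_apply, stateEquiv_apply]

theorem ae_dU (i j : Fin 3) (V : State Ω) :
    dU Ω i j (stateConf Ω V) =ᵐ[vol Ω] strain (cu V) i j := coeFn_strainL _ i j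

theorem isWeakDiv_stress_iff (hreg : m.Regular Ω) (U G : State Ω) (i : Fin 3) :
    IsWeakDiv Ω (fun j => m.stress (cu U) (cτ G) (cR U) j i) (fun s => m.ρ s * cv G i s) ↔
      ∀ w : W0 Ω, ⟪mulOp Ω m.ρ (velV Ω i (stateVel Ω G)), val w⟫
        + ∑ j, ⟪m.stressL (stateConf Ω U) (stateConf Ω G) j i, grad w j⟫ = 0 :=
  isWeakDiv_iff (qL := fun j => m.stressL (stateConf Ω U) (stateConf Ω G) j i)
    (fun j => ae_add (ae_sub (ae_sum fun k => ae_sum fun l => ae_mul (hreg.A_bdd j i k l)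
      (ae_dU k l U)) (ae_mul (hreg.a_bdd j i) .rfl))
      (ae_sum fun k => ae_sum fun l => ae_mul (hreg.B_bdd j i k l) .rfl))
    (ae_mul hreg.ρ_bdd .rfl)

theorem isWeakDiv_entropyFlux_iff (hreg : m.Regular Ω) (U G : State Ω) :
    IsWeakDiv Ω (m.entropyFlux (cτ U) (cτ G) (cR G))
      (fun s => m.c s * cθ G s + (∑ i, ∑ j, m.a i j s * strain (cu G) i j s)
        + ∑ i, ∑ j, m.b i j s * grad (cR G i) j s) ↔
      ∀ w : W0 Ω, ⟪m.entropyRate (stateConf Ω G) (stateVel Ω G), val w⟫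
        + ∑ i, ⟪m.fluxL (stateConf Ω U) (stateConf Ω G) i, grad w i⟫ = 0 :=
  isWeakDiv_iff (qL := m.fluxL (stateConf Ω U) (stateConf Ω G))
    (fun i => ae_sum fun j => ae_add (ae_add (ae_neg (ae_mul (hreg.d_bdd i j) .rfl))
      (ae_mul (hreg.K_bdd i j) .rfl)) (ae_mul (hreg.Kt_bdd i j) .rfl))
    (ae_add (ae_add (ae_mul hreg.c_bdd .rfl)
      (ae_sum fun i => ae_sum fun j => ae_mul (hreg.a_bdd i j) (ae_dU i j G)))
      (ae_sum fun i => ae_sum fun j => ae_mul (hreg.b_bdd i j) .rfl))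

theorem isWeakDiv_momentFlux_iff (hreg : m.Regular Ω) (U G : State Ω) (i : Fin 3) :
    IsWeakDiv Ω (fun j => m.momentFlux (cu U) (cτ G) (cR U) (cR G) j i)
      (fun s => (∑ j, m.kap i j s * cM G j s) + ∑ j, m.d i j s * grad (cτ G) j s) ↔
      ∀ w : W0 Ω, ⟪m.momentRate (stateConf Ω G) (stateVel Ω G) i, val w⟫
        + ∑ j, ⟪m.momentL (stateConf Ω U) (stateConf Ω G) j i, grad w j⟫ = 0 :=
  isWeakDiv_iff (qL := fun j => m.momentL (stateConf Ω U) (stateConf Ω G) j i)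
    (fun j => ae_add (ae_add (ae_sub (ae_sum fun k => ae_sum fun l => ae_mul (hreg.B_bdd k l j i)
      (ae_dU k l U)) (ae_mul (hreg.b_bdd j i) .rfl))
      (ae_sum fun k => ae_sum fun l => ae_mul (hreg.C_bdd j i k l) .rfl))
      (ae_sum fun k => ae_sum fun l => ae_mul (hreg.Ct_bdd j i k l) .rfl))
    (ae_add (ae_sum fun j => ae_mul (hreg.kap_bdd i j) .rfl)
      (ae_sum fun j => ae_mul (hreg.d_bdd i j) .rfl))

theorem embL_eq_iff (U G : State Ω) : embL Ω (stateConf Ω G) = stateVel Ω U ↔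
    valv (cu G) = cv U ∧ val (cτ G) = cθ U ∧ valv (cR G) = cM U := by
  refine Iff.trans (Prod.ext_iff (α := L2v Ω) (β := L2 Ω × L2v Ω)) (and_congr Iff.rfl ?_)
  exact Prod.ext_iff (α := L2 Ω) (β := L2v Ω)

theorem val_zero : val (0 : W0 Ω) = 0 := map_zero (valL Ω)

theorem grad_zero (j : Fin 3) : grad (0 : W0 Ω) j = 0 := map_zero (gradL Ω j)

theorem sum_row_single {n : ℕ} (f : Fin n → L2 Ω) (q : Fin n → Fin 3 → L2 Ω) (i : Fin n) (w : W0 Ω) :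
    ∑ k, (⟪f k, val ((Pi.single i w : Fin n → W0 Ω) k)⟫
      + ∑ j, ⟪q k j, grad ((Pi.single i w : Fin n → W0 Ω) k) j⟫) =
      ⟪f i, val w⟫ + ∑ j, ⟪q i j, grad w j⟫ := by
  rw [Finset.sum_eq_single i]
  · simp only [Pi.single_eq_same]
  · intro k _ hk
    simp only [Pi.single_eq_of_ne hk, val_zero, grad_zero, inner_zero_right, Finset.sum_const_zero,
      add_zero]
  · exact fun h => absurd (Finset.mem_univ i) h

theorem genEq_iff (hreg : m.Regular Ω) (hsym : m.Symmetric Ω) (U G : State Ω) :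
    m.GenEq U G ↔ (U, G) ∈ m.graph Ω := by
  rw [mem_graph_iff, embL_eq_iff]
  have hstr := isWeakDiv_stress_iff hreg U G
  have hent := isWeakDiv_entropyFlux_iff hreg U G
  have hmom := isWeakDiv_momentFlux_iff hreg U G
  have hweak := fun z => weak_form_eq hsym (stateConf Ω U) (stateConf Ω G) z (stateVel Ω G)
  generalize m.stressL (stateConf Ω U) (stateConf Ω G) = S at hstr hweak
  generalize m.fluxL (stateConf Ω U) (stateConf Ω G) = q at hent hweak
  generalize m.momentL (stateConf Ω U) (stateConf Ω G) = T at hmom hweak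
  generalize m.entropyRate (stateConf Ω G) (stateVel Ω G) = h at hent hweak
  generalize m.momentRate (stateConf Ω G) (stateVel Ω G) = k at hmom hweak
  generalize (fun i => mulOp Ω m.ρ (velV Ω i (stateVel Ω G))) = p at hstr hweak
  constructor
  · intro hg
    refine ⟨⟨hg.row_u, hg.row_τ, hg.row_R⟩, fun z => ?_⟩
    rw [hweak, Finset.sum_eq_zero fun i _ => (hstr i).1 (hg.row_v i) _, hent.1 hg.row_θ,
      Finset.sum_eq_zero fun i _ => (hmom i).1 (hg.row_M i) _, add_zero, add_zero]
  · rintro ⟨⟨h1, h2, h3⟩, hz⟩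
    simp only [hweak] at hz
    have key : ∀ (u : Fin 3 → W0 Ω) (τ : W0 Ω) (R : Fin 3 → W0 Ω),
        (∑ i, (⟪mulOp Ω m.ρ (velV Ω i (stateVel Ω G)), val (u i)⟫ + ∑ j, ⟪S j i, grad (u i) j⟫))
        + (⟪h, val τ⟫ + ∑ i, ⟪q i, grad τ i⟫)
        + ∑ i, (⟪k i, val (R i)⟫ + ∑ j, ⟪T j i, grad (R i) j⟫) = 0 := fun u τ R =>
      hz (stateConf Ω (WithLp.toLp 2 u, 0, τ, 0, WithLp.toLp 2 R, 0))
    refine ⟨h1, h2, h3, fun i => (hstr i).2 fun w => ?_, hent.2 fun w => ?_,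
      fun i => (hmom i).2 fun w => ?_⟩
    · have := key (Pi.single i w) 0 0
      rw [sum_row_single _ (fun i j => S j i)] at this
      simpa only [Pi.zero_apply, val_zero, grad_zero, inner_zero_right, Finset.sum_const_zero,
        add_zero] using this
    · have := key 0 w 0
      simpa only [Pi.zero_apply, val_zero, grad_zero, inner_zero_right, Finset.sum_const_zero,
        add_zero, zero_add] using this
    · have := key 0 0 (Pi.single i w)
      rw [sum_row_single _ (fun i j => T j i)] at this
      simpa only [Pi.zero_apply, val_zero, grad_zero, inner_zero_right, Finset.sum_const_zero,
        add_zero, zero_add] using this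

theorem denseRange_valv (hΩ : IsOpen Ω) (hΩb : Bornology.IsBounded Ω) :
    DenseRange (valvL Ω) := by
  have h1 : DenseRange (Pi.map fun _ : Fin 3 => valL Ω) :=
    DenseRange.piMap fun _ => denseRange_val hΩ hΩb
  have h2 := (PiLp.continuousLinearEquiv 2 ℝ (fun _ : Fin 3 => L2 Ω)).symm.surjective.denseRange.comp
    h1 (PiLp.continuousLinearEquiv 2 ℝ (fun _ : Fin 3 => L2 Ω)).symm.continuous
  refine Dense.mono ?_ h2
  rintro _ ⟨w, rfl⟩
  exact ⟨WithLp.toLp 2 w, rfl⟩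

theorem denseRange_embL (hΩ : IsOpen Ω) (hΩb : Bornology.IsBounded Ω) :
    DenseRange (embL Ω) := by
  have h : DenseRange (Prod.map (valvL Ω) (Prod.map (valL Ω) (valvL Ω))) :=
    (denseRange_valv hΩ hΩb).prodMap ((denseRange_val hΩ hΩb).prodMap (denseRange_valv hΩ hΩb))
  have h' := (velEquiv Ω).symm.surjective.denseRange.comp h (velEquiv Ω).symm.continuous
  refine Dense.mono ?_ h'
  rintro _ ⟨w, rfl⟩
  exact ⟨stateConf Ω (w.1, 0, w.2.1, 0, w.2.2, 0), rfl⟩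

theorem valvL_injective (hΩ : IsOpen Ω) (hΩb : Bornology.IsBounded Ω) :
    Function.Injective (valvL Ω) := fun u w h => by
  refine WithLp.ofLp_injective 2 (funext fun i => val_injective hΩ hΩb ?_)
  exact congrFun (congrArg WithLp.ofLp h) i

theorem embL_injective (hΩ : IsOpen Ω) (hΩb : Bornology.IsBounded Ω) :
    Function.Injective (embL Ω) := fun x z h => by
  have h' := congrArg (velEquiv Ω) h
  have h1 : confU Ω x = confU Ω z := valvL_injective hΩ hΩb (congrArg Prod.fst h')
  have h2 : confT Ω x = confT Ω z := val_injective hΩ hΩb (congrArg (fun y => y.2.1) h')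
  have h3 : confR Ω x = confR Ω z := valvL_injective hΩ hΩb (congrArg (fun y => y.2.2) h')
  have hx := sq_norm_conf (x - z)
  rw [map_sub, map_sub, map_sub, h1, h2, h3] at hx
  simpa [sub_eq_zero] using hx

end Material

end MicroTherm

namespace MicroTherm

open Filter Topology
open scoped RealInnerProductSpace

/-- A `C¹` function on `[0,∞)` extends to a `C¹` function on the line. -/
theorem exists_extension {E : Type*} [NormedAddCommGroup E] [NormedSpace ℝ E] [CompleteSpace E]
    {φ : ℝ → E} (hφ : ContDiffOn ℝ 1 φ (Ici 0)) :
    ∃ f g : ℝ → E, Continuous g ∧ (∀ t, HasDerivAt f (g t) t) ∧ EqOn f φ (Ici 0) := by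
  have hg : Continuous fun t => derivWithin φ (Ici 0) (max t 0) :=
    (hφ.continuousOn_derivWithin (uniqueDiffOn_Ici 0) le_rfl).comp_continuous (by fun_prop)
      fun t => le_max_right t 0
  refine ⟨fun t => φ 0 + ∫ s in (0 : ℝ)..t, derivWithin φ (Ici 0) (max s 0), _, hg,
    fun t => (hg.integral_hasStrictDerivAt 0 t).hasDerivAt.const_add _, fun t ht => ?_⟩
  have h := intervalIntegral.integral_eq_sub_of_hasDeriv_right_of_le (f := φ) (mem_Ici.1 ht)
    (hφ.continuousOn.mono Icc_subset_Ici_self) (fun s hs => ?_) (hg.intervalIntegrable 0 t)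
  · simp only [h, add_sub_cancel]
  · rw [max_eq_left hs.1.le]
    exact ((hφ.differentiableOn (by simp) s hs.1.le).hasDerivWithinAt).mono
      fun r hr => hs.1.le.trans (le_of_lt hr)

/-- Classical solution of the Cauchy problem for a graph which is dissipative for the energy form
`B`. -/
theorem exists_classical_solution {E : Type*} [NormedAddCommGroup E] [NormedSpace ℝ E]
    [CompleteSpace E] {B : E →L[ℝ] E →L[ℝ] ℝ} (hB : ∀ x y, B x y = B y x) {c : ℝ} (hc : 0 < c)
    (hcoer : ∀ x, c * ‖x‖ ^ 2 ≤ B x x) {P : Submodule ℝ (E × E)}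
    (hdiss : ∀ U G, (U, G) ∈ P → B G U ≤ 0)
    (hrange : ∀ r : ℝ, 0 < r → ∀ f, ∃ p ∈ P, r • p.1 - p.2 = f)
    (hsingle : ∀ y, ((0 : E), y) ∈ P → y = 0) {U₀ G₀ : E} (h₀ : (U₀, G₀) ∈ P) {φ : ℝ → E}
    (hφ : ContDiffOn ℝ 1 φ (Ici 0)) :
    ∃ U G : ℝ → E, ContDiffOn ℝ 1 U (Ici 0) ∧ ContinuousOn G (Ici 0) ∧
      (∀ t, 0 ≤ t → (U t, G t) ∈ P ∧ HasDerivWithinAt U (G t + φ t) (Ici 0) t) ∧ U 0 = U₀ := by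
  obtain ⟨f, g, hg, hf, hfF⟩ := exists_extension hφ
  obtain ⟨U, V, hV, hU0, h⟩ := exists_solution_of_form hB hc hcoer (fun p hp => hdiss p.1 p.2 hp)
    hrange hsingle h₀ hg hf
  have hfc : Continuous f := continuous_iff_continuousAt.2 fun t => (hf t).continuousAt
  refine ⟨U, fun t => V t - f t, ?_, (hV.sub hfc).continuousOn, fun t ht => ⟨(h t ht).2, ?_⟩, hU0⟩
  · rw [contDiffOn_one_iff_derivWithin (uniqueDiffOn_Ici 0)]
    refine ⟨fun t ht => (h t ht).1.differentiableWithinAt, hV.continuousOn.congr fun t ht => ?_⟩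
    exact (h t ht).1.derivWithin (uniqueDiffOn_Ici 0 t ht)
  · rw [← hfF ht, sub_add_cancel]
    exact (h t ht).1

/-- Classical solution of the Cauchy problem for a second order system in weak form. -/
theorem exists_classical_solution_systemGraph {E X Y : Type*} [NormedAddCommGroup E]
    [NormedSpace ℝ E] [CompleteSpace E] [NormedAddCommGroup X] [InnerProductSpace ℝ X]
    [CompleteSpace X] [NormedAddCommGroup Y] [NormedSpace ℝ Y]
    {B : E →L[ℝ] E →L[ℝ] ℝ} {e : E ≃ₗ[ℝ] X × Y} {ι : X →L[ℝ] Y} {kin : Y →L[ℝ] Y →L[ℝ] ℝ}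
    {W N : X →L[ℝ] X →L[ℝ] ℝ}
    (hBe : ∀ U V, B U V = (1 / 2) * (kin (e U).2 (e V).2 + W (e U).1 (e V).1))
    (hB : ∀ x y, B x y = B y x) {c : ℝ} (hc : 0 < c) (hcoer : ∀ x, c * ‖x‖ ^ 2 ≤ B x x)
    {c₁ : ℝ} (hc₁ : 0 < c₁) (hkin : ∀ y, c₁ * ‖y‖ ^ 2 ≤ kin y y)
    (hWsymm : ∀ x y, W x y = W y x) {c₂ : ℝ} (hc₂ : 0 < c₂) (hW : ∀ x, c₂ * ‖x‖ ^ 2 ≤ W x x)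
    (hN : ∀ x, 0 ≤ N x x) (hι : Function.Injective ι) (hd : DenseRange ι) {U₀ G₀ : E}
    (h₀ : (U₀, G₀) ∈ systemGraph e ι kin W N) {φ : ℝ → E} (hφ : ContDiffOn ℝ 1 φ (Ici 0)) :
    ∃ U G : ℝ → E, ContDiffOn ℝ 1 U (Ici 0) ∧ ContinuousOn G (Ici 0) ∧
      (∀ t, 0 ≤ t → (U t, G t) ∈ systemGraph e ι kin W N ∧
        HasDerivWithinAt U (G t + φ t) (Ici 0) t) ∧ U 0 = U₀ := by
  refine exists_classical_solution hB hc hcoer (fun U G h => ?_)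
    (fun r hr f => systemGraph_range hc₂ hW hN (fun y => le_trans (by positivity) (hkin y)) hr f)
    (fun y hy => systemGraph_single hι hd hc₁ hkin hy) h₀ hφ
  rw [hBe]
  exact mul_nonpos_of_nonneg_of_nonpos (by norm_num) (systemGraph_dissip hWsymm hN h)

theorem aestronglyMeasurable_det {α : Type*} [MeasurableSpace α] {μ : Measure α} {n : ℕ}
    {M : α → Matrix (Fin n) (Fin n) ℝ} (hM : ∀ i j, AEStronglyMeasurable (fun x => M x i j) μ) :
    AEStronglyMeasurable (fun x => (M x).det) μ := by
  simp only [Matrix.det_apply]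
  refine Finset.aestronglyMeasurable_fun_sum _ fun σ _ => AEStronglyMeasurable.const_smul ?_ _
  exact Finset.aestronglyMeasurable_fun_prod _ fun i _ => hM _ _

theorem aestronglyMeasurable_inv {α : Type*} [MeasurableSpace α] {μ : Measure α} {n : ℕ}
    {M : α → Matrix (Fin n) (Fin n) ℝ} (hM : ∀ i j, AEStronglyMeasurable (fun x => M x i j) μ)
    (i j : Fin n) : AEStronglyMeasurable (fun x => (M x)⁻¹ i j) μ := by
  simp only [Matrix.inv_def, Matrix.smul_apply, smul_eq_mul, Matrix.adjugate_apply,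
    Ring.inverse_eq_inv']
  refine ((aestronglyMeasurable_det hM).aemeasurable.inv.aestronglyMeasurable).mul ?_
  refine aestronglyMeasurable_det fun k l => ?_
  simp only [Matrix.updateRow_apply]
  split_ifs
  · exact aestronglyMeasurable_const
  · exact hM k l

/-- The entries of the inverse of a coercive matrix are bounded. -/
theorem abs_inv_apply_le {n : ℕ} {M : Matrix (Fin n) (Fin n) ℝ} {r : ℝ} (hr : 0 < r)
    (hM : ∀ ξ : Fin n → ℝ, r * ∑ i, ξ i * ξ i ≤ ∑ i, ∑ j, M i j * ξ i * ξ j) (i j : Fin n) :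
    |M⁻¹ i j| ≤ 1 / r := by
  by_cases hdet : IsUnit M.det
  · have hmul := Matrix.mul_nonsing_inv M hdet
    have hcol : ∀ k, ∑ l, M k l * M⁻¹ l j = if k = j then 1 else 0 := fun k => by
      rw [← Matrix.mul_apply, hmul, Matrix.one_apply]
    have h1 := hM fun l => M⁻¹ l j
    have h2 : ∑ k, ∑ l, M k l * M⁻¹ k j * M⁻¹ l j = M⁻¹ j j := by
      have : ∀ k, ∑ l, M k l * M⁻¹ k j * M⁻¹ l j = M⁻¹ k j * if k = j then 1 else 0 := fun k => by
        rw [← hcol k, Finset.mul_sum]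
        exact Finset.sum_congr rfl fun l _ => by ring
      simp [this]
    rw [h2] at h1
    have h3 : ∀ k, M⁻¹ k j * M⁻¹ k j ≤ ∑ l, M⁻¹ l j * M⁻¹ l j := fun k =>
      Finset.single_le_sum (f := fun l => M⁻¹ l j * M⁻¹ l j) (fun l _ => mul_self_nonneg _)
        (Finset.mem_univ k)
    have h4 : r * M⁻¹ j j ≤ 1 := by
      by_contra hlt
      push Not at hlt
      have := mul_le_mul_of_nonneg_left (h3 j) hr.le
      have hpos : 0 < M⁻¹ j j := by
        by_contra hn
        nlinarith
      nlinarith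
    have h5 : r * (M⁻¹ i j * M⁻¹ i j) ≤ M⁻¹ j j :=
      (mul_le_mul_of_nonneg_left (h3 i) hr.le).trans h1
    rw [le_div_iff₀ hr]
    have h6 : (|M⁻¹ i j| * r) ^ 2 ≤ 1 := by
      rw [mul_pow, sq_abs]
      nlinarith
    exact (sq_le_one_iff₀ (mul_nonneg (abs_nonneg _) hr.le)).1 h6
  · rw [Matrix.nonsing_inv_apply_not_isUnit _ hdet]
    simp only [Matrix.zero_apply, abs_zero]
    positivity

namespace Material

variable {m : Material} {Ω : Set E3}

theorem memLp_ell (hreg : m.Regular Ω) (i j : Fin 3) : MemLp (m.ell i j) ∞ (vol Ω) := by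
  obtain ⟨r, hr, h⟩ := hreg.kap_pos
  refine memLp_top_of_bound (aestronglyMeasurable_inv (fun k l => (hreg.kap_bdd k l).1) i j)
    (1 / r) ?_
  filter_upwards [h] with x hx
  exact abs_inv_apply_le hr hx i j

theorem memLp_ell_mul (hreg : m.Regular Ω) (i j : Fin 3) :
    MemLp (fun x => m.ell i j x * m.ρ x) ∞ (vol Ω) :=
  hreg.ρ_bdd.mul (memLp_ell hreg i j)

theorem memLp_ρ_div_c (hreg : m.Regular Ω) : MemLp (fun x => m.ρ x / m.c x) ∞ (vol Ω) := by
  obtain ⟨r, hr, h⟩ := hreg.c_pos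
  have hc : MemLp (fun x => (m.c x)⁻¹) ∞ (vol Ω) := by
    refine memLp_top_of_bound hreg.c_bdd.1.aemeasurable.inv.aestronglyMeasurable r⁻¹ ?_
    filter_upwards [h] with x hx
    rw [Real.norm_of_nonneg (inv_nonneg.2 (hr.le.trans hx))]
    exact inv_anti₀ hr hx
  simp only [div_eq_mul_inv]
  exact hc.mul hreg.ρ_bdd

/-- The state `ℱ` as a function of the values of the loads. -/
noncomputable def source (m : Material) (Ω : Set E3) : (L2v Ω × L2 Ω × L2v Ω) →ₗ[ℝ] State Ω where
  toFun q := (0, q.1, 0, mulOp Ω (fun x => m.ρ x / m.c x) q.2.1, 0,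
    WithLp.toLp 2 fun i => ∑ j, mulOp Ω (fun x => m.ell i j x * m.ρ x) (q.2.2 j))
  map_add' p q := by
    refine Prod.ext (add_zero _).symm (Prod.ext rfl (Prod.ext (add_zero _).symm
      (Prod.ext (map_add _ _ _) (Prod.ext (add_zero _).symm ?_))))
    refine WithLp.ofLp_injective 2 (funext fun i => ?_)
    simp [Finset.sum_add_distrib]
  map_smul' c q := by
    refine Prod.ext (smul_zero _).symm (Prod.ext rfl (Prod.ext (smul_zero _).symm
      (Prod.ext (map_smul _ _ _) (Prod.ext (smul_zero _).symm ?_))))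
    refine WithLp.ofLp_injective 2 (funext fun i => ?_)
    simp [Finset.smul_sum]

theorem continuous_source : Continuous (m.source Ω) := by
  refine continuous_const.prodMk (continuous_fst.prodMk (continuous_const.prodMk
    (((mulOp Ω _).continuous.comp (continuous_fst.comp continuous_snd)).prodMk
      (continuous_const.prodMk ?_))))
  refine (PiLp.continuous_toLp 2 _).comp (continuous_pi fun i => continuous_finsetSum _ fun j _ => ?_)
  exact (mulOp Ω _).continuous.comp ((PiLp.continuous_apply 2 (fun _ : Fin 3 => L2 Ω) j).comp
    (continuous_snd.comp continuous_snd))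

/-- `source` as a bounded operator. -/
noncomputable def sourceL (m : Material) (Ω : Set E3) : (L2v Ω × L2 Ω × L2v Ω) →L[ℝ] State Ω :=
  ⟨m.source Ω, continuous_source⟩

end Material

namespace Loads

variable {m : Material} {Ω : Set E3}

/-- The values of the loads. -/
noncomputable def vals (F : Loads Ω) (t : ℝ) : L2v Ω × L2 Ω × L2v Ω :=
  (valv (F.f t), val (F.s t), valv (F.Q t))

theorem toState_eq (hreg : m.Regular Ω) (F : Loads Ω) (t : ℝ) :
    F.toState m t = m.sourceL Ω (F.vals t) := by
  simp only [toState, mulL2_eq_mulOp (Material.memLp_ρ_div_c hreg),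
    mulL2_eq_mulOp (Material.memLp_ell_mul hreg _ _)]
  rfl

theorem contDiffOn_vals (F : Loads Ω) : ContDiffOn ℝ 1 F.vals (Ici 0) :=
  F.f_contDiff.prodMk (F.s_contDiff.prodMk F.Q_contDiff)

theorem contDiffOn_toState (hreg : m.Regular Ω) (F : Loads Ω) :
    ContDiffOn ℝ 1 (F.toState m) (Ici 0) :=
  ((m.sourceL Ω).contDiff.comp_contDiffOn F.contDiffOn_vals).congr fun t _ => toState_eq hreg F t

end Loads

namespace Material

variable {m : Material} {Ω : Set E3}

theorem graph_dissip (hreg : m.Regular Ω) (hsym : m.Symmetric Ω) (hdiss : m.Dissipative Ω)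
    {U G : State Ω} (hp : (U, G) ∈ m.graph Ω) : m.energyForm Ω G U ≤ 0 := by
  obtain ⟨h1, h2⟩ := (mem_graph_iff U G).1 hp
  have h3 := h2 (stateConf Ω G)
  have h4 := coupling_nonneg hreg hsym hdiss (stateConf Ω G)
  have h5 := stored_symm hsym (stateConf Ω G) (stateConf Ω U)
  rw [h1] at h3
  rw [energyForm_apply]
  linarith

theorem graph_sub {U G U' G' : State Ω} (h : (U, G) ∈ m.graph Ω) (h' : (U', G') ∈ m.graph Ω) :
    (U - U', G - G') ∈ m.graph Ω := by
  have h₃ := (m.graph Ω).sub_mem h h'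
  rwa [Prod.mk_sub_mk] at h₃

set_option maxHeartbeats 2000000 in
theorem exists_isSolution (hΩ : IsOpen Ω) (hΩb : Bornology.IsBounded Ω) (hreg : m.Regular Ω)
    (hsym : m.Symmetric Ω) (hdiss : m.Dissipative Ω) (hcoer : m.Coercive Ω) (F : Loads Ω)
    {U₀ : State Ω} (hU₀ : U₀ ∈ m.genDomain Ω) : ∃ U, IsSolution m F U₀ U := by
  obtain ⟨r₁, hr₁, h₁⟩ := exists_kin_coercive hreg hdiss
  obtain ⟨r₂, hr₂, h₂⟩ := exists_stored_coercive hΩb hreg hcoer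
  obtain ⟨r, hr, hB⟩ := exists_energyForm_coercive hΩb hreg hdiss hcoer
  have hs : ∀ U V, m.energyForm Ω U V = m.energyForm Ω V U := energyForm_symm hsym
  obtain ⟨G₀, hG₀⟩ := hU₀
  have hp := (genEq_iff hreg hsym _ _).1 hG₀
  have hBe : ∀ U V, m.energyForm Ω U V = (1 / 2) * (m.kin Ω (stateEquiv Ω U).2 (stateEquiv Ω V).2
      + m.stored Ω (stateEquiv Ω U).1 (stateEquiv Ω V).1) := fun U V => by
    rw [energyForm_apply, stateEquiv_apply, stateEquiv_apply]
  rw [graph] at hp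
  obtain ⟨U, G, hU, hG, h, hU0⟩ := exists_classical_solution_systemGraph (B := m.energyForm Ω)
    (e := stateEquiv Ω) (kin := m.kin Ω) (W := m.stored Ω) (N := m.coupling Ω) hBe hs hr hB hr₁ h₁
    (stored_symm hsym) hr₂ h₂ (coupling_nonneg hreg hsym hdiss) (embL_injective hΩ hΩb)
    (denseRange_embL hΩ hΩb) hp (F.contDiffOn_toState hreg)
  refine ⟨U, hU, ⟨G, hG, fun t ht => ⟨(genEq_iff hreg hsym _ _).2 ?_, (h t ht).2⟩⟩, hU0⟩
  rw [graph]
  exact (h t ht).1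

/-- Energy estimate for the difference of two solutions. -/
theorem energyNorm_sub_le (hΩb : Bornology.IsBounded Ω) (hreg : m.Regular Ω)
    (hsym : m.Symmetric Ω) (hdiss : m.Dissipative Ω) (hcoer : m.Coercive Ω) {F F' : Loads Ω}
    {U₀ U₀' : State Ω} {U U' : ℝ → State Ω} (hU : IsSolution m F U₀ U)
    (hU' : IsSolution m F' U₀' U') {t : ℝ} (ht : 0 ≤ t) :
    m.energyNorm (U t - U' t) ≤ m.energyNorm (U₀ - U₀') +
      ∫ ξ in (0 : ℝ)..t, m.energyNorm (F.toState m ξ - F'.toState m ξ) := by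
  obtain ⟨r, hr, hB⟩ := exists_energyForm_coercive hΩb hreg hdiss hcoer
  have hs : ∀ U V, m.energyForm Ω U V = m.energyForm Ω V U := energyForm_symm hsym
  obtain ⟨G, hGc, hG⟩ := hU.evolution
  obtain ⟨G', hGc', hG'⟩ := hU'.evolution
  have h := sqrt_form_le_add_integral (B := m.energyForm Ω) hs hr hB (U := fun t => U t - U' t)
    (G := fun t => G t - G' t) (F := fun t => F.toState m t - F'.toState m t)
    (fun s hs => (((hG s hs).2).sub (hG' s hs).2).congr_deriv (by abel))
    (fun s hs => ?_)
    (((F.contDiffOn_toState hreg).continuousOn).sub (F'.contDiffOn_toState hreg).continuousOn) ht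
  · simp only [energyNorm_eq hreg]
    rwa [hU.initial, hU'.initial] at h
  · exact graph_dissip hreg hsym hdiss (graph_sub ((genEq_iff hreg hsym _ _).1 (hG s hs).1)
      ((genEq_iff hreg hsym _ _).1 (hG' s hs).1))

/-- Energy estimate for a solution. -/
theorem energyNorm_le (hΩb : Bornology.IsBounded Ω) (hreg : m.Regular Ω)
    (hsym : m.Symmetric Ω) (hdiss : m.Dissipative Ω) (hcoer : m.Coercive Ω) {F : Loads Ω}
    {U₀ : State Ω} {U : ℝ → State Ω} (hU : IsSolution m F U₀ U) {t : ℝ} (ht : 0 ≤ t) :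
    m.energyNorm (U t) ≤ m.energyNorm U₀ + ∫ ξ in (0 : ℝ)..t, m.energyNorm (F.toState m ξ) := by
  obtain ⟨r, hr, hB⟩ := exists_energyForm_coercive hΩb hreg hdiss hcoer
  have hs : ∀ U V, m.energyForm Ω U V = m.energyForm Ω V U := energyForm_symm hsym
  obtain ⟨G, hGc, hG⟩ := hU.evolution
  have h := sqrt_form_le_add_integral (B := m.energyForm Ω) hs hr hB (U := U)
    (G := G) (F := F.toState m) (fun s hs => (hG s hs).2)
    (fun s hs => graph_dissip hreg hsym hdiss ((genEq_iff hreg hsym _ _).1 (hG s hs).1))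
    (F.contDiffOn_toState hreg).continuousOn ht
  simp only [energyNorm_eq hreg]
  rwa [hU.initial] at h

theorem exists_energyNorm_equiv (hΩb : Bornology.IsBounded Ω) (hreg : m.Regular Ω)
    (hdiss : m.Dissipative Ω) (hcoer : m.Coercive Ω) :
    ∃ k₁ k₂ : ℝ, 0 < k₁ ∧ 0 < k₂ ∧ ∀ U : State Ω,
      k₁ * ‖U‖ ≤ m.energyNorm U ∧ m.energyNorm U ≤ k₂ * ‖U‖ := by
  obtain ⟨r, hr, hB⟩ := exists_energyForm_coercive hΩb hreg hdiss hcoer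
  set K : ℝ := ‖m.energyForm Ω‖ + 1 with hK
  have hKpos : 0 < K := by
    have := (m.energyForm Ω).opNorm_nonneg
    positivity
  refine ⟨√r, √K, Real.sqrt_pos.2 hr, Real.sqrt_pos.2 hKpos, fun U => ?_⟩
  have h1 : √r * ‖U‖ = √(r * ‖U‖ ^ 2) := by
    rw [Real.sqrt_mul hr.le, Real.sqrt_sq (norm_nonneg _)]
  have h2 : √K * ‖U‖ = √(K * ‖U‖ ^ 2) := by
    rw [Real.sqrt_mul hKpos.le, Real.sqrt_sq (norm_nonneg _)]
  rw [energyNorm_eq hreg, h1, h2]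
  refine ⟨Real.sqrt_le_sqrt (hB U), Real.sqrt_le_sqrt ?_⟩
  have h3 := (le_abs_self _).trans ((m.energyForm Ω).le_opNorm₂ U U)
  nlinarith [sq_nonneg ‖U‖]

theorem exists_energyNorm_sourceL_le (hΩb : Bornology.IsBounded Ω) (hreg : m.Regular Ω)
    (hdiss : m.Dissipative Ω) (hcoer : m.Coercive Ω) :
    ∃ C : ℝ, 0 < C ∧ ∀ q : L2v Ω × L2 Ω × L2v Ω,
      m.energyNorm (m.sourceL Ω q) ≤ C * (‖q.1‖ + ‖q.2.1‖ + ‖q.2.2‖) := by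
  obtain ⟨k₁, k₂, -, hk, h⟩ := exists_energyNorm_equiv hΩb hreg hdiss hcoer
  have h0 := (m.sourceL Ω).opNorm_nonneg
  refine ⟨k₂ * (‖m.sourceL Ω‖ + 1), by positivity, fun q => (h _).2.trans ?_⟩
  rw [mul_assoc]
  refine mul_le_mul_of_nonneg_left ?_ hk.le
  have h1 : ‖q‖ ≤ ‖q.1‖ + ‖q.2.1‖ + ‖q.2.2‖ := by
    have a := norm_nonneg q.1
    have b := norm_nonneg q.2.1
    have c := norm_nonneg q.2.2
    exact max_le (by linarith) (max_le (by linarith) (by linarith))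
  have h2 : ‖q‖ ≥ 0 := norm_nonneg q
  calc ‖m.sourceL Ω q‖ ≤ ‖m.sourceL Ω‖ * ‖q‖ := (m.sourceL Ω).le_opNorm q
    _ ≤ (‖m.sourceL Ω‖ + 1) * (‖q.1‖ + ‖q.2.1‖ + ‖q.2.2‖) := by gcongr; linarith

theorem integral_energyNorm_sourceL_le (hreg : m.Regular Ω) {C : ℝ}
    (hC : ∀ q : L2v Ω × L2 Ω × L2v Ω,
      m.energyNorm (m.sourceL Ω q) ≤ C * (‖q.1‖ + ‖q.2.1‖ + ‖q.2.2‖))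
    {q : ℝ → L2v Ω × L2 Ω × L2v Ω} (hq : ContinuousOn q (Ici 0)) {t : ℝ} (ht : 0 ≤ t) :
    ∫ ξ in (0 : ℝ)..t, m.energyNorm (m.sourceL Ω (q ξ)) ≤
      C * ∫ ξ in (0 : ℝ)..t, (‖(q ξ).1‖ + ‖(q ξ).2.1‖ + ‖(q ξ).2.2‖) := by
  rw [← intervalIntegral.integral_const_mul]
  have hq' : ContinuousOn q (uIcc 0 t) := hq.mono (by
    rw [uIcc_of_le ht]; exact Icc_subset_Ici_self)
  have hs : ContinuousOn (fun ξ => m.sourceL Ω (q ξ)) (uIcc 0 t) :=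
    (m.sourceL Ω).continuous.comp_continuousOn hq'
  refine intervalIntegral.integral_mono_on ht ?_ ?_ fun ξ _ => hC _
  · refine ContinuousOn.intervalIntegrable ?_
    simp only [energyNorm_eq hreg]
    exact (((m.energyForm Ω).continuous.comp_continuousOn hs).clm_apply hs).sqrt
  · refine ContinuousOn.intervalIntegrable (continuousOn_const.mul ?_)
    exact ((continuous_fst.comp_continuousOn hq').norm.add
      ((continuous_fst.comp continuous_snd).comp_continuousOn hq').norm).add
      ((continuous_snd.comp continuous_snd).comp_continuousOn hq').norm

theorem integral_energyNorm_toState_le (hreg : m.Regular Ω) {C : ℝ}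
    (hC : ∀ q : L2v Ω × L2 Ω × L2v Ω,
      m.energyNorm (m.sourceL Ω q) ≤ C * (‖q.1‖ + ‖q.2.1‖ + ‖q.2.2‖))
    (F : Loads Ω) {t : ℝ} (ht : 0 ≤ t) :
    ∫ ξ in (0 : ℝ)..t, m.energyNorm (F.toState m ξ) ≤
      C * ∫ ξ in (0 : ℝ)..t, (‖valv (F.f ξ)‖ + ‖val (F.s ξ)‖ + ‖valv (F.Q ξ)‖) := by
  simp only [Loads.toState_eq hreg]
  exact integral_energyNorm_sourceL_le hreg hC F.contDiffOn_vals.continuousOn ht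

theorem integral_energyNorm_toState_sub_le (hreg : m.Regular Ω) {C : ℝ}
    (hC : ∀ q : L2v Ω × L2 Ω × L2v Ω,
      m.energyNorm (m.sourceL Ω q) ≤ C * (‖q.1‖ + ‖q.2.1‖ + ‖q.2.2‖))
    (F F' : Loads Ω) {t : ℝ} (ht : 0 ≤ t) :
    ∫ ξ in (0 : ℝ)..t, m.energyNorm (F.toState m ξ - F'.toState m ξ) ≤
      C * ∫ ξ in (0 : ℝ)..t, (‖valv (F.f ξ) - valv (F'.f ξ)‖ + ‖val (F.s ξ) - val (F'.s ξ)‖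
        + ‖valv (F.Q ξ) - valv (F'.Q ξ)‖) := by
  simp only [Loads.toState_eq hreg, ← map_sub]
  exact integral_energyNorm_sourceL_le hreg hC
    (F.contDiffOn_vals.continuousOn.sub F'.contDiffOn_vals.continuousOn) ht

/-- Solutions are unique. -/
theorem eqOn_of_isSolution (hΩb : Bornology.IsBounded Ω) (hreg : m.Regular Ω)
    (hsym : m.Symmetric Ω) (hdiss : m.Dissipative Ω) (hcoer : m.Coercive Ω) {F : Loads Ω}
    {U₀ : State Ω} {U V : ℝ → State Ω} (hU : IsSolution m F U₀ U) (hV : IsSolution m F U₀ V) :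
    EqOn U V (Ici 0) := by
  intro t ht
  obtain ⟨k₁, k₂, hk₁, -, hk⟩ := exists_energyNorm_equiv hΩb hreg hdiss hcoer
  have h := energyNorm_sub_le hΩb hreg hsym hdiss hcoer hU hV ht
  have h0 : m.energyNorm (0 : State Ω) = 0 :=
    le_antisymm (by simpa using (hk 0).2) (by simpa using (hk 0).1)
  simp only [sub_self, h0, intervalIntegral.integral_zero, add_zero] at h
  have h1 := (hk (U t - V t)).1.trans h
  have h2 : ‖U t - V t‖ ≤ 0 := by nlinarith [norm_nonneg (U t - V t)]
  exact sub_eq_zero.1 (norm_le_zero_iff.1 h2)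

end Material

end MicroTherm

theorem theorem2 (Ω : Set MicroTherm.E3) (hΩ : IsOpen Ω) (hΩb : Bornology.IsBounded Ω)
    (m : MicroTherm.Material) (hreg : m.Regular Ω)
    (hsym : m.Symmetric Ω) (hdiss : m.Dissipative Ω) (hcoer : m.Coercive Ω) :
    -- the energy norm is equivalent to the usual norm of the state space
    (∃ k₁ k₂ : ℝ, 0 < k₁ ∧ 0 < k₂ ∧ ∀ U : MicroTherm.State Ω,
      k₁ * ‖U‖ ≤ m.energyNorm U ∧ m.energyNorm U ≤ k₂ * ‖U‖) ∧
    -- existence and uniqueness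
    (∀ (F : MicroTherm.Loads Ω), ∀ U₀ ∈ m.genDomain Ω,
      ∃ U : ℝ → MicroTherm.State Ω, MicroTherm.IsSolution m F U₀ U ∧
        ∀ V : ℝ → MicroTherm.State Ω, MicroTherm.IsSolution m F U₀ V →
          Set.EqOn V U (Set.Ici 0)) ∧
    -- the energy estimate
    (∀ (F : MicroTherm.Loads Ω), ∀ U₀ ∈ m.genDomain Ω, ∀ U : ℝ → MicroTherm.State Ω,
      MicroTherm.IsSolution m F U₀ U → ∀ t, 0 ≤ t →
        m.energyNorm (U t) ≤ m.energyNorm U₀ + ∫ ξ in (0 : ℝ)..t, m.energyNorm (F.toState m ξ)) ∧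
    -- the estimate by the loads, and continuous dependence on initial data and loads
    (∃ C : ℝ, 0 < C ∧
      (∀ (F : MicroTherm.Loads Ω), ∀ U₀ ∈ m.genDomain Ω, ∀ U : ℝ → MicroTherm.State Ω,
        MicroTherm.IsSolution m F U₀ U → ∀ t, 0 ≤ t →
          m.energyNorm (U t) ≤ m.energyNorm U₀ + C * ∫ ξ in (0 : ℝ)..t,
            (‖MicroTherm.valv (F.f ξ)‖ + ‖MicroTherm.val (F.s ξ)‖
              + ‖MicroTherm.valv (F.Q ξ)‖)) ∧
      (∀ (F F' : MicroTherm.Loads Ω), ∀ U₀ ∈ m.genDomain Ω, ∀ U₀' ∈ m.genDomain Ω,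
        ∀ U U' : ℝ → MicroTherm.State Ω,
        MicroTherm.IsSolution m F U₀ U → MicroTherm.IsSolution m F' U₀' U' → ∀ t, 0 ≤ t →
          m.energyNorm (U t - U' t) ≤ m.energyNorm (U₀ - U₀') + C * ∫ ξ in (0 : ℝ)..t,
            (‖MicroTherm.valv (F.f ξ) - MicroTherm.valv (F'.f ξ)‖
              + ‖MicroTherm.val (F.s ξ) - MicroTherm.val (F'.s ξ)‖
              + ‖MicroTherm.valv (F.Q ξ) - MicroTherm.valv (F'.Q ξ)‖))) := by
  obtain ⟨C, hC, hCs⟩ :=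
    MicroTherm.Material.exists_energyNorm_sourceL_le hΩb hreg hdiss hcoer
  refine ⟨MicroTherm.Material.exists_energyNorm_equiv hΩb hreg hdiss hcoer, fun F U₀ hU₀ => ?_,
    fun F U₀ _ U hU t ht => MicroTherm.Material.energyNorm_le hΩb hreg hsym hdiss hcoer hU ht,
    C, hC, fun F U₀ _ U hU t ht => ?_, fun F F' U₀ _ U₀' _ U U' hU hU' t ht => ?_⟩
  · obtain ⟨U, hU⟩ := MicroTherm.Material.exists_isSolution hΩ hΩb hreg hsym hdiss hcoer F hU₀
    exact ⟨U, hU, fun V hV =>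
      MicroTherm.Material.eqOn_of_isSolution hΩb hreg hsym hdiss hcoer hV hU⟩
  · exact (MicroTherm.Material.energyNorm_le hΩb hreg hsym hdiss hcoer hU ht).trans
      (add_le_add_right (MicroTherm.Material.integral_energyNorm_toState_le hreg hCs F ht) _)
  · exact (MicroTherm.Material.energyNorm_sub_le hΩb hreg hsym hdiss hcoer hU hU' ht).trans
      (add_le_add_right
        (MicroTherm.Material.integral_energyNorm_toState_sub_le hreg hCs F F' ht) _)
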